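/- Let $q=e^{2\pi i/3}$. For $n\ge 0$ let $\tilde Z_n(z_1,\dots,z_{2n})$ be the partition function of the six-vertex model on the $n\times n$ grid with domain wall boundary conditions (each edge carries an arrow, two arrows enter and two leave each vertex; the boundary arrows at the left and right point in, those at the top and bottom point out). Row $i$ carries the parameter $z_i$ and column $j$ the parameter $z_{n+j}$, and a vertex with row parameter $z$ and column parameter $w$ has weight $a=q^{-1/2}w-q^{1/2}z$ if its arrows are (right, up) or (left, down), $b=q^{-1/2}z-q^{1/2}w$ if they are (left, up) or (right, down), and $c=(q^{-1}-q)z^{1/2}w^{1/2}$ for the two remaining patterns. For $z_1,\dots,z_{2n}\neq 0$ put $$Z_n=(-1)^{n(n-1)/2}(q^{-1}-q)^{-n}\prod_{i=1}^{2n}z_i^{-1/2}\;\tilde Z_n .$$ Define $$Z'_n=(-1)^{\binom n2}\prod_{1\le i<j\le 2n}(qz_i-q^{-1}z_j)\oint\!\cdots\!\oint\prod_{l=1}^n\frac{dw_l}{2\pi i}\;\frac{(qz_{2l-1}-q^{-1}w_l)\prod_{m>l}(w_m-w_l)(qw_l-q^{-1}w_m)}{\prod_{i\le 2l-1}(w_l-z_i)\prod_{i\ge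 2l-1}(qw_l-q^{-1}z_i)},$$ where each integration contour has winding number $1$ around every $z_i$ and $0$ around every $q^{-2}z_i$ (such contours exist exactly when $z_i\ne q^{-2}z_j$ for all $i,j$). Then: 1. $Z_n=Z'_n$ for all such $z_1,\dots,z_{2n}$ and all such contours. 2. There are polynomials $P_n\in\mathbb C[z_1,\dots,z_{2n}]$ ($n\ge 0$) such that $Z'_n=P_n$ for all such $z$ and contours, $Z_n=P_n$ whenever all $z_i\ne0$, and: * $P_n$ has degree $n-1$ in each of its variables; * (wheel condition) $P_n(z_1,\dots,z_{2n})=0$ whenever $z_j=q^2z_i$ and $z_k=q^4z_i$ for some $i<j<k$; * (recursion) if $n\ge1$, $i\ne j$ and $z_j=q^2z_i$, then $P_n(z_1,\dots,z_{2n})=\prod_{k\ne i,j}(qz_i-z_k)\;P_{n-1}(z_1,\dots,\hat z_i,\dots,\hat z_j,\dots,z_{2n})$; * $P_n(q^{\epsilon_1},\dots,q^{\epsilon_{2n}})=3^{\binom n2}$ for all $\epsilon_i\in\{1,-1\}$ with $\sum_{i=1}^{2n}\epsilon_i=0$ and $\sum_{i=1}^{j}\epsilon_i\le0$ for all $j\le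 2n$. 3. For $n\ge1$ let $\tilde A_n(x,y)=\sum_{i,j}\tilde A_{n,i,j}x^{i-1}y^{j-1}$, where $\tilde A_{n,i,j}$ is the number of $n\times n$ alternating sign matrices whose $1$ in the first row is in column $i$ and whose $1$ in the last row is in column $j$. Then for all $x,y\in\mathbb C$ $$\tilde A_n(x,y)=\oint\!\cdots\!\oint\prod_{l=2}^n\frac{du_l}{2\pi i}\,\frac{(1+u_l)(1+xu_l)}{u_l^{2l-2}(1+u_l(1-y))}\prod_{2\le l<m\le n}(u_m-u_l)(1+u_m+u_mu_l),$$ where each contour has winding number $1$ around $0$ and, if $y\ne1$, winding number $0$ around $1/(y-1)$. -/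

import Mathlib

open Finset

noncomputable section

/-- The cube root of unity `exp (2 π i / 3)`. -/
def omega3 : ℂ := Complex.exp (2 * Real.pi * Complex.I / 3)

/-! ### The six-vertex model with domain wall boundary conditions -/

/-- An assignment of arrows to the edges of the `n × n` grid. Row `i` has the `n + 1` horizontal
edges `hor i 0, …, hor i n` (left to right); column `j` has the `n + 1` vertical edges
`ver 0 j, …, ver n j` (top to bottom). The vertex `(i, j)` has left edge `hor i j`, right edge
`hor i (j+1)`, top edge `ver i j` and bottom edge `ver (i+1) j`.
A horizontal edge is `true` if its arrow points right, a vertical edge is `true` if its arrow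
points up. -/
abbrev ArrowConfig (n : ℕ) : Type :=
  (Fin n → Fin (n + 1) → Bool) × (Fin (n + 1) → Fin n → Bool)

namespace ArrowConfig

variable {n : ℕ}

/-- Arrow on the left edge of the vertex `(i, j)`: `true` means pointing right. -/
def left (c : ArrowConfig n) (i j : Fin n) : Bool := c.1 i j.castSucc
/-- Arrow on the right edge of the vertex `(i, j)`: `true` means pointing right. -/
def right (c : ArrowConfig n) (i j : Fin n) : Bool := c.1 i j.succ
/-- Arrow on the top edge of the vertex `(i, j)`: `true` means pointing up. -/
def top (c : ArrowConfig n) (i j : Fin n) : Bool := c.2 i.castSucc j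
/-- Arrow on the bottom edge of the vertex `(i, j)`: `true` means pointing up. -/
def bottom (c : ArrowConfig n) (i j : Fin n) : Bool := c.2 i.succ j

/-- The number of arrows that point into the vertex `(i, j)`. -/
def inDegree (c : ArrowConfig n) (i j : Fin n) : ℕ :=
  (if c.left i j = true then 1 else 0) + (if c.right i j = false then 1 else 0) +
    (if c.top i j = false then 1 else 0) + (if c.bottom i j = true then 1 else 0)

/-- Two arrows in and two arrows out at each vertex; on the boundary, the arrows at the left and at
the right point in, and those at the top and at the bottom point out. -/
def IsDWBC (c : ArrowConfig n) : Prop :=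
  (∀ i j, c.inDegree i j = 2) ∧
    (∀ i, c.1 i 0 = true) ∧ (∀ i, c.1 i (Fin.last n) = false) ∧
    (∀ j, c.2 0 j = true) ∧ (∀ j, c.2 (Fin.last n) j = false)

/-- The weight of the vertex `(i, j)`, where `z` is the parameter of its row and `w` the parameter
of its column. If the horizontal line goes straight through the vertex, then (by the ice rule) so
does the vertical one, and the weight is `a` for the arrow patterns right/up and left/down and `b`
for left/up and right/down. The two other patterns have weight `c`. -/
def vertexWeight (q z w : ℂ) (c : ArrowConfig n) (i j : Fin n) : ℂ :=
  if c.left i j = c.right i j then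
    if c.left i j = c.top i j then q ^ (-1 / 2 : ℂ) * w - q ^ (1 / 2 : ℂ) * z
    else q ^ (-1 / 2 : ℂ) * z - q ^ (1 / 2 : ℂ) * w
  else (q⁻¹ - q) * z ^ (1 / 2 : ℂ) * w ^ (1 / 2 : ℂ)

end ArrowConfig

/-- The parameter `z_{i+1}` of the row `i` (rows are counted from `0`, from top to bottom). -/
def rowParam {n : ℕ} (z : Fin (2 * n) → ℂ) (i : Fin n) : ℂ := z ⟨i, by omega⟩

/-- The parameter `z_{n+j+1}` of the column `j` (columns are counted from `0`, left to right). -/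
def colParam {n : ℕ} (z : Fin (2 * n) → ℂ) (j : Fin n) : ℂ := z ⟨n + j, by omega⟩

open Classical in
/-- The partition function `Z̃_n` of the six-vertex model with domain wall boundary conditions. -/
def partitionFunction (q : ℂ) (n : ℕ) (z : Fin (2 * n) → ℂ) : ℂ :=
  ∑ c : ArrowConfig n with c.IsDWBC,
    ∏ i, ∏ j, c.vertexWeight q (rowParam z i) (colParam z j) i j

/-- The normalized partition function
`Z_n = (-1)^{n(n-1)/2} (q⁻¹ - q)^{-n} ∏ z_i^{-1/2} Z̃_n`. -/
def normalizedZ (q : ℂ) (n : ℕ) (z : Fin (2 * n) → ℂ) : ℂ :=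
  (-1) ^ (n * (n - 1) / 2) * ((q⁻¹ - q) ^ n)⁻¹ * (∏ i, (z i ^ (1 / 2 : ℂ))⁻¹) *
    partitionFunction q n z

/-! ### Contour integrals -/

/-- A closed curve `[0, 1] → ℂ` that is continuous, differentiable outside a finite set of
parameters, and has integrable derivative (for instance a piecewise `C¹` closed curve). -/
structure ClosedCurve where
  toFun : ℝ → ℂ
  continuousOn : ContinuousOn toFun (Set.Icc 0 1)
  closed : toFun 0 = toFun 1
  differentiable : ∃ s : Finset ℝ, ∀ t ∈ Set.Ioo (0 : ℝ) 1, t ∉ s → DifferentiableAt ℝ toFun t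
  integrable : IntervalIntegrable (deriv toFun) MeasureTheory.volume 0 1

/-- `∮_γ f(w) dw`. -/
def ClosedCurve.integral (γ : ClosedCurve) (f : ℂ → ℂ) : ℂ :=
  ∫ t in (0 : ℝ)..1, f (γ.toFun t) * deriv γ.toFun t

/-- An integration contour: finitely many closed curves (a single one, or for instance a union of
circles around several points). -/
abbrev Contour : Type := List ClosedCurve

namespace Contour

/-- `∮_Γ f(w) dw / (2 π i)`. -/
def integral (Γ : Contour) (f : ℂ → ℂ) : ℂ :=
  (2 * Real.pi * Complex.I)⁻¹ * (Γ.map fun γ => γ.integral f).sum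

/-- The contour does not pass through `a`. -/
def Avoids (Γ : Contour) (a : ℂ) : Prop :=
  ∀ γ ∈ Γ, ∀ t ∈ Set.Icc (0 : ℝ) 1, γ.toFun t ≠ a

/-- The winding number of the contour around `a` (for `a` not on the contour). -/
def index (Γ : Contour) (a : ℂ) : ℂ := Γ.integral fun w => (w - a)⁻¹

/-- The contour surrounds each point of `A` once counterclockwise, but no point of `B`. -/
def Separates (Γ : Contour) (A B : Set ℂ) : Prop :=
  (∀ a ∈ A, Γ.Avoids a ∧ Γ.index a = 1) ∧ (∀ b ∈ B, Γ.Avoids b ∧ Γ.index b = 0)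

/-- The iterated integral `∮_{Γ_1} dw_1/(2πi) ⋯ ∮_{Γ_n} dw_n/(2πi) f(w_1, …, w_n)`. -/
def iterated : (n : ℕ) → (Fin n → Contour) → ((Fin n → ℂ) → ℂ) → ℂ
  | 0, _, f => f Fin.elim0
  | n + 1, Γ, f =>
      (Γ 0).integral fun w => iterated n (fun l => Γ l.succ) fun ws => f (Fin.cons w ws)

end Contour

/-- The integrand of `Z'_n`. Indices are counted from `0`, so that `w l` stands for
`w_{l+1}`, and `z_{2(l+1)-1}` is `z ⟨2 * l, _⟩`. -/
def zIntegrand (q : ℂ) (n : ℕ) (z : Fin (2 * n) → ℂ) (w : Fin n → ℂ) : ℂ :=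
  ∏ l : Fin n,
    ((q * z ⟨2 * l, by omega⟩ - q⁻¹ * w l) *
        ∏ m with l < m, ((w m - w l) * (q * w l - q⁻¹ * w m))) /
      ((∏ i : Fin (2 * n) with i.val ≤ 2 * l.val, (w l - z i)) *
        ∏ i : Fin (2 * n) with 2 * l.val ≤ i.val, (q * w l - q⁻¹ * z i))

/-- The multiple contour integral `Z'_n`, with the variable `w_l` integrated over `Γ l`. -/
def contourZ (q : ℂ) (n : ℕ) (z : Fin (2 * n) → ℂ) (Γ : Fin n → Contour) : ℂ :=
  (-1) ^ (n.choose 2) * (∏ i, ∏ j with i < j, (q * z i - q⁻¹ * z j)) *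
    Contour.iterated n Γ (zIntegrand q n z)

/-- Each contour surrounds all the `z_i` counterclockwise, but none of the `q⁻² z_i`. -/
def AdmissibleContours (q : ℂ) (n : ℕ) (z : Fin (2 * n) → ℂ) (Γ : Fin n → Contour) : Prop :=
  ∀ l, (Γ l).Separates (Set.range z) (Set.range fun i => q ^ (-2 : ℤ) * z i)

/-! ### Alternating sign matrices -/

/-- Ignoring the `0`s, the entries are alternately `1` and `-1`, starting and ending with `1`. -/
def IsAlternating {n : ℕ} (f : Fin n → SignType) : Prop :=
  let l := (List.ofFn f).filter (· ≠ 0)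
  l.head? = some 1 ∧ l.getLast? = some 1 ∧ l.IsChain fun a b => b = -a

/-- Alternating sign matrices (`SignType` is the type with the elements `-1`, `0`, `1`). -/
def IsASM {n : ℕ} (M : Matrix (Fin n) (Fin n) SignType) : Prop :=
  (∀ i, IsAlternating fun j => M i j) ∧ (∀ j, IsAlternating fun i => M i j)

open Classical in
/-- The number of alternating sign matrices of size `n + 1` whose `1` in the first row is in the
column `i` and whose `1` in the last row is in the column `j` (columns are counted from `0`). -/
def refinedASMCount (n : ℕ) (i j : Fin (n + 1)) : ℕ :=
  #{M : Matrix (Fin (n + 1)) (Fin (n + 1)) SignType |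
    IsASM M ∧ M 0 i = 1 ∧ M (Fin.last n) j = 1}

/-- The doubly refined generating function `Ã_{n+1}(x, y)` of alternating sign matrices of
size `n + 1`. -/
def refinedASM (n : ℕ) (x y : ℂ) : ℂ :=
  ∑ i : Fin (n + 1), ∑ j : Fin (n + 1),
    (refinedASMCount n i j : ℂ) * x ^ (i : ℕ) * y ^ (j : ℕ)

/-- The integrand of the integral formula for `Ã_{n+1}(x, y)`. Its variables `u_2, …, u_{n+1}` are
`u 0, …, u (n-1)` here, so that `u_l ^ (2 l - 2)` becomes `u k ^ (2 k + 2)`. -/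
def asmIntegrand (n : ℕ) (x y : ℂ) (u : Fin n → ℂ) : ℂ :=
  (∏ k : Fin n, ((1 + u k) * (1 + x * u k)) /
      (u k ^ (2 * (k : ℕ) + 2) * (1 + u k * (1 - y)))) *
    ∏ k : Fin n, ∏ m with k < m, ((u m - u k) * (1 + u m + u m * u k))

namespace Contour

/-- The circle with centre `c` and radius `r`, run through once counterclockwise. -/
def circle (c : ℂ) (r : ℝ) : ClosedCurve where
  toFun t := circleMap c r (2 * Real.pi * t)
  continuousOn := ((continuous_circleMap c r).comp (by fun_prop)).continuousOn
  closed := by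
    have := periodic_circleMap c r 0
    simp only [zero_add] at this
    simp [this]
  differentiable := ⟨∅, fun t _ _ =>
    ((differentiable_circleMap c r).comp (by fun_prop)).differentiableAt⟩
  integrable := by
    have h : ContDiff ℝ 1 fun t : ℝ => circleMap c r (2 * Real.pi * t) :=
      (contDiff_circleMap c r).comp (by fun_prop)
    exact (h.continuous_deriv le_rfl).intervalIntegrable 0 1

theorem circle_integral (c : ℂ) (r : ℝ) (f : ℂ → ℂ) :
    (circle c r).integral f = ∮ w in C(c, r), f w := by
  have hd : ∀ t : ℝ, deriv (circle c r).toFun t =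
      (2 * Real.pi : ℝ) * deriv (circleMap c r) (2 * Real.pi * t) := by
    intro t
    have h1 := (hasDerivAt_circleMap c r (2 * Real.pi * t)).scomp t
      ((hasDerivAt_id t).const_mul (2 * Real.pi))
    have h2 : HasDerivAt (circle c r).toFun _ t := h1
    rw [h2.deriv, (hasDerivAt_circleMap c r (2 * Real.pi * t)).deriv]
    simp
  have h3 := intervalIntegral.smul_integral_comp_mul_left (a := 0) (b := 1)
    (fun θ => deriv (circleMap c r) θ • f (circleMap c r θ)) (2 * Real.pi)
  rw [mul_zero, mul_one] at h3
  rw [circleIntegral, ← h3, ClosedCurve.integral, ← intervalIntegral.integral_smul]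
  congr 1
  ext t
  rw [hd]
  simp only [smul_eq_mul, Complex.real_smul]
  change f (circleMap c r (2 * Real.pi * t)) * _ = _
  ring

/-- Separating contours exist for any two disjoint finite sets. -/
theorem exists_separates (A B : Finset ℂ) (h : Disjoint A B) :
    ∃ Γ : Contour, Γ.Separates A B := by
  classical
  obtain ⟨r, hr, hr'⟩ : ∃ r : ℝ, 0 < r ∧ ∀ a ∈ A ∪ B, ∀ b ∈ A ∪ B, a ≠ b → r < ‖a - b‖ := by
    have h1 : ∀ p ∈ ((A ∪ B) ×ˢ (A ∪ B)).filter (fun p => p.1 ≠ p.2),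
        ∀ᶠ r in nhdsWithin (0 : ℝ) (Set.Ioi 0), r < ‖p.1 - p.2‖ := by
      intro p hp
      apply nhdsWithin_le_nhds
      exact gt_mem_nhds (norm_pos_iff.2 (sub_ne_zero.2 (Finset.mem_filter.1 hp).2))
    obtain ⟨r, h2, h3⟩ := (((Finset.eventually_all _).2 h1).and self_mem_nhdsWithin).exists
    exact ⟨r, h3, fun a ha b hb hab => h2 (a, b)
      (Finset.mem_filter.2 ⟨Finset.mem_product.2 ⟨ha, hb⟩, hab⟩)⟩
  have key : ∀ p ∈ A ∪ B, Avoids (A.toList.map fun a => circle a r) p ∧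
      index (A.toList.map fun a => circle a r) p = if p ∈ A then 1 else 0 := by
    intro p hp
    refine ⟨?_, ?_⟩
    · intro γ hγ t _ ht
      obtain ⟨a, ha, rfl⟩ := List.mem_map.1 hγ
      rw [Finset.mem_toList] at ha
      have h4 : ‖p - a‖ = r := by
        rw [← ht, ← dist_eq_norm]
        exact circleMap_mem_sphere a hr.le _
      by_cases hpa : p = a
      · subst hpa; simp at h4; exact hr.ne h4
      · exact (hr' p hp a (Finset.mem_union_left _ ha) hpa).ne' h4
    · have h5 : ∀ a ∈ A, (∮ w in C(a, r), (w - p)⁻¹) =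
          if a = p then 2 * Real.pi * Complex.I else 0 := by
        intro a ha
        split_ifs with hap
        · subst hap
          exact circleIntegral.integral_sub_center_inv a hr.ne'
        · have hlt := hr' a (Finset.mem_union_left _ ha) p hp hap
          have hne : ∀ w ∈ Metric.closedBall a r, w - p ≠ 0 := by
            intro w hw hwp
            rw [sub_eq_zero.1 hwp, Metric.mem_closedBall, dist_comm, dist_eq_norm] at hw
            exact absurd hw (not_le.2 hlt)
          refine Complex.circleIntegral_eq_zero_of_differentiable_on_off_countable hr.le
            Set.countable_empty ?_ ?_
          · exact (continuousOn_id.sub continuousOn_const).inv₀ hne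
          · intro w hw
            exact (differentiableAt_id.sub_const p).inv (hne w (Metric.ball_subset_closedBall hw.1))
      rw [index, integral, List.map_map]
      simp only [Function.comp_def, circle_integral]
      rw [Finset.sum_map_toList, Finset.sum_congr rfl h5, Finset.sum_ite_eq' A p]
      split_ifs
      · exact inv_mul_cancel₀ Complex.two_pi_I_ne_zero
      · simp
  refine ⟨A.toList.map fun a => circle a r, fun a ha => ?_, fun b hb => ?_⟩
  · have := key a (Finset.mem_union_left _ ha)
    rwa [if_pos (Finset.mem_coe.1 ha)] at this
  · have := key b (Finset.mem_union_right _ hb)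
    rwa [if_neg fun hA => Finset.disjoint_left.1 h hA hb] at this

end Contour

end

/-! Write q for `omega3`. The theorem compares two polynomials in the 2n parameters, one from the
six-vertex model and one from the contour integral; both satisfy the same recursion, and a
uniqueness argument identifies them.

Six-vertex side. In an asymmetric gauge the vertex weights are polynomial; the square roots of the
symmetric gauge telescope along every line (`prod_vertexWeight`). The Yang–Baxter equation makes row
transfer matrices commute, so the partition function is symmetric in the row parameters, and by a
quarter turn also in the column parameters. Where an a- or b-weight vanishes, a row and a column
freeze and can be removed (Korepin's recursion, `dwPartition_remove`). As q ^ 3 = 1, this happens at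
two values of a row parameter for each column, more than enough points for interpolation, and
induction yields symmetry in all 2n parameters together (`dwPartition_exchange`). Korepin's
recursion then holds for any two parameters with z_j = q² z_i; the wheel condition, the lower bound
for the degree and the values 3 ^ (n choose 2) are consequences.

Contour side. Partial fractions show that the integral becomes polynomial after multiplication by a
power of the product of the z_i - q⁻² z_j, even if some z_i coincide. At generic points it is a sum
of residues, in which prefactor and numerator cancel all these factors, so that only differences z_i
- z_j remain in the denominators. The two denominators are coprime, hence the integral is a
polynomial (`exists_contourZ_eq_eval`). The residue sum is small enough to read off, term by term,
the degree bound n - 1, the wheel condition for increasing indices, and the recursion for adjacent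
parameters.

Comparison. If the two polynomials agree at one size, their difference at the next size vanishes
when z_{i+1} = q² z_i and on increasing wheels. Counting zeros, by induction on j - i, it vanishes
whenever z_j = q² z_i with i < j, and then it is zero (`MvPolynomial.eq_zero_of_adjacent_of_wheel`).

Alternating sign matrices. The polynomial is evaluated in two ways at the parameters α, 1, …, 1, β.
In the model, all weights coincide at equal parameters, so configurations, that is alternating sign
matrices, are weighted only by the positions of the 1 in the first and the last row; this gives
`refinedASM` at Möbius functions x of α and y of β. In the integral, the first variable is fixed at
α by its residue, and u = (w - 1) / (q w - q⁻¹) transforms the rest into `asmIntegrand`. This proves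
the formula for α, β positive reals other than 1, hence for infinitely many x and y; both sides are
polynomials in x and y. -/

noncomputable section

/-! ### Transfer matrices and the Yang–Baxter equation -/

section SixVertexTransfer

variable {R : Type*} [CommRing R]

/-- A local weight of the six-vertex model: `a`, `b`, `c`, `d` are the weights of the patterns
right/up or left/down, of left/up or right/down, and of the two sink/source patterns. -/
def iceWeight (a b c d : R) (l r t u : Bool) : R :=
  if l = r then (if t = u then (if l = t then a else b) else 0)
  else if l = t ∧ r = u then (if l = true then c else d) else 0

/-- The six-vertex weight, in a gauge in which it is polynomial. Here `si` is the inverse of `s`. -/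
def vWeight (s si z w : R) : Bool → Bool → Bool → Bool → R :=
  iceWeight (si * w - s * z) (si * z - s * w) (si ^ 2 - s ^ 2) ((si ^ 2 - s ^ 2) * (z * w))

/-- The row of vertices with row parameter `z`, vertical arrows `t` above and `u` below. -/
def rowTransfer (s si : R) {n : ℕ} (y : Fin n → R) (z : R) :
    Matrix (Fin n → Bool) (Fin n → Bool) R :=
  Matrix.of fun t u =>
    (List.ofFn fun j => Matrix.of fun l r => vWeight s si z (y j) l r (t j) (u j)).prod true false

/-- The domain wall partition function with the weights `vWeight`. -/
def dwPartition (s si : R) (n : ℕ) (x y : Fin n → R) : R :=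
  (List.ofFn fun i => rowTransfer s si y (x i)).prod (fun _ => true) (fun _ => false)

theorem Bool.sum_univ {M : Type*} [AddCommMonoid M] (f : Bool → M) :
    ∑ b, f b = f true + f false := by
  simp

/-- Splitting off the first coordinate in a sum over all functions on `Fin (n + 1)`. -/
theorem Fin.sum_univ_cons {M S : Type*} [AddCommMonoid M] [Fintype S] {n : ℕ}
    (f : (Fin (n + 1) → S) → M) : ∑ g, f g = ∑ s, ∑ g, f (Fin.cons s g) := by
  rw [← Fintype.sum_prod_type', ← (Fin.consEquiv fun _ : Fin (n + 1) => S).sum_comp f]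
  rfl

/-- Distributivity for ordered products, since the matrices attached to the vertices of a row do not
commute. -/
theorem sum_list_prod_ofFn {A S : Type*} [Ring A] [Fintype S] {n : ℕ} (f : Fin n → S → A) :
    ∑ m : Fin n → S, (List.ofFn fun j => f j (m j)).prod = (List.ofFn fun j => ∑ s, f j s).prod := by
  induction n with
  | zero => simp
  | succ n ih =>
    rw [Fin.sum_univ_cons]
    simp only [List.ofFn_succ, List.prod_cons, Fin.cons_zero, Fin.cons_succ]
    simp_rw [← Finset.mul_sum]
    rw [ih fun j => f j.succ, Finset.sum_mul]

open scoped Kronecker in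
theorem list_prod_kronecker {S : Type*} [Fintype S] [DecidableEq S] {n : ℕ}
    (f g : Fin n → Matrix S S R) :
    (List.ofFn f).prod ⊗ₖ (List.ofFn g).prod = (List.ofFn fun j => f j ⊗ₖ g j).prod := by
  induction n with
  | zero => simp
  | succ n ih =>
    simp only [List.ofFn_succ, List.prod_cons]
    rw [← ih, Matrix.mul_kronecker_mul]

/-- The railroad argument: `r` is pushed through the columns one at a time. -/
theorem list_prod_intertwine {A : Type*} [Monoid A] {n : ℕ} {f g : Fin n → A} {r : A}
    (h : ∀ j, r * f j = g j * r) : r * (List.ofFn f).prod = (List.ofFn g).prod * r := by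
  induction n with
  | zero => simp
  | succ n ih =>
    simp only [List.ofFn_succ, List.prod_cons]
    rw [← mul_assoc, h, mul_assoc, ih fun j => h j.succ, mul_assoc]

/-- The `R`-matrix that intertwines two rows. -/
def rMatrix (s si z z' : R) : Matrix (Bool × Bool) (Bool × Bool) R :=
  Matrix.of fun x y =>
    if x = y then
      (if x.1 = x.2 then si ^ 2 * z - s ^ 2 * z' else
        (si ^ 2 - s ^ 2) * (if x.1 = true then z else z'))
    else if x.1 = y.2 ∧ x.2 = y.1 then z' - z else 0

open scoped Kronecker in
/-- Two vertices on top of each other, with the vertical edge between them summed over. -/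
def columnPair (s si z z' w : R) (t u : Bool) : Matrix (Bool × Bool) (Bool × Bool) R :=
  ∑ m : Bool, Matrix.of (fun l r => vWeight s si z w l r t m) ⊗ₖ
    Matrix.of (fun l r => vWeight s si z' w l r m u)

/-- A finite check over the 64 states of the external edges, two horizontal ones on each side and
one vertical one at top and bottom; the only relation needed between `s` and `si` is `hs`. -/
theorem yang_baxter {s si : R} (hs : s * si = 1) (z z' w : R) (t u : Bool) :
    rMatrix s si z z' * columnPair s si z z' w t u =
      columnPair s si z' z w t u * rMatrix s si z z' := by
  ext ⟨x1, x2⟩ ⟨y1, y2⟩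
  simp only [Matrix.mul_apply, columnPair, Fintype.sum_prod_type, Matrix.add_apply,
    Matrix.kroneckerMap_apply, Matrix.of_apply, Fintype.sum_bool, rMatrix]
  cases x1 <;> cases x2 <;> cases y1 <;> cases y2 <;> cases t <;> cases u <;>
    simp [vWeight, iceWeight] <;> grind

end SixVertexTransfer

/-! ### Symmetry in rows and in columns, and Korepin's recursion -/

section SixVertexSymmetry

variable {R : Type*} [CommRing R]

-- Two stacked rows, read column by column instead of row by row; in this form the Yang–Baxter
-- equation applies.
open scoped Kronecker in
theorem rowTransfer_mul_apply (s si : R) {n : ℕ} (y : Fin n → R) (z z' : R) (t u : Fin n → Bool) :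
    (rowTransfer s si y z * rowTransfer s si y z') t u =
      (List.ofFn fun j => columnPair s si z z' (y j) (t j) (u j)).prod (true, true)
        (false, false) := by
  simp only [columnPair]
  rw [← sum_list_prod_ofFn fun j m => Matrix.of (fun l r => vWeight s si z (y j) l r (t j) m) ⊗ₖ
    Matrix.of (fun l r => vWeight s si z' (y j) l r m (u j)), Matrix.mul_apply, Matrix.sum_apply]
  refine Finset.sum_congr rfl fun m _ => ?_
  rw [← list_prod_kronecker]
  rfl

/-- The row (true, true) and the column (false, false) of the R-matrix have only a diagonal entry,
and it is the same for both. Reading the intertwining relation between these states, which are the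
boundary conditions, gives commutation up to this entry, which `hz` allows to cancel. -/
theorem rowTransfer_commute {s si : R} [IsDomain R] (hs : s * si = 1) {n : ℕ} (y : Fin n → R)
    {z z' : R} (hz : si ^ 2 * z - s ^ 2 * z' ≠ 0) :
    Commute (rowTransfer s si y z) (rowTransfer s si y z') := by
  ext t u
  rw [rowTransfer_mul_apply, rowTransfer_mul_apply]
  have h := list_prod_intertwine (r := rMatrix s si z z')
    (f := fun j => columnPair s si z z' (y j) (t j) (u j))
    (g := fun j => columnPair s si z' z (y j) (t j) (u j))
    fun j => yang_baxter hs z z' (y j) (t j) (u j)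
  have h' := congrFun (congrFun h (true, true)) (false, false)
  simp only [Matrix.mul_apply, Fintype.sum_prod_type, Fintype.sum_bool, rMatrix,
    Matrix.of_apply] at h'
  simp at h'
  rw [mul_comm] at h'
  exact mul_right_cancel₀ hz h'

theorem dwPartition_comp_perm_of_ne {s si : R} [IsDomain R] (hs : s * si = 1) {n : ℕ}
    (x y : Fin n → R) (hx : ∀ i j, i ≠ j → si ^ 2 * x i - s ^ 2 * x j ≠ 0)
    (σ : Equiv.Perm (Fin n)) : dwPartition s si n (x ∘ σ) y = dwPartition s si n x y := by
  unfold dwPartition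
  have h : (List.ofFn fun i => rowTransfer s si y ((x ∘ σ) i)).prod =
      (List.ofFn fun i => rowTransfer s si y (x i)).prod := by
    refine List.Perm.prod_eq'
      (Equiv.Perm.ofFn_comp_perm σ fun i => rowTransfer s si y (x i)) ?_
    rw [List.pairwise_ofFn]
    exact fun i j hij => rowTransfer_commute hs y (hx _ _ (σ.injective.ne hij.ne))
  rw [h]

/-- The arrows at the left and at the right point in, those at the top and at the bottom out. -/
def ArrowConfig.IsBoundary {n : ℕ} (c : ArrowConfig n) : Prop :=
  (∀ i, c.1 i 0 = true ∧ c.1 i (Fin.last n) = false) ∧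
    (c.2 0 = fun _ => true) ∧ c.2 (Fin.last n) = fun _ => false

theorem list_prod_apply_eq_sum {S : Type*} [Fintype S] [DecidableEq S] {n : ℕ}
    (M : Fin n → Matrix S S R) (a b : S) :
    (List.ofFn M).prod a b = ∑ h : Fin (n + 1) → S with h 0 = a ∧ h (Fin.last n) = b,
      ∏ j, M j (h j.castSucc) (h j.succ) := by
  rw [Finset.sum_filter]
  induction n generalizing a with
  | zero =>
    rw [Fin.sum_univ_cons]
    simp [Matrix.one_apply, ite_and]
  | succ n ih =>
    rw [Fin.sum_univ_cons, List.ofFn_succ, List.prod_cons, Matrix.mul_apply]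
    simp only [ih fun j => M j.succ, Finset.mul_sum]
    rw [Finset.sum_comm, Finset.sum_comm (γ := S)]
    refine Finset.sum_congr rfl fun g _ => ?_
    rw [Finset.sum_eq_single (g 0), Finset.sum_eq_single a]
    · rw [Fin.prod_univ_succ]
      simp [← Fin.succ_last]
    · intro b _ hb
      simp [hb]
    · simp
    · intro b _ hb
      simp [hb.symm]
    · simp

-- Only the boundary is prescribed on the right: the ice rule is built into `vWeight`, which
-- vanishes where it fails.
open Classical in
theorem dwPartition_eq_sum (s si : R) {n : ℕ} (x y : Fin n → R) :
    dwPartition s si n x y = ∑ c : ArrowConfig n with c.IsBoundary,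
      ∏ i, ∏ j, vWeight s si (x i) (y j) (c.left i j) (c.right i j) (c.top i j) (c.bottom i j) := by
  rw [dwPartition, list_prod_apply_eq_sum, Finset.sum_filter, Finset.sum_filter,
    Fintype.sum_prod_type_right]
  refine Finset.sum_congr rfl fun v _ => ?_
  simp only [ArrowConfig.IsBoundary]
  split_ifs with hv
  · simp only [hv, and_self, and_true]
    simp only [rowTransfer, Matrix.of_apply, list_prod_apply_eq_sum]
    rw [Finset.prod_univ_sum, ← Finset.sum_filter]
    refine Finset.sum_congr ?_ fun h _ => rfl
    ext h
    simp
  · simp [hv]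


theorem map_vWeight {S : Type*} [CommRing S] (f : R →+* S) (s si z w : R) (l r t u : Bool) :
    f (vWeight s si z w l r t u) = vWeight (f s) (f si) (f z) (f w) l r t u := by
  simp only [vWeight, iceWeight]
  split_ifs <;> simp

theorem map_dwPartition {S : Type*} [CommRing S] (f : R →+* S) (s si : R) {n : ℕ}
    (x y : Fin n → R) :
    f (dwPartition s si n x y) = dwPartition (f s) (f si) n (fun i => f (x i)) fun i => f (y i) := by
  simp only [dwPartition_eq_sum, map_sum, map_prod, map_vWeight]

/-- The factor cancelled in `rowTransfer_commute` may vanish at special row parameters, but never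
for indeterminates. So the identity is proved over a polynomial ring and specialized. -/
theorem dwPartition_comp_perm {s si : R} [IsDomain R] (hs : s * si = 1) {n : ℕ}
    (x y : Fin n → R) (σ : Equiv.Perm (Fin n)) :
    dwPartition s si n (x ∘ σ) y = dwPartition s si n x y := by
  have h := dwPartition_comp_perm_of_ne (R := MvPolynomial (Fin n) R) (s := MvPolynomial.C s)
    (si := MvPolynomial.C si) (by rw [← map_mul, hs, map_one]) MvPolynomial.X
    (fun i => MvPolynomial.C (y i)) (fun i j hij h0 => ?_) σ
  · have h' := congrArg (MvPolynomial.eval x) h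
    rw [map_dwPartition, map_dwPartition] at h'
    simpa [Function.comp_def] using h'
  -- At this point the factor takes the value `si ^ 2`, and `si` is invertible.
  · have h' := congrArg (MvPolynomial.eval (Pi.single i 1)) h0
    simp [hij] at h'
    rw [h', mul_zero] at hs
    exact zero_ne_one hs

/-- A quarter turn combined with the reversal of all arrows. It preserves domain wall boundary
conditions and exchanges the roles of rows and columns. -/
theorem vWeight_rotate (s si z w : R) (l r t u : Bool) :
    vWeight s si z w l r t u = vWeight s si w z (!u) (!t) l r := by
  cases l <;> cases r <;> cases t <;> cases u <;> simp [vWeight, iceWeight, mul_comm]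

theorem dwPartition_swap (s si : R) {n : ℕ} (x y : Fin n → R) :
    dwPartition s si n y x = dwPartition s si n x (y ∘ Fin.rev) := by
  classical
  rw [dwPartition_eq_sum, dwPartition_eq_sum]
  refine Finset.sum_bij' (fun c _ => (fun i j => ! c.2 j.rev i, fun i j => c.1 j.rev i))
    (fun c _ => (fun i j => c.2 j i.rev, fun i j => ! c.1 j i.rev)) ?_ ?_ ?_ ?_ ?_
  · intro c hc
    obtain ⟨-, h1, h2, h3⟩ := Finset.mem_filter.1 hc
    refine Finset.mem_filter.2 ⟨Finset.mem_univ _, ?_⟩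
    simp [ArrowConfig.IsBoundary, h1, h2, h3]
  · intro c hc
    obtain ⟨-, h1, h2, h3⟩ := Finset.mem_filter.1 hc
    refine Finset.mem_filter.2 ⟨Finset.mem_univ _, ?_⟩
    simp [ArrowConfig.IsBoundary, h1, h2, h3]
  · intro c hc
    simp
  · intro c hc
    simp
  · intro c hc
    rw [Finset.prod_comm]
    refine Finset.prod_congr rfl fun i _ => ?_
    rw [← Equiv.prod_comp Fin.revPerm]
    refine Finset.prod_congr rfl fun j _ => ?_
    rw [vWeight_rotate]
    simp [ArrowConfig.left, ArrowConfig.right, ArrowConfig.top, ArrowConfig.bottom,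
      Fin.rev_castSucc, Fin.rev_succ]

/-- The left boundary arrow and a downward top arrow both enter the vertex, so the other two must
leave it. The vertex is frozen, and the next column again sees an incoming arrow from the left;
hence a first column that starts with a downward arrow can be split off. -/
theorem rowTransfer_of_false (s si : R) {n : ℕ} (y : Fin (n + 1) → R) (z : R)
    (t u : Fin (n + 1) → Bool) (ht : t 0 = false) :
    rowTransfer s si y z t u = if u 0 = false then
      (si * z - s * y 0) * rowTransfer s si (Fin.tail y) z (Fin.tail t) (Fin.tail u) else 0 := by
  simp only [rowTransfer, Matrix.of_apply, List.ofFn_succ, List.prod_cons, Matrix.mul_apply,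
    Fintype.sum_bool, ht]
  cases u 0
  · simp only [vWeight, iceWeight]
    simp
    rfl
  · simp [vWeight, iceWeight]

theorem list_prod_rowTransfer_of_false (s si : R) {n m : ℕ} (y : Fin (n + 1) → R) (x : Fin m → R)
    (t u : Fin (n + 1) → Bool) (ht : t 0 = false) (hu : u 0 = false) :
    (List.ofFn fun i => rowTransfer s si y (x i)).prod t u = (∏ i, (si * x i - s * y 0)) *
      (List.ofFn fun i => rowTransfer s si (Fin.tail y) (x i)).prod (Fin.tail t) (Fin.tail u) := by
  induction m generalizing t with
  | zero =>
    have : t = u ↔ Fin.tail t = Fin.tail u := by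
      constructor
      · rintro rfl; rfl
      · intro h
        rw [← Fin.cons_self_tail t, ← Fin.cons_self_tail u, h, ht, hu]
    simp [Matrix.one_apply, this]
  | succ m ih =>
    simp only [List.ofFn_succ, List.prod_cons, Matrix.mul_apply, Fin.prod_univ_succ]
    rw [Fin.sum_univ_cons, Bool.sum_univ]
    simp only [rowTransfer_of_false s si y (x 0) t _ ht, Fin.cons_zero, Fin.tail_cons]
    simp only [Bool.true_eq_false, if_false, zero_mul, Finset.sum_const_zero, zero_add, if_true]
    rw [Finset.mul_sum]
    refine Finset.sum_congr rfl fun g _ => ?_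
    rw [ih (fun i => x i.succ) (Fin.cons false g) rfl, Fin.tail_cons]
    ring

theorem list_prod_top_false (s si : R) {n : ℕ} (y : Fin n → R) (z : R) (u : Fin n → Bool) :
    (List.ofFn fun j => Matrix.of fun l r => vWeight s si z (y j) l r true (u j)).prod false false =
      if u = fun _ => true then ∏ j, (si * z - s * y j) else 0 := by
  induction n with
  | zero => simp [eq_iff_true_of_subsingleton]
  | succ n ih =>
    have : (u = fun _ => true) ↔ u 0 = true ∧ (fun j => u (Fin.succ j)) = fun _ => true := by
      simp [funext_iff, Fin.forall_fin_succ]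
    simp only [List.ofFn_succ, List.prod_cons, Matrix.mul_apply, Fintype.sum_bool, this,
      ih (fun j => y j.succ) fun j => u j.succ, Fin.prod_univ_succ]
    cases u 0 <;> simp [vWeight, iceWeight]

/-- With the a-weight of the corner equal to zero, the corner must be a c-vertex. Then a left arrow
runs into columns with upward top arrows, and the rest of the row is frozen with b-weights. -/
theorem rowTransfer_top (s si : R) {n : ℕ} (y : Fin (n + 1) → R) (z : R)
    (u : Fin (n + 1) → Bool) (h : si * y 0 = s * z) :
    rowTransfer s si y z (fun _ => true) u = if u = Fin.cons false fun _ => true then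
      (si ^ 2 - s ^ 2) * ∏ j, (si * z - s * Fin.tail y j) else 0 := by
  have : (u = Fin.cons false fun _ => true) ↔
      u 0 = false ∧ (fun j => u (Fin.succ j)) = fun _ => true := by
    simp [funext_iff, Fin.forall_fin_succ]
  simp only [rowTransfer, Matrix.of_apply, List.ofFn_succ, List.prod_cons, Matrix.mul_apply,
    Fintype.sum_bool, list_prod_top_false s si (fun j => y j.succ) z fun j => u j.succ, this]
  cases u 0 <;> simp [vWeight, iceWeight, Fin.tail, h]

/-- Korepin's recursion: the corner freezes the first row by `rowTransfer_top`, and the downward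
arrow below it freezes the first column. -/
theorem dwPartition_corner (s si : R) {n : ℕ} (x y : Fin (n + 1) → R) (h : si * y 0 = s * x 0) :
    dwPartition s si (n + 1) x y = (si ^ 2 - s ^ 2) * (∏ j, (si * x 0 - s * Fin.tail y j)) *
      (∏ i, (si * Fin.tail x i - s * y 0)) *
        dwPartition s si n (Fin.tail x) (Fin.tail y) := by
  rw [dwPartition, List.ofFn_succ, List.prod_cons, Matrix.mul_apply,
    Finset.sum_eq_single (Fin.cons false fun _ => true)]
  · rw [rowTransfer_top s si y (x 0) _ h, if_pos rfl,
      list_prod_rowTransfer_of_false s si y _ _ _ rfl rfl]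
    simp only [Fin.tail_cons, mul_assoc]
    rfl
  · intro u _ hu
    rw [rowTransfer_top s si y (x 0) _ h, if_neg hu, zero_mul]
  · simp

/-- The quarter turn reverses the order of one family of lines; symmetry undoes this. -/
theorem dwPartition_comm {s si : R} [IsDomain R] (hs : s * si = 1) {n : ℕ} (x y : Fin n → R) :
    dwPartition s si n y x = dwPartition s si n x y := by
  rw [← dwPartition_comp_perm hs y x Fin.revPerm, dwPartition_swap]
  congr 1
  ext j
  simp

theorem dwPartition_comp_perm_right {s si : R} [IsDomain R] (hs : s * si = 1) {n : ℕ}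
    (x y : Fin n → R) (σ : Equiv.Perm (Fin n)) :
    dwPartition s si n x (y ∘ σ) = dwPartition s si n x y := by
  rw [← dwPartition_comm hs, dwPartition_comp_perm hs, dwPartition_comm hs]

theorem Fin.comp_cycleRange_symm {α : Type*} {n : ℕ} (x : Fin (n + 1) → α) (i : Fin (n + 1)) :
    x ∘ i.cycleRange.symm = Fin.cons (x i) (x ∘ i.succAbove) := by
  ext k
  refine Fin.cases ?_ (fun k => ?_) k <;> simp

/-- The row `i` and the column `j` can be removed if the weight `a` vanishes where they meet. -/
theorem dwPartition_remove {s si : R} [IsDomain R] (hs : s * si = 1) {n : ℕ}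
    (x y : Fin (n + 1) → R) (i j : Fin (n + 1)) (h : si * y j = s * x i) :
    dwPartition s si (n + 1) x y =
      (si ^ 2 - s ^ 2) * (∏ m, (si * x i - s * y (j.succAbove m))) *
        (∏ m, (si * x (i.succAbove m) - s * y j)) *
          dwPartition s si n (x ∘ i.succAbove) (y ∘ j.succAbove) := by
  rw [← dwPartition_comp_perm hs x y i.cycleRange.symm,
    ← dwPartition_comp_perm_right hs _ y j.cycleRange.symm, Fin.comp_cycleRange_symm,
    Fin.comp_cycleRange_symm, dwPartition_corner]
  · simp [Fin.tail_cons]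
  · simpa using h

end SixVertexSymmetry

/-! ### Polynomial identities at generic points, and degrees -/

section GenericPoints

variable {σ : Type*}

/-- A point whose coordinates are nonzero and have pairwise distinct cubes. -/
def HasDistinctCubes (z : σ → ℂ) : Prop :=
  (∀ i, z i ≠ 0) ∧ Function.Injective fun i => z i ^ 3

/-- Genericity is the nonvanishing of the nonzero polynomial `E`, and `p * E` vanishes everywhere.
Cubes occur because the points c * z i with c ^ 3 = 1 are then all distinct. -/
theorem MvPolynomial.eq_zero_of_eval_generic [Fintype σ] (p : MvPolynomial σ ℂ)
    (h : ∀ z, HasDistinctCubes z → MvPolynomial.eval z p = 0) : p = 0 := by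
  classical
  set E : MvPolynomial σ ℂ := (∏ i, MvPolynomial.X i) *
    ∏ x ∈ (univ : Finset (σ × σ)).filter (fun x => x.1 ≠ x.2),
      (MvPolynomial.X x.1 ^ 3 - MvPolynomial.X x.2 ^ 3) with hE
  have hgen : ∀ z, MvPolynomial.eval z E ≠ 0 ↔ HasDistinctCubes z := by
    intro z
    simp only [hE, map_mul, map_prod, map_sub, map_pow, MvPolynomial.eval_X, mul_ne_zero_iff,
      Finset.prod_ne_zero_iff, sub_ne_zero, HasDistinctCubes, Finset.mem_univ, true_imp_iff,
      Finset.mem_filter, true_and, Prod.forall, ne_eq]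
    refine and_congr_right fun _ => ⟨fun h i j hij => ?_, fun h i j hij h' => hij (h h')⟩
    by_contra hne
    exact h i j hne hij
  have h0 : E ≠ 0 := by
    intro h0
    -- A generic point: distinct positive integers, whose cubes are distinct.
    have := (hgen fun i => ((Fintype.equivFin σ i : ℕ) + 1 : ℂ)).2 ⟨fun i => ?_, fun i j hij => ?_⟩
    · rw [h0, map_zero] at this
      exact this rfl
    · exact Nat.cast_add_one_ne_zero _
    · have h1 : ((Fintype.equivFin σ i : ℕ) + 1) ^ 3 = ((Fintype.equivFin σ j : ℕ) + 1) ^ 3 := by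
        simp only at hij
        exact_mod_cast hij
      have h2 := Nat.pow_left_injective (n := 3) (by norm_num) h1
      exact (Fintype.equivFin σ).injective (Fin.ext (by omega))
  have h1 : p * E = 0 := by
    apply MvPolynomial.funext
    intro z
    rw [map_mul, map_zero]
    by_cases hz : MvPolynomial.eval z E = 0
    · rw [hz, mul_zero]
    · rw [h z ((hgen z).1 hz), zero_mul]
  exact (mul_eq_zero.1 h1).resolve_right h0

theorem MvPolynomial.eval_aeval_polynomial (f : σ → Polynomial ℂ) (p : MvPolynomial σ ℂ) (t : ℂ) :
    (MvPolynomial.aeval f p).eval t = MvPolynomial.eval (fun k => (f k).eval t) p := by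
  induction p using MvPolynomial.induction_on with
  | C a => simp
  | add p q hp hq => simp [hp, hq]
  | mul_X p i hp => simp [hp]

theorem MvPolynomial.natDegree_aeval_le [Fintype σ] (f : σ → Polynomial ℂ) (p : MvPolynomial σ ℂ) :
    (MvPolynomial.aeval f p).natDegree ≤ ∑ k, p.degreeOf k * (f k).natDegree := by
  rw [MvPolynomial.aeval_eq_eval₂Hom, MvPolynomial.coe_eval₂Hom, MvPolynomial.eval₂_eq']
  refine Polynomial.natDegree_sum_le_of_forall_le _ _ fun d hd => ?_
  rw [Polynomial.algebraMap_eq]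
  refine (Polynomial.natDegree_C_mul_le _ _).trans ((Polynomial.natDegree_prod_le _ _).trans ?_)
  refine Finset.sum_le_sum fun k _ => Polynomial.natDegree_pow_le.trans ?_
  exact Nat.mul_le_mul_right _ (MvPolynomial.monomial_le_degreeOf k hd)

/-- A polynomial of degree at most `d` in `z i` vanishes if, for generic values of the
other variables, it has more than `d` zeros in `z i`. -/
theorem MvPolynomial.eq_zero_of_roots [Fintype σ] [DecidableEq σ] (p : MvPolynomial σ ℂ) (i : σ) (d : ℕ)
    (hd : p.degreeOf i ≤ d)
    (h : ∀ z, HasDistinctCubes z → ∃ S : Finset ℂ, d < S.card ∧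
      ∀ t ∈ S, MvPolynomial.eval (Function.update z i t) p = 0) : p = 0 := by
  refine MvPolynomial.eq_zero_of_eval_generic p fun z hz => ?_
  obtain ⟨S, hS, hS'⟩ := h z hz
  set f : σ → Polynomial ℂ :=
    Function.update (fun k => Polynomial.C (z k)) i Polynomial.X with hf
  have hfe : ∀ t, (fun k => (f k).eval t) = Function.update z i t := by
    intro t
    ext k
    by_cases hk : k = i
    · subst hk; simp [hf]
    · simp [hf, hk]
  have h0 : MvPolynomial.aeval f p = 0 := by
    refine Polynomial.eq_zero_of_natDegree_lt_card_of_eval_eq_zero' _ S (fun t ht => ?_) ?_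
    · rw [MvPolynomial.eval_aeval_polynomial, hfe, hS' t ht]
    · refine lt_of_le_of_lt (MvPolynomial.natDegree_aeval_le f p) (lt_of_le_of_lt ?_ hS)
      rw [Finset.sum_eq_single i]
      · simpa [hf] using hd
      · intro k _ hk
        simp [hf, hk]
      · simp
  have h1 := congrArg (Polynomial.eval (z i)) h0
  rw [MvPolynomial.eval_aeval_polynomial, hfe, Function.update_eq_self] at h1
  simpa using h1

theorem MvPolynomial.degreeOf_prod_le_of_le {ι : Type*} (i : σ) (s : Finset ι)
    (f : ι → MvPolynomial σ ℂ) (d : ι → ℕ) (h : ∀ j ∈ s, (f j).degreeOf i ≤ d j) :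
    (∏ j ∈ s, f j).degreeOf i ≤ ∑ j ∈ s, d j :=
  (MvPolynomial.degreeOf_prod_le i s f).trans (Finset.sum_le_sum h)

theorem MvPolynomial.degreeOf_sum_le_of_le {ι : Type*} (i : σ) (s : Finset ι)
    (f : ι → MvPolynomial σ ℂ) (d : ℕ) (h : ∀ j ∈ s, (f j).degreeOf i ≤ d) :
    (∑ j ∈ s, f j).degreeOf i ≤ d :=
  (MvPolynomial.degreeOf_sum_le i s f).trans (Finset.sup_le h)

theorem MvPolynomial.degreeOf_X_le (i j : σ) [DecidableEq σ] :
    (MvPolynomial.X j : MvPolynomial σ ℂ).degreeOf i ≤ if j = i then 1 else 0 := by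
  rw [MvPolynomial.degreeOf_X]
  simp [eq_comm]

/-- The gain from the asymmetric gauge: one of the two c-patterns has a constant weight, while the
other carries the whole factor `z * w`. -/
theorem degreeOf_vWeight_le (k : σ) (s si : ℂ) (x y : MvPolynomial σ ℂ) (l r t u : Bool) :
    (vWeight (MvPolynomial.C s) (MvPolynomial.C si) x y l r t u).degreeOf k ≤
      if l = true ∧ r = false then 0 else x.degreeOf k + y.degreeOf k := by
  have hC : ∀ (c : ℂ) (p : MvPolynomial σ ℂ),
      (MvPolynomial.C c * p).degreeOf k ≤ p.degreeOf k := fun c p =>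
    MvPolynomial.degreeOf_C_mul_le p k c
  have hk : (MvPolynomial.C si ^ 2 - MvPolynomial.C s ^ 2 : MvPolynomial σ ℂ) =
      MvPolynomial.C (si ^ 2 - s ^ 2) := by simp
  have h1 := hC s x
  have h2 := hC si x
  have h3 := hC s y
  have h4 := hC si y
  have h5 := MvPolynomial.degreeOf_sub_le k (MvPolynomial.C si * x) (MvPolynomial.C s * y)
  have h6 := MvPolynomial.degreeOf_sub_le k (MvPolynomial.C si * y) (MvPolynomial.C s * x)
  have h7 := hC (si ^ 2 - s ^ 2) (x * y)
  have h8 := MvPolynomial.degreeOf_mul_le k x y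
  have h9 := MvPolynomial.degreeOf_C (si ^ 2 - s ^ 2) k
  simp only [vWeight, iceWeight, hk]
  split_ifs <;> first | simp_all; done | omega

end GenericPoints

/-! ### Symmetry between rows and columns at a cube root of unity -/

section SixVertexCubeRoot

theorem Fin.exists_castSucc_succ_of_ne {n : ℕ} (h : Fin (n + 1) → Bool) (h0 : h 0 = true)
    (hl : h (Fin.last n) = false) : ∃ j : Fin n, h j.castSucc = true ∧ h j.succ = false := by
  by_contra hcon
  push Not at hcon
  have : ∀ j, h j = true := by
    intro j
    induction j using Fin.induction with
    | zero => exact h0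
    | succ j ih => simpa using hcon j ih
  simp [this] at hl

-- In the row with the variable, the arrows turn from right to left at some vertex. The weight there
-- is constant, and each of the other n - 1 weights has degree at most 1.
open MvPolynomial in
theorem degreeOf_dwPartition_le {σ : Type*} (k : σ) (s si : ℂ) {n : ℕ}
    (x y : Fin n → MvPolynomial σ ℂ) (i₀ : Fin n) (h0 : (x i₀).degreeOf k ≤ 1)
    (hx : ∀ i ≠ i₀, (x i).degreeOf k = 0) (hy : ∀ j, (y j).degreeOf k = 0) :
    (dwPartition (C s) (C si) n x y).degreeOf k ≤ n - 1 := by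
  classical
  rw [dwPartition_eq_sum]
  refine degreeOf_sum_le_of_le _ _ _ _ fun c hc => ?_
  obtain ⟨-, hc, -⟩ := Finset.mem_filter.1 hc
  refine (degreeOf_prod_le_of_le k _ _ (fun i => if i = i₀ then n - 1 else 0)
    fun i _ => ?_).trans (by simp)
  have hv := fun j => degreeOf_vWeight_le k s si (x i) (y j) (c.left i j) (c.right i j)
    (c.top i j) (c.bottom i j)
  split_ifs with hi
  · subst hi
    obtain ⟨j₀, hj0, hj1⟩ := Fin.exists_castSucc_succ_of_ne (c.1 i) (hc i).1 (hc i).2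
    refine (degreeOf_prod_le_of_le k _ _ (fun j => if j = j₀ then 0 else 1) fun j _ => ?_).trans ?_
    · refine (hv j).trans ?_
      split_ifs with h1 h2 h2
      · exact le_rfl
      · exact Nat.zero_le _
      · subst h2
        exact absurd ⟨hj0, hj1⟩ h1
      · rw [hy]; exact h0
    · simp [Finset.sum_ite, Finset.filter_ne', Finset.card_erase_of_mem]
  · refine (degreeOf_prod_le_of_le k _ _ (fun j => 0) fun j _ => ?_).trans (by simp)
    refine (hv j).trans ?_
    split_ifs
    · exact le_rfl
    · rw [hy, hx i hi]

theorem dwPartition_one (s si : ℂ) (x y : Fin 1 → ℂ) :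
    dwPartition s si 1 x y = si ^ 2 - s ^ 2 := by
  simp [dwPartition, rowTransfer, vWeight, iceWeight]

theorem dwPartition_remove' {s si : ℂ} (hs : s * si = 1) {n : ℕ}
    (x y : Fin (n + 1) → ℂ) (i j : Fin (n + 1)) (h : si * x i = s * y j) :
    dwPartition s si (n + 1) x y =
      (si ^ 2 - s ^ 2) * (∏ m, (si * y j - s * x (i.succAbove m))) *
        (∏ m, (si * y (j.succAbove m) - s * x i)) *
          dwPartition s si n (x ∘ i.succAbove) (y ∘ j.succAbove) := by
  rw [← dwPartition_comm hs, dwPartition_remove hs y x j i h, dwPartition_comm hs]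

theorem Finset.card_image_union_image {ι : Type*} [Fintype ι] [DecidableEq ι] (f g : ι → ℂ)
    (hf : f.Injective) (hg : g.Injective) (hfg : ∀ i j, f i ≠ g j) :
    (univ.image f ∪ univ.image g).card = 2 * Fintype.card ι := by
  rw [Finset.card_union_of_disjoint, Finset.card_image_of_injective _ hf,
    Finset.card_image_of_injective _ hg, Finset.card_univ, two_mul]
  rw [Finset.disjoint_left]
  simp only [Finset.mem_image, Finset.mem_univ, true_and]
  rintro _ ⟨i, rfl⟩ ⟨j, hj⟩
  exact hfg i j hj.symm

theorem cubeRoot_pow_three {s : ℂ} (hq : (s ^ 2) ^ 2 + s ^ 2 + 1 = 0) : (s ^ 2) ^ 3 = 1 := by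
  linear_combination (s ^ 2 - 1) * hq

theorem cubeRoot_inv_eq {s si : ℂ} (hs : s * si = 1) (hq : (s ^ 2) ^ 2 + s ^ 2 + 1 = 0) :
    si = (s ^ 2) ^ 2 * s := by
  have h3 := cubeRoot_pow_three hq
  linear_combination (-si) * h3 + (s ^ 2) ^ 2 * s * hs

theorem cubeRoot_ne_one {q : ℂ} (hq : q ^ 2 + q + 1 = 0) : q ≠ 1 := by
  rintro rfl
  norm_num at hq

theorem HasDistinctCubes.eq_of_mul_eq {σ : Type*} {z : σ → ℂ} (hz : HasDistinctCubes z) {c d : ℂ}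
    (hc : c ^ 3 = 1) (hd : d ^ 3 = 1) {i j : σ} (h : c * z i = d * z j) : i = j ∧ c = d := by
  have hij : i = j := hz.2 (by
    have h' := congrArg (· ^ 3) h
    simp only [mul_pow, hc, hd, one_mul] at h'
    exact h')
  subst hij
  exact ⟨rfl, mul_right_cancel₀ (hz.1 i) h⟩

-- Induction on the size. In the second row parameter t both sides have degree at most n + 1. For
-- each of the n + 1 remaining columns they agree at t = q y and at t = q² y: there a b- or an
-- a-weight vanishes, the row and the column are removed, and the smaller case applies. These 2(n +
-- 1) points suffice.
open MvPolynomial in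
theorem dwPartition_exchange {s si : ℂ} (hs : s * si = 1) (hq : (s ^ 2) ^ 2 + s ^ 2 + 1 = 0)
    {n : ℕ} (a b : ℂ) (x y : Fin n → ℂ) :
    dwPartition s si (n + 1) (Fin.cons a x) (Fin.cons b y) =
      dwPartition s si (n + 1) (Fin.cons b x) (Fin.cons a y) := by
  have h3 := cubeRoot_pow_three hq
  have hsi := cubeRoot_inv_eq hs hq
  have hs0 : s ≠ 0 := left_ne_zero_of_mul_eq_one hs
  induction n generalizing a b with
  | zero => rw [dwPartition_one, dwPartition_one]
  | succ n ih =>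
    have key : ∀ (a b t : ℂ) (x' : Fin n → ℂ) (y : Fin (n + 1) → ℂ) (m : Fin (n + 1)),
        (t = s ^ 2 * y m ∨ t = (s ^ 2) ^ 2 * y m) →
        dwPartition s si (n + 2) (Fin.cons a (Fin.cons t x')) (Fin.cons b y) =
          dwPartition s si (n + 2) (Fin.cons b (Fin.cons t x')) (Fin.cons a y) := by
      intro a b t x' y m htm
      have hx : ∀ a : ℂ, (Fin.cons a (Fin.cons t x') : Fin (n + 2) → ℂ) ∘
          (Fin.succ 0 : Fin (n + 2)).succAbove = Fin.cons a x' := by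
        intro a
        rw [Fin.cons_comp_succ_succAbove]
        congr 1
      have hy : ∀ b : ℂ, (Fin.cons b y : Fin (n + 2) → ℂ) ∘ m.succ.succAbove =
          Fin.cons b (y ∘ m.succAbove) := fun b => Fin.cons_comp_succ_succAbove b y m
      have hx' : ∀ a k, (Fin.cons a (Fin.cons t x') : Fin (n + 2) → ℂ)
          ((Fin.succ 0 : Fin (n + 2)).succAbove k) = (Fin.cons a x' : Fin (n + 1) → ℂ) k :=
        fun a k => congrFun (hx a) k
      have hy' : ∀ b k, (Fin.cons b y : Fin (n + 2) → ℂ) (m.succ.succAbove k) =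
          (Fin.cons b (y ∘ m.succAbove) : Fin (n + 1) → ℂ) k := fun b k => congrFun (hy b) k
      rcases htm with htm | htm
      · have h1 : si * t = s * y m := by rw [htm, hsi]; linear_combination s * y m * h3
        rw [dwPartition_remove' hs _ _ (Fin.succ 0) m.succ (by simpa using h1),
          dwPartition_remove' hs _ _ (Fin.succ 0) m.succ (by simpa using h1)]
        rw [hx, hx, hy, hy, ih a b]
        congr 1
        simp only [hx', hy', Fin.cons_succ, Fin.cons_zero]
        rw [Fin.prod_univ_succ, Fin.prod_univ_succ, Fin.prod_univ_succ, Fin.prod_univ_succ]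
        simp only [Fin.cons_zero, Fin.cons_succ]
        -- Of the factors that split off, only these two involve `a` and `b`; for a cube root of
        -- unity they have the same zero, so their product is symmetric in `a` and `b`.
        have h2 : (si * y m - s * a) * (si * b - s * t) =
            (si * y m - s * b) * (si * a - s * t) := by
          rw [htm, hsi]; linear_combination (s ^ 4 * (b - a) * y m) * h3
        linear_combination (si ^ 2 - s ^ 2) * (∏ i, (si * y m - s * x' i)) *
          (∏ i, (si * (y ∘ m.succAbove) i - s * t)) * h2
      · have h1 : si * y m = s * t := by rw [htm, hsi]; ring
        rw [dwPartition_remove hs _ _ (Fin.succ 0) m.succ (by simpa using h1),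
          dwPartition_remove hs _ _ (Fin.succ 0) m.succ (by simpa using h1)]
        rw [hx, hx, hy, hy, ih a b]
        congr 1
        simp only [hx', hy', Fin.cons_succ, Fin.cons_zero]
        rw [Fin.prod_univ_succ, Fin.prod_univ_succ, Fin.prod_univ_succ, Fin.prod_univ_succ]
        simp only [Fin.cons_zero, Fin.cons_succ]
        have h2 : (si * t - s * b) * (si * a - s * y m) =
            (si * t - s * a) * (si * b - s * y m) := by
          rw [htm, hsi]; linear_combination ((a - b) * y m * s ^ 2 * (s ^ 6 + 1)) * h3
        linear_combination (si ^ 2 - s ^ 2) * (∏ i, (si * t - s * (y ∘ m.succAbove) i)) *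
          (∏ i, (si * x' i - s * y m)) * h2
    -- `none` stands for the second row parameter, `some m` for a column parameter. The latter must
    -- also be variables, so that the interpolation points are distinct generically.
    set X' : ℂ → Fin (n + 2) → MvPolynomial (Option (Fin (n + 1))) ℂ :=
      fun a => Fin.cons (C a) (Fin.cons (X none) fun i => C (Fin.tail x i)) with hX'
    set Y' : ℂ → Fin (n + 2) → MvPolynomial (Option (Fin (n + 1))) ℂ :=
      fun b => Fin.cons (C b) fun m => X (some m) with hY'
    have heval : ∀ z a b, eval z (dwPartition (C s) (C si) (n + 2) (X' a) (Y' b)) =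
        dwPartition s si (n + 2) (Fin.cons a (Fin.cons (z none) (Fin.tail x)))
          (Fin.cons b fun m => z (some m)) := by
      intro z a b
      rw [map_dwPartition, eval_C, eval_C]
      congr 1
      · ext i
        refine Fin.cases (by simp [hX']) (fun i => ?_) i
        exact Fin.cases (by simp [hX']) (fun i => by simp [hX']) i
      · ext i
        exact Fin.cases (by simp [hY']) (fun i => by simp [hY']) i
    have hdeg : ∀ a b, (dwPartition (C s) (C si) (n + 2) (X' a) (Y' b)).degreeOf none ≤ n + 1 := by
      intro a b
      refine degreeOf_dwPartition_le none s si _ _ (Fin.succ 0) ?_ ?_ ?_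
      · refine (degreeOf_X_le none none).trans (by simp)
      · intro i
        refine Fin.cases (by simp [hX']) (fun i => ?_) i
        exact Fin.cases (by simp) (fun i _ => by simp [hX']) i
      · intro j
        exact Fin.cases (by simp [hY']) (fun i => by simp [hY', degreeOf_X]) j
    have h0 : dwPartition (C s) (C si) (n + 2) (X' a) (Y' b) -
        dwPartition (C s) (C si) (n + 2) (X' b) (Y' a) = 0 := by
      refine eq_zero_of_roots _ none (n + 1)
        ((degreeOf_sub_le _ _ _).trans (max_le (hdeg a b) (hdeg b a))) fun z hz => ?_
      refine ⟨univ.image (fun m => s ^ 2 * z (some m)) ∪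
        univ.image (fun m => (s ^ 2) ^ 2 * z (some m)), ?_, ?_⟩
      · have hq1 := cubeRoot_ne_one hq
        have h6 : ((s ^ 2) ^ 2) ^ 3 = 1 := by linear_combination ((s ^ 2) ^ 3 + 1) * h3
        rw [Finset.card_image_union_image]
        · simp
        · intro i j hij
          exact Option.some_injective _ (hz.eq_of_mul_eq h3 h3 hij).1
        · intro i j hij
          exact Option.some_injective _ (hz.eq_of_mul_eq h6 h6 hij).1
        · intro i j hij
          refine hq1 ?_
          have h7 := (hz.eq_of_mul_eq h3 h6 hij).2
          have h8 : s ^ 2 ≠ 0 := pow_ne_zero _ hs0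
          field_simp at h7
          exact h7.symm
      · intro t ht
        rw [map_sub, heval, heval, sub_eq_zero]
        obtain ⟨m, hm⟩ : ∃ m, t = s ^ 2 * z (some m) ∨ t = (s ^ 2) ^ 2 * z (some m) := by
          simp only [Finset.mem_union, Finset.mem_image, Finset.mem_univ, true_and] at ht
          rcases ht with ⟨m, hm⟩ | ⟨m, hm⟩
          · exact ⟨m, Or.inl hm.symm⟩
          · exact ⟨m, Or.inr hm.symm⟩
        simp only [Function.update_self, ne_eq, reduceCtorEq, not_false_eq_true,
          Function.update_of_ne]
        exact key a b t _ _ m hm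
    have h1 := congrArg (eval fun o : Option (Fin (n + 1)) => o.elim (x 0) y) h0
    rw [map_sub, heval, heval, map_zero, sub_eq_zero] at h1
    simpa using h1

end SixVertexCubeRoot

/-! ### The normalized partition function as a symmetric polynomial -/

section SixVertexPolynomial

/-- The square root `exp (π i / 3)` of `omega3`. -/
def sqrtOmega3 : ℂ := omega3 ^ (1 / 2 : ℂ)

theorem omega3_ne_zero : omega3 ≠ 0 := Complex.exp_ne_zero _

theorem omega3_pow_three : omega3 ^ 3 = 1 := by
  rw [omega3, ← Complex.exp_nat_mul, ← Complex.exp_two_pi_mul_I]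
  congr 1
  push_cast
  ring

theorem omega3_ne_one : omega3 ≠ 1 := by
  have h := Complex.isPrimitiveRoot_exp 3 (by norm_num)
  have h' : omega3 = Complex.exp (2 * Real.pi * Complex.I / (3 : ℕ)) := by
    rw [omega3]; norm_num
  rw [h']
  exact h.ne_one (by norm_num)

theorem omega3_quadratic : omega3 ^ 2 + omega3 + 1 = 0 := by
  have h : (omega3 - 1) * (omega3 ^ 2 + omega3 + 1) = 0 := by
    linear_combination omega3_pow_three
  exact (mul_eq_zero.1 h).resolve_left (sub_ne_zero.2 omega3_ne_one)

theorem omega3_inv : omega3⁻¹ = omega3 ^ 2 := by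
  refine inv_eq_of_mul_eq_one_right ?_
  linear_combination omega3_pow_three

theorem sqrtOmega3_sq : sqrtOmega3 ^ 2 = omega3 := by
  rw [sqrtOmega3, ← Complex.cpow_nat_mul]
  norm_num

theorem omega3_cpow_neg_half : omega3 ^ (-1 / 2 : ℂ) = sqrtOmega3⁻¹ := by
  rw [sqrtOmega3, ← Complex.cpow_neg]
  norm_num

theorem sqrtOmega3_ne_zero : sqrtOmega3 ≠ 0 := by
  intro h
  have := sqrtOmega3_sq
  rw [h] at this
  exact omega3_ne_zero (by rw [← this]; norm_num)

theorem sqrtOmega3_mul_inv : sqrtOmega3 * sqrtOmega3⁻¹ = 1 := mul_inv_cancel₀ sqrtOmega3_ne_zero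

theorem sqrtOmega3_quadratic : (sqrtOmega3 ^ 2) ^ 2 + sqrtOmega3 ^ 2 + 1 = 0 := by
  rw [sqrtOmega3_sq]; exact omega3_quadratic

theorem sqrtOmega3_inv : sqrtOmega3⁻¹ = omega3 ^ 2 * sqrtOmega3 := by
  rw [cubeRoot_inv_eq sqrtOmega3_mul_inv sqrtOmega3_quadratic, sqrtOmega3_sq]

/-- The constant `q⁻¹ - q`. -/
def omega3Diff : ℂ := omega3⁻¹ - omega3

theorem omega3Diff_sq : omega3Diff ^ 2 = -3 := by
  rw [omega3Diff, omega3_inv]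
  linear_combination (omega3 - 2) * omega3_pow_three + omega3_quadratic

theorem omega3Diff_ne_zero : omega3Diff ≠ 0 := by
  intro h
  have := omega3Diff_sq
  rw [h] at this
  norm_num at this

theorem sqrtOmega3_inv_sq_sub : sqrtOmega3⁻¹ ^ 2 - sqrtOmega3 ^ 2 = omega3Diff := by
  rw [inv_pow, sqrtOmega3_sq, omega3Diff]

/-- The normalized domain wall partition function with row parameters `x` and column
parameters `y`. -/
def sixVertexValue (n : ℕ) (x y : Fin n → ℂ) : ℂ :=
  (-1) ^ (n * (n - 1) / 2) * (omega3Diff ^ n)⁻¹ * dwPartition sqrtOmega3 sqrtOmega3⁻¹ n x y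

open MvPolynomial in
/-- The normalized domain wall partition function as a polynomial in the parameters. -/
def sixVertexPoly (n : ℕ) : MvPolynomial (Fin (2 * n)) ℂ :=
  C ((-1) ^ (n * (n - 1) / 2) * (omega3Diff ^ n)⁻¹) *
    dwPartition (C sqrtOmega3) (C sqrtOmega3⁻¹) n (fun i => X ⟨i, by omega⟩)
      (fun j => X ⟨n + j, by omega⟩)

theorem eval_sixVertexPoly (n : ℕ) (z : Fin (2 * n) → ℂ) :
    MvPolynomial.eval z (sixVertexPoly n) = sixVertexValue n (rowParam z) (colParam z) := by
  rw [sixVertexPoly, map_mul, map_dwPartition]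
  simp only [MvPolynomial.eval_C, MvPolynomial.eval_X]
  rfl

/-- Rows and columns as positions in the list of all parameters. -/
def rowColEquiv (n : ℕ) : Fin n ⊕ Fin n ≃ Fin (2 * n) :=
  finSumFinEquiv.trans (finCongr (two_mul n).symm)

theorem eval_sixVertexPoly' (n : ℕ) (z : Fin (2 * n) → ℂ) :
    MvPolynomial.eval z (sixVertexPoly n) =
      sixVertexValue n (fun i => z (rowColEquiv n (Sum.inl i)))
        (fun i => z (rowColEquiv n (Sum.inr i))) := by
  rw [eval_sixVertexPoly]
  rfl

theorem sixVertexValue_exchange {n : ℕ} (x y : Fin (n + 1) → ℂ) :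
    sixVertexValue (n + 1) x y =
      sixVertexValue (n + 1) (Function.update x 0 (y 0)) (Function.update y 0 (x 0)) := by
  rw [sixVertexValue, sixVertexValue]
  congr 1
  have h := dwPartition_exchange sqrtOmega3_mul_inv sqrtOmega3_quadratic (x 0) (y 0) (Fin.tail x)
    (Fin.tail y)
  rw [Fin.cons_self_tail, Fin.cons_self_tail] at h
  rw [h]
  congr 1
  · ext i; exact Fin.cases (by simp) (fun i => by simp [Fin.tail]) i
  · ext i; exact Fin.cases (by simp) (fun i => by simp [Fin.tail]) i

/-- Transpositions generate. Inside the rows or the columns they are covered by Yang–Baxter; a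
transposition of a row and a column is conjugate, by such permutations, to that of row 0 and column
0, which is `sixVertexValue_exchange`. -/
theorem sixVertexValue_perm {n : ℕ} (z : Fin n ⊕ Fin n → ℂ) (σ : Equiv.Perm (Fin n ⊕ Fin n)) :
    sixVertexValue n (fun i => z (σ (Sum.inl i))) (fun i => z (σ (Sum.inr i))) =
      sixVertexValue n (fun i => z (Sum.inl i)) (fun i => z (Sum.inr i)) := by
  revert z
  have hsum : ∀ (τ ρ : Equiv.Perm (Fin n)) (z : Fin n ⊕ Fin n → ℂ),
      sixVertexValue n (fun i => z (Equiv.sumCongr τ ρ (Sum.inl i)))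
        (fun i => z (Equiv.sumCongr τ ρ (Sum.inr i))) =
      sixVertexValue n (fun i => z (Sum.inl i)) (fun i => z (Sum.inr i)) := by
    intro τ ρ z
    simp only [sixVertexValue, Equiv.sumCongr_apply, Sum.map_inl, Sum.map_inr]
    congr 1
    exact (dwPartition_comp_perm sqrtOmega3_mul_inv (fun i => z (Sum.inl i)) _ τ).trans
      (dwPartition_comp_perm_right sqrtOmega3_mul_inv _ (fun i => z (Sum.inr i)) ρ)
  have hmul : ∀ τ ρ : Equiv.Perm (Fin n ⊕ Fin n),
      (∀ z : Fin n ⊕ Fin n → ℂ, sixVertexValue n (fun i => z (τ (Sum.inl i)))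
        (fun i => z (τ (Sum.inr i))) =
        sixVertexValue n (fun i => z (Sum.inl i)) (fun i => z (Sum.inr i))) →
      (∀ z : Fin n ⊕ Fin n → ℂ, sixVertexValue n (fun i => z (ρ (Sum.inl i)))
        (fun i => z (ρ (Sum.inr i))) =
        sixVertexValue n (fun i => z (Sum.inl i)) (fun i => z (Sum.inr i))) →
      ∀ z : Fin n ⊕ Fin n → ℂ, sixVertexValue n (fun i => z ((τ * ρ) (Sum.inl i)))
        (fun i => z ((τ * ρ) (Sum.inr i))) =
        sixVertexValue n (fun i => z (Sum.inl i)) (fun i => z (Sum.inr i)) := by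
    intro τ ρ hτ hρ z
    exact (hρ fun i => z (τ i)).trans (hτ z)
  have hswap : ∀ a b : Fin n, ∀ z : Fin n ⊕ Fin n → ℂ,
      sixVertexValue n (fun i => z (Equiv.swap (Sum.inl a) (Sum.inr b) (Sum.inl i)))
        (fun i => z (Equiv.swap (Sum.inl a) (Sum.inr b) (Sum.inr i))) =
      sixVertexValue n (fun i => z (Sum.inl i)) (fun i => z (Sum.inr i)) := by
    intro a b
    obtain ⟨m, rfl⟩ : ∃ m, n = m + 1 := ⟨n - 1, by have := a.2; omega⟩
    have h : Equiv.swap (Sum.inl a : Fin (m + 1) ⊕ Fin (m + 1)) (Sum.inr b) =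
        Equiv.sumCongr (Equiv.swap 0 a) (Equiv.swap 0 b) * Equiv.swap (Sum.inl 0) (Sum.inr 0) *
          (Equiv.sumCongr (Equiv.swap 0 a) (Equiv.swap 0 b))⁻¹ := by
      rw [← Equiv.swap_apply_apply]
      simp
    rw [h]
    refine hmul _ _ (hmul _ _ (hsum _ _) fun z => ?_) ?_
    · rw [sixVertexValue_exchange]
      congr 1
      · ext i
        by_cases hi : i = 0
        · subst hi; simp
        · rw [Function.update_of_ne hi, Equiv.swap_apply_of_ne_of_ne] <;> simp [hi]
      · ext i
        by_cases hi : i = 0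
        · subst hi; simp
        · rw [Function.update_of_ne hi, Equiv.swap_apply_of_ne_of_ne] <;> simp [hi]
    · have : (Equiv.sumCongr (Equiv.swap 0 a) (Equiv.swap 0 b))⁻¹ =
          Equiv.sumCongr (Equiv.swap 0 a)⁻¹ (Equiv.swap 0 b)⁻¹ := by
        ext x; cases x <;> rfl
      rw [this]
      exact hsum _ _
  induction σ using Equiv.Perm.swap_induction_on with
  | one => intro z; rfl
  | swap_mul f x y hxy ih =>
    refine hmul _ _ ?_ ih
    rcases x with a | a <;> rcases y with b | b
    · have : Equiv.swap (Sum.inl a : Fin n ⊕ Fin n) (Sum.inl b) =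
          Equiv.sumCongr (Equiv.swap a b) 1 := (Equiv.Perm.sumCongr_swap_one a b).symm
      rw [this]
      exact hsum _ _
    · exact hswap a b
    · rw [Equiv.swap_comm]
      exact hswap b a
    · have : Equiv.swap (Sum.inr a : Fin n ⊕ Fin n) (Sum.inr b) =
          Equiv.sumCongr 1 (Equiv.swap a b) := (Equiv.Perm.sumCongr_one_swap a b).symm
      rw [this]
      exact hsum _ _

theorem sixVertexPoly_perm {n : ℕ} (z : Fin (2 * n) → ℂ) (σ : Equiv.Perm (Fin (2 * n))) :
    MvPolynomial.eval (fun i => z (σ i)) (sixVertexPoly n) =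
      MvPolynomial.eval z (sixVertexPoly n) := by
  rw [eval_sixVertexPoly', eval_sixVertexPoly']
  have h := sixVertexValue_perm (fun i => z (rowColEquiv n i))
    (((rowColEquiv n).trans σ).trans (rowColEquiv n).symm)
  simpa using h

/-- The column parameter makes the b-weight vanish where row 0 and column 0 meet. The normalization
is chosen for this formula: the sign gains (-1) ^ n from one size to the next, which compensates for
the n column factors, and the powers of s and s⁻¹ cancel. -/
theorem sixVertexValue_corner {n : ℕ} (a : ℂ) (x y : Fin n → ℂ) :
    sixVertexValue (n + 1) (Fin.cons a x) (Fin.cons (omega3 ^ 2 * a) y) =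
      (∏ i, (omega3 * a - x i)) * (∏ i, (omega3 * a - y i)) * sixVertexValue n x y := by
  have h3 := omega3_pow_three
  have hsi := sqrtOmega3_inv
  have hs2 := sqrtOmega3_sq
  have hx : ∀ m, sqrtOmega3⁻¹ * (omega3 ^ 2 * a) - sqrtOmega3 * x m =
      sqrtOmega3 * (omega3 * a - x m) := fun m => by
    rw [hsi]; linear_combination sqrtOmega3 * omega3 * a * h3
  have hy : ∀ m, sqrtOmega3⁻¹ * y m - sqrtOmega3 * a =
      -sqrtOmega3⁻¹ * (omega3 * a - y m) := fun m => by
    rw [hsi]; linear_combination sqrtOmega3 * a * h3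
  have hsign : ((-1) ^ ((n + 1) * (n + 1 - 1) / 2) : ℂ) = (-1) ^ (n * (n - 1) / 2) * (-1) ^ n := by
    rw [← pow_add, ← Nat.choose_two_right, ← Nat.choose_two_right, Nat.choose_succ_succ' n 1,
      Nat.choose_one_right, add_comm]
  rw [sixVertexValue, dwPartition_remove' sqrtOmega3_mul_inv _ _ 0 0, sqrtOmega3_inv_sq_sub, hsign]
  · simp only [Fin.succAbove_zero, Fin.cons_zero, Fin.cons_succ, hx, hy, Finset.prod_mul_distrib,
      Finset.prod_const, Finset.card_univ, Fintype.card_fin]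
    rw [sixVertexValue]
    have h4 : sqrtOmega3 ^ n * (-sqrtOmega3⁻¹) ^ n * (-1) ^ n = 1 := by
      rw [← mul_pow, ← mul_pow]
      simp [sqrtOmega3_ne_zero]
    have h5 : (omega3Diff ^ (n + 1))⁻¹ * omega3Diff = (omega3Diff ^ n)⁻¹ := by
      have := omega3Diff_ne_zero
      field_simp
      ring
    have h6 : ((Fin.cons a x : Fin (n + 1) → ℂ) ∘ Fin.succ) = x := by ext; simp
    have h7 : ((Fin.cons (omega3 ^ 2 * a) y : Fin (n + 1) → ℂ) ∘ Fin.succ) = y := by ext; simp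
    rw [h6, h7, ← h5]
    linear_combination (-1) ^ (n * (n - 1) / 2) * ((omega3Diff ^ (n + 1))⁻¹ * omega3Diff) *
      (∏ i, (omega3 * a - x i)) * (∏ i, (omega3 * a - y i)) *
      dwPartition sqrtOmega3 sqrtOmega3⁻¹ n x y * h4
  · simp only [Fin.cons_zero, hsi]
    ring

/-- The value of the polynomial at `z` with `z j' = q² z i`. -/
theorem sixVertexPoly_recursion (n : ℕ) (z : Fin (2 * (n + 1)) → ℂ) (i : Fin (2 * n + 2))
    (j : Fin (2 * n + 1)) (h : z (i.succAbove j) = omega3 ^ 2 * z i) :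
    MvPolynomial.eval z (sixVertexPoly (n + 1)) =
      (∏ k : Fin (2 * n), (omega3 * z i - z (i.succAbove (j.succAbove k)))) *
        MvPolynomial.eval (fun k : Fin (2 * n) => z (i.succAbove (j.succAbove k)))
          (sixVertexPoly n) := by
  -- By full symmetry `i` may be placed in row 0 and its partner in column 0, with the other
  -- parameters in their order.
  set g : Fin (n + 1) ⊕ Fin (n + 1) → Fin (2 * n + 2) := Sum.elim
    (Fin.cons i fun k => i.succAbove (j.succAbove (rowColEquiv n (Sum.inl k))))
    (Fin.cons (i.succAbove j) fun k => i.succAbove (j.succAbove (rowColEquiv n (Sum.inr k))))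
    with hg
  have hinj : Function.Injective g := by
    refine Function.Injective.sumElim ?_ ?_ ?_
    · refine Fin.cons_injective_iff.2 ⟨?_, ?_⟩
      · rintro ⟨k, hk⟩
        exact Fin.succAbove_ne _ _ hk
      · exact Fin.succAbove_right_injective.comp (Fin.succAbove_right_injective.comp
          ((rowColEquiv n).injective.comp Sum.inl_injective))
    · refine Fin.cons_injective_iff.2 ⟨?_, ?_⟩
      · rintro ⟨k, hk⟩
        exact Fin.succAbove_ne _ _ (Fin.succAbove_right_injective hk)
      · exact Fin.succAbove_right_injective.comp (Fin.succAbove_right_injective.comp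
          ((rowColEquiv n).injective.comp Sum.inr_injective))
    · intro a b
      refine Fin.cases ?_ (fun a => ?_) a <;> refine Fin.cases ?_ (fun b => ?_) b
      · exact (Fin.succAbove_ne _ _).symm
      · exact (Fin.succAbove_ne _ _).symm
      · intro h
        exact Fin.succAbove_ne _ _ (Fin.succAbove_right_injective h)
      · intro h
        have := (rowColEquiv n).injective
          (Fin.succAbove_right_injective (Fin.succAbove_right_injective h))
        simp at this
  set σ : Equiv.Perm (Fin (n + 1) ⊕ Fin (n + 1)) :=
    (Equiv.ofBijective g ((Fintype.bijective_iff_injective_and_card g).2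
      ⟨hinj, by simp; omega⟩)).trans (rowColEquiv (n + 1)).symm with hσ
  have h1 := sixVertexValue_perm (fun k => z (rowColEquiv (n + 1) k)) σ
  rw [eval_sixVertexPoly', ← h1]
  have h2 : ∀ k, z (rowColEquiv (n + 1) (σ k)) = z (g k) := by
    intro k
    simp [hσ]
  simp only [h2]
  have h3 := sixVertexValue_corner (z i)
    (fun k => z (i.succAbove (j.succAbove (rowColEquiv n (Sum.inl k)))))
    (fun k => z (i.succAbove (j.succAbove (rowColEquiv n (Sum.inr k)))))
  rw [eval_sixVertexPoly', ← Equiv.prod_comp (rowColEquiv n), Fintype.prod_sum_type, ← h3]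
  congr 1
  · ext k; exact Fin.cases (by simp [hg]) (fun k => by simp [hg]) k
  · ext k; exact Fin.cases (by simp [hg, h]) (fun k => by simp [hg]) k

end SixVertexPolynomial

/-! ### Wheel condition, special values and degree -/

section SixVertexPolynomialProperties

theorem sixVertexValue_zero (x y : Fin 0 → ℂ) : sixVertexValue 0 x y = 1 := by
  simp [sixVertexValue, dwPartition, Matrix.one_apply, eq_iff_true_of_subsingleton]

theorem sixVertexValue_one (x y : Fin 1 → ℂ) : sixVertexValue 1 x y = 1 := by
  rw [sixVertexValue, dwPartition_one, sqrtOmega3_inv_sq_sub]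
  simp [omega3Diff_ne_zero]

/-- The recursion for the pair (i, j) produces the factor q z_i - z_k. By symmetry no order of the
indices is required. -/
theorem sixVertexPoly_wheel (n : ℕ) (z : Fin (2 * n) → ℂ) {i j k : Fin (2 * n)} (hij : i ≠ j)
    (hik : i ≠ k) (hjk : j ≠ k) (hj : z j = omega3 ^ 2 * z i) (hk : z k = omega3 * z i) :
    MvPolynomial.eval z (sixVertexPoly n) = 0 := by
  obtain ⟨n, rfl⟩ : ∃ m, n = m + 1 := ⟨n - 1, by have := i.2; omega⟩
  obtain ⟨j', rfl⟩ := Fin.exists_succAbove_eq (n := 2 * n + 1) hij.symm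
  obtain ⟨k', rfl⟩ := Fin.exists_succAbove_eq (n := 2 * n + 1) hik.symm
  obtain ⟨k'', rfl⟩ := Fin.exists_succAbove_eq (n := 2 * n) (x := k') (y := j')
    (fun h => hjk (by rw [h]))
  rw [sixVertexPoly_recursion n z i j' hj, Finset.prod_eq_zero (Finset.mem_univ k''), zero_mul]
  exact sub_eq_zero.2 hk.symm

/-- With d² = -q and c² = 3 one has 1 - q = c d and 1 - q⁻¹ = c d⁻¹. In a balanced product the
powers of d cancel and c ^ (2n) = 3 ^ n is left. -/
theorem prod_one_sub_omega3_zpow (n : ℕ) (ε : Fin (2 * n) → ℤ) (h1 : ∀ i, ε i = 1 ∨ ε i = -1)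
    (h0 : ∑ i, ε i = 0) : ∏ i, (1 - omega3 ^ ε i) = 3 ^ n := by
  have hq := omega3_quadratic
  obtain ⟨d, hd⟩ : ∃ d, d = Complex.I * sqrtOmega3 := ⟨_, rfl⟩
  have hd2 : d ^ 2 = -omega3 := by rw [hd, mul_pow, Complex.I_sq, sqrtOmega3_sq]; ring
  have hd0 : d ≠ 0 := hd ▸ mul_ne_zero Complex.I_ne_zero sqrtOmega3_ne_zero
  obtain ⟨c, hc⟩ : ∃ c, c = (1 - omega3) / d := ⟨_, rfl⟩
  have hcd : c * d = 1 - omega3 := by rw [hc]; field_simp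
  have hc2 : c ^ 2 = 3 := by
    rw [hc, div_pow, hd2, div_eq_iff (neg_ne_zero.2 omega3_ne_zero)]
    linear_combination hq
  have hfac : ∀ i, 1 - omega3 ^ ε i = c * d ^ ε i := by
    intro i
    rcases h1 i with h | h <;> rw [h]
    · simpa using hcd.symm
    · rw [zpow_neg_one, zpow_neg_one, omega3_inv, ← div_eq_mul_inv, eq_div_iff hd0]
      have h4 : -omega3 * ((1 - omega3 ^ 2) * d - c) = 0 := by
        have : c * (-omega3) = (1 - omega3) * d := by rw [← hd2]; rw [← hcd]; ring
        linear_combination -this + d * omega3_pow_three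
      exact sub_eq_zero.1 ((mul_eq_zero.1 h4).resolve_left (neg_ne_zero.2 omega3_ne_zero))
  have hsum : ∀ s : Finset (Fin (2 * n)), ∏ i ∈ s, d ^ ε i = d ^ ∑ i ∈ s, ε i := by
    intro s
    induction s using Finset.induction_on with
    | empty => simp
    | insert a s ha ih => rw [Finset.prod_insert ha, Finset.sum_insert ha, zpow_add₀ hd0, ih]
  simp only [hfac, Finset.prod_mul_distrib, hsum, h0, Finset.prod_const, Finset.card_univ,
    Fintype.card_fin, zpow_zero, mul_one, pow_mul, hc2]

theorem exists_adjacent_neg_pos {n : ℕ} (ε : Fin (2 * n + 2) → ℤ)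
    (h1 : ∀ i, ε i = 1 ∨ ε i = -1) (h0 : ∑ i, ε i = 0) (hz : ε 0 ≤ 0) :
    ∃ p : Fin (2 * n + 1), ε p.castSucc = -1 ∧ ε p.succ = 1 := by
  by_contra hcon
  push Not at hcon
  have : ∀ j, ε j = -1 := by
    intro j
    induction j using Fin.induction with
    | zero => rcases h1 0 with h | h <;> omega
    | succ j ih => exact (h1 _).resolve_left (hcon j ih)
  simp [this] at h0
  omega

/-- A Dyck path has adjacent steps -1, +1. The corresponding parameters are q⁻¹ and q = q² q⁻¹, so
the recursion removes them; its factors are 1 - q ^ ε, with product 3 ^ n, and what remains is a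
Dyck path. -/
theorem sixVertexPoly_dyck (n : ℕ) (ε : Fin (2 * n) → ℤ) (h1 : ∀ i, ε i = 1 ∨ ε i = -1)
    (h0 : ∑ i, ε i = 0) (hle : ∀ j, ∑ i with i ≤ j, ε i ≤ 0) :
    MvPolynomial.eval (fun i => omega3 ^ ε i) (sixVertexPoly n) = 3 ^ n.choose 2 := by
  induction n with
  | zero => exact (eval_sixVertexPoly 0 _).trans ((sixVertexValue_zero _ _).trans (by simp))
  | succ n ih =>
    obtain ⟨p, hp, hp'⟩ := exists_adjacent_neg_pos ε h1 h0 (by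
      have h := hle (0 : Fin (2 * n + 2))
      have h2 : (univ.filter fun i : Fin (2 * n + 2) => i ≤ 0) = {0} := by
        ext i; simp
      erw [h2] at h
      simpa using h)
    have hps : p.castSucc.succAbove p = p.succ := Fin.succAbove_castSucc_self p
    set e : Fin (2 * n) → Fin (2 * n + 2) := fun k => p.castSucc.succAbove (p.succAbove k) with he
    have hemono : StrictMono e := (Fin.strictMono_succAbove _).comp (Fin.strictMono_succAbove _)
    have hsplit : ∀ f : Fin (2 * n + 2) → ℤ, ∑ i, f i = f p.castSucc + f p.succ + ∑ k, f (e k) := by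
      intro f
      rw [Fin.sum_univ_succAbove f p.castSucc, Fin.sum_univ_succAbove _ p, hps, add_assoc]
    have h0' : ∑ k, ε (e k) = 0 := by
      have := hsplit ε
      rw [hp, hp'] at this
      have h00 : ∑ i : Fin (2 * n + 2), ε i = 0 := h0
      omega
    have hrec := sixVertexPoly_recursion n (fun i => omega3 ^ ε i) p.castSucc p (by
      have : ε (p.castSucc.succAbove p) = 1 := by rw [hps]; exact hp'
      simp only [this, hp]
      rw [zpow_one, zpow_neg_one]
      have := omega3_ne_zero
      field_simp)
    refine hrec.trans ?_
    rw [ih (fun k => ε (e k)) (fun k => h1 _) h0' fun j => ?_]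
    · have h3 := prod_one_sub_omega3_zpow n (fun k => ε (e k)) (fun k => h1 _) h0'
      have h4 : omega3 * omega3 ^ ε p.castSucc = 1 := by
        rw [hp, zpow_neg_one, mul_inv_cancel₀ omega3_ne_zero]
      simp only [h4]
      rw [h3, ← pow_add, Nat.choose_succ_succ' n 1, Nat.choose_one_right]
    · have h5 := hle (e j)
      rw [Finset.sum_filter] at h5 ⊢
      have h6 := hsplit fun i => if i ≤ e j then ε i else 0
      -- The removed steps are adjacent, so a partial sum ending at a remaining index contains both
      -- or neither. Their total is zero, and partial sums are unchanged.
      have h7 : (p.castSucc ≤ e j) ↔ p.succ ≤ e j := by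
        have hne : e j ≠ p.castSucc := Fin.succAbove_ne _ _
        rw [Fin.le_def, Fin.le_def, Fin.val_castSucc, Fin.val_succ]
        have : (e j : ℕ) ≠ p := fun h => hne (Fin.ext (by simpa using h))
        omega
      have h8 : ((if p.castSucc ≤ e j then ε p.castSucc else 0) +
          if p.succ ≤ e j then ε p.succ else 0) = 0 := by
        rw [hp, hp']
        by_cases h : p.succ ≤ e j
        · rw [if_pos (h7.2 h), if_pos h]; rfl
        · rw [if_neg (fun h' => h (h7.1 h')), if_neg h]; rfl
      simp only [hemono.le_iff_le] at h6
      rw [h8, zero_add] at h6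
      rw [← h6]
      exact h5

theorem MvPolynomial.degreeOf_aeval_le {σ τ : Type*} [Fintype σ] (i : τ)
    (f : σ → MvPolynomial τ ℂ) (p : MvPolynomial σ ℂ) :
    (MvPolynomial.aeval f p).degreeOf i ≤ ∑ k, p.degreeOf k * (f k).degreeOf i := by
  rw [MvPolynomial.aeval_eq_eval₂Hom, MvPolynomial.coe_eval₂Hom, MvPolynomial.eval₂_eq']
  refine MvPolynomial.degreeOf_sum_le_of_le _ _ _ _ fun d hd => ?_
  rw [MvPolynomial.algebraMap_eq]
  refine (MvPolynomial.degreeOf_C_mul_le _ _ _).trans ?_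
  refine MvPolynomial.degreeOf_prod_le_of_le _ _ _ _ fun k _ => ?_
  refine (MvPolynomial.degreeOf_pow_le _ _ _).trans ?_
  exact Nat.mul_le_mul_right _ (MvPolynomial.monomial_le_degreeOf k hd)

open MvPolynomial in
theorem degreeOf_sixVertexPoly_le (n : ℕ) (k : Fin (2 * n)) :
    (sixVertexPoly n).degreeOf k ≤ n - 1 := by
  refine (degreeOf_C_mul_le _ _ _).trans ?_
  by_cases hk : (k : ℕ) < n
  · refine degreeOf_dwPartition_le k _ _ _ _ ⟨k, hk⟩ ?_ ?_ ?_
    · simp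
    · intro i hi
      have : k ≠ ⟨i, by omega⟩ := fun h => hi (by ext; simp [h])
      simp [degreeOf_X, this]
    · intro j
      have : k ≠ ⟨n + j, by omega⟩ := fun h => by rw [h] at hk; simp at hk
      simp [degreeOf_X, this]
  · rw [← dwPartition_comm (by rw [← map_mul, sqrtOmega3_mul_inv, map_one])]
    refine degreeOf_dwPartition_le k _ _ _ _ ⟨k - n, by omega⟩ ?_ ?_ ?_
    · have : (⟨n + (k - n), by omega⟩ : Fin (2 * n)) = k := by ext; simp; omega
      simp [this]
    · intro i hi
      have : k ≠ ⟨n + i, by omega⟩ := fun h => hi (by ext; simp [h])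
      simp [degreeOf_X, this]
    · intro j
      have : k ≠ ⟨j, by omega⟩ := fun h => by rw [h] at hk; simp at hk
      simp [degreeOf_X, this]

-- The substitution of q² z_a for another variable does not raise the degree in a third variable c.
-- By the recursion its result has the factor q z_a - z_c, of degree 1 in z_c, and a smaller
-- polynomial of known degree.
open MvPolynomial in
theorem le_degreeOf_sixVertexPoly (n : ℕ) :
    sixVertexPoly (n + 1) ≠ 0 ∧ ∀ k, n ≤ (sixVertexPoly (n + 1)).degreeOf k := by
  induction n with
  | zero =>
    refine ⟨fun h => ?_, fun k => Nat.zero_le _⟩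
    have h1 := eval_sixVertexPoly 1 0
    rw [sixVertexValue_one, h, map_zero] at h1
    exact zero_ne_one h1
  | succ n ih =>
    have hsub : ∀ (a : Fin (2 * (n + 1) + 2)) (b : Fin (2 * (n + 1) + 1)),
        aeval (Function.update X (a.succAbove b) (C (omega3 ^ 2) * X a) :
          Fin (2 * (n + 1) + 2) → MvPolynomial (Fin (2 * (n + 1) + 2)) ℂ) (sixVertexPoly (n + 2)) =
        (∏ k, (C omega3 * X a - X (a.succAbove (b.succAbove k)))) *
          rename (fun k => a.succAbove (b.succAbove k)) (sixVertexPoly (n + 1)) := by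
      intro a b
      apply MvPolynomial.funext
      intro z
      have h1 := sixVertexPoly_recursion (n + 1)
        (fun k => eval z ((Function.update X (a.succAbove b) (C (omega3 ^ 2) * X a) :
          Fin (2 * (n + 1) + 2) → MvPolynomial (Fin (2 * (n + 1) + 2)) ℂ) k)) a b (by
            rw [Function.update_self, Function.update_of_ne (Fin.succAbove_ne a b).symm]
            simp)
      have h2 : ∀ k, a.succAbove (b.succAbove k) ≠ a.succAbove b := fun k h =>
        Fin.succAbove_ne b k (Fin.succAbove_right_injective h)
      simp only [Function.update_of_ne (h2 _), Function.update_of_ne (Fin.succAbove_ne a b).symm,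
        eval_X] at h1
      rw [map_mul, map_prod, eval_rename, ← coe_aeval_eq_eval, RingHom.coe_coe,
        ← AlgHom.comp_apply, comp_aeval]
      simp only [map_sub, map_mul, aeval_C, aeval_X, Algebra.algebraMap_self, RingHom.id_apply]
      exact h1
    have hne : ∀ (a : Fin (2 * (n + 1) + 2)) (b : Fin (2 * (n + 1) + 1)) k,
        (C omega3 * X a - X (a.succAbove (b.succAbove k)) : MvPolynomial _ ℂ) ≠ 0 := by
      intro a b k h
      have h1 := congrArg (eval (Pi.single (a.succAbove (b.succAbove k)) 1)) h
      simp at h1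
    have hne' : ∀ (a : Fin (2 * (n + 1) + 2)) (b : Fin (2 * (n + 1) + 1)),
        rename (fun k => a.succAbove (b.succAbove k)) (sixVertexPoly (n + 1)) ≠ 0 := by
      intro a b h
      refine ih.1 (rename_injective _ ?_ (h.trans (map_zero _).symm))
      exact Fin.succAbove_right_injective.comp Fin.succAbove_right_injective
    constructor
    · intro h
      have h1 := hsub 0 0
      rw [h, map_zero] at h1
      exact mul_ne_zero (Finset.prod_ne_zero_iff.2 fun k _ => hne 0 0 k) (hne' 0 0) h1.symm
    · intro c
      -- There are at least four variables, so a pair can be chosen that avoids `c`.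
      obtain ⟨a, b, k, hk⟩ : ∃ (a : Fin (2 * (n + 1) + 2)) (b : Fin (2 * (n + 1) + 1))
          (k : Fin (2 * (n + 1))), a.succAbove (b.succAbove k) = c := by
        obtain ⟨a, ha⟩ := exists_ne (c : Fin (2 * (n + 1) + 2))
        obtain ⟨c', hc'⟩ := Fin.exists_succAbove_eq ha.symm
        obtain ⟨b, hb⟩ := exists_ne (c' : Fin (2 * n + 2 + 1))
        obtain ⟨k, hk⟩ := Fin.exists_succAbove_eq hb.symm
        exact ⟨a, b, k, by rw [hk, hc']⟩
      have hca : c ≠ a := hk ▸ Fin.succAbove_ne _ _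
      have hcb : c ≠ a.succAbove b := fun h =>
        Fin.succAbove_ne b k (Fin.succAbove_right_injective (hk.trans h))
      have h1 := congrArg (degreeOf c) (hsub a b)
      rw [degreeOf_mul_eq (Finset.prod_ne_zero_iff.2 fun k _ => hne a b k) (hne' a b),
        degreeOf_prod_eq _ _ fun k _ => hne a b k] at h1
      have h2 : n ≤ (rename (fun k => a.succAbove (b.succAbove k))
          (sixVertexPoly (n + 1))).degreeOf c := by
        have hinj : Function.Injective fun k => a.succAbove (b.succAbove k) :=
          Fin.succAbove_right_injective.comp Fin.succAbove_right_injective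
        have h5 := degreeOf_rename_of_injective (p := sixVertexPoly (n + 1)) hinj k
        rw [← hk]
        exact (ih.2 k).trans h5.ge
      have h3 : 1 ≤ ∑ k, (C omega3 * X a - X (a.succAbove (b.succAbove k)) :
          MvPolynomial (Fin (2 * (n + 1) + 2)) ℂ).degreeOf c := by
        refine le_trans ?_ (Finset.single_le_sum (fun _ _ => Nat.zero_le _) (Finset.mem_univ k))
        rw [hk]
        have h5 := degreeOf_sub_le c (C omega3 * X a : MvPolynomial (Fin (2 * (n + 1) + 2)) ℂ)
          (C omega3 * X a - X c)
        have h6 : degreeOf c (C omega3 * X a : MvPolynomial (Fin (2 * (n + 1) + 2)) ℂ) ≤ 0 :=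
          (degreeOf_C_mul_le _ _ _).trans (by rw [degreeOf_X, if_neg hca])
        rw [sub_sub_cancel, degreeOf_X, if_pos rfl, Nat.le_zero.1 h6] at h5
        simpa using h5
      have h4 : degreeOf c (aeval (Function.update X (a.succAbove b) (C (omega3 ^ 2) * X a) :
          Fin (2 * (n + 1) + 2) → MvPolynomial (Fin (2 * (n + 1) + 2)) ℂ)
          (sixVertexPoly (n + 2))) ≤ degreeOf c (sixVertexPoly (n + 2)) := by
        refine (MvPolynomial.degreeOf_aeval_le c _ _).trans ?_
        refine (Finset.sum_le_sum (g := fun k => if k = c then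
          degreeOf c (sixVertexPoly (n + 2)) else 0) fun k _ => ?_).trans ?_
        · by_cases hk : k = a.succAbove b
          · subst hk
            rw [Function.update_self]
            have : degreeOf c (C (omega3 ^ 2) * X a : MvPolynomial (Fin (2 * (n + 1) + 2)) ℂ) ≤ 0 :=
              (degreeOf_C_mul_le _ _ _).trans (by rw [degreeOf_X, if_neg hca])
            rw [Nat.le_zero.1 this, mul_zero]
            exact Nat.zero_le _
          · rw [Function.update_of_ne hk, degreeOf_X]
            by_cases hc : k = c
            · subst hc; simp
            · rw [if_neg (Ne.symm hc), mul_zero]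
              exact Nat.zero_le _
        · exact le_of_eq (Fintype.sum_ite_eq' c fun _ => degreeOf c (sixVertexPoly (n + 2)))
      rw [h1] at h4
      exact le_trans (by omega) h4

theorem degreeOf_sixVertexPoly (n : ℕ) (k : Fin (2 * n)) :
    (sixVertexPoly n).degreeOf k = n - 1 := by
  obtain ⟨n, rfl⟩ : ∃ m, n = m + 1 := ⟨n - 1, by have := k.2; omega⟩
  exact le_antisymm (degreeOf_sixVertexPoly_le _ _) ((le_degreeOf_sixVertexPoly n).2 k)

end SixVertexPolynomialProperties

/-! ### From the symmetric gauge to polynomial weights -/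

section GaugeTransformation

theorem Fin.prod_div_succ {n : ℕ} (f : Fin (n + 1) → ℂ) (hf : ∀ i, f i ≠ 0) :
    ∏ j : Fin n, f j.castSucc / f j.succ = f 0 / f (Fin.last n) := by
  induction n with
  | zero => simp [hf]
  | succ n ih =>
    rw [Fin.prod_univ_castSucc]
    have h := ih (fun j => f j.castSucc) fun j => hf _
    simp only [Fin.succ_castSucc] at h ⊢
    rw [h]
    have h1 := hf (Fin.last n).castSucc
    have h2 := hf (Fin.last (n + 1))
    simp only [Fin.castSucc_zero, Fin.succ_last]
    field_simp

/-- The gauge factor of an edge. -/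
def gaugeFactor (z : ℂ) (b : Bool) : ℂ := if b = true then z ^ (1 / 2 : ℂ) else 1

theorem gaugeFactor_ne_zero {z : ℂ} (hz : z ≠ 0) (b : Bool) : gaugeFactor z b ≠ 0 := by
  unfold gaugeFactor
  split_ifs
  · simp [Complex.cpow_eq_zero_iff, hz]
  · exact one_ne_zero

/-- Every edge with value `true` carries the square root of the parameter of its line. Of the square
root only its square is used, so the branch does not matter. -/
theorem vertexWeight_eq {n : ℕ} (c : ArrowConfig n) (i j : Fin n) {z w : ℂ} (hz : z ≠ 0)
    (hw : w ≠ 0) (hc : c.inDegree i j = 2) :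
    c.vertexWeight omega3 z w i j =
      vWeight sqrtOmega3 sqrtOmega3⁻¹ z w (c.left i j) (c.right i j) (c.top i j) (c.bottom i j) *
        (gaugeFactor z (c.left i j) / gaugeFactor z (c.right i j)) *
        (gaugeFactor w (c.top i j) / gaugeFactor w (c.bottom i j)) := by
  have hz' : z ^ (1 / 2 : ℂ) ≠ 0 := gaugeFactor_ne_zero hz true
  have hw' : w ^ (1 / 2 : ℂ) ≠ 0 := gaugeFactor_ne_zero hw true
  have hz2 : z ^ (1 / 2 : ℂ) * z ^ (1 / 2 : ℂ) = z := by
    rw [← Complex.cpow_add _ _ hz]; norm_num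
  have hw2 : w ^ (1 / 2 : ℂ) * w ^ (1 / 2 : ℂ) = w := by
    rw [← Complex.cpow_add _ _ hw]; norm_num
  have hk := sqrtOmega3_inv_sq_sub
  rw [omega3Diff] at hk
  simp only [ArrowConfig.vertexWeight, ArrowConfig.inDegree, vWeight, iceWeight, gaugeFactor,
    omega3_cpow_neg_half, hk] at hc ⊢
  generalize c.left i j = l at *
  generalize c.right i j = r at *
  generalize c.top i j = t at *
  generalize c.bottom i j = u at *
  have hs : omega3 ^ (1 / 2 : ℂ) = sqrtOmega3 := rfl
  rw [hs]
  generalize z ^ (1 / 2 : ℂ) = z' at *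
  generalize w ^ (1 / 2 : ℂ) = w' at *
  subst hz2 hw2
  cases l <;> cases r <;> cases t <;> cases u <;> simp at hc ⊢ <;> field_simp

theorem vWeight_eq_zero {R : Type*} [CommRing R] (s si z w : R) {n : ℕ} (c : ArrowConfig n)
    (i j : Fin n) (hc : c.inDegree i j ≠ 2) :
    vWeight s si z w (c.left i j) (c.right i j) (c.top i j) (c.bottom i j) = 0 := by
  simp only [ArrowConfig.inDegree] at hc
  generalize c.left i j = l at *
  generalize c.right i j = r at *
  generalize c.top i j = t at *
  generalize c.bottom i j = u at *
  cases l <;> cases r <;> cases t <;> cases u <;> simp [vWeight, iceWeight] at hc ⊢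

theorem ArrowConfig.isDWBC_iff {n : ℕ} (c : ArrowConfig n) :
    c.IsDWBC ↔ (∀ i j, c.inDegree i j = 2) ∧ c.IsBoundary := by
  simp only [ArrowConfig.IsDWBC, ArrowConfig.IsBoundary, funext_iff, forall_and, and_assoc]

/-- The gauge factors telescope along each line. Every line starts with `true` and ends with
`false`, which leaves one square root per line: the product that the normalization divides out. -/
theorem prod_vertexWeight {n : ℕ} (c : ArrowConfig n) (hc : c.IsDWBC) (x y : Fin n → ℂ)
    (hx : ∀ i, x i ≠ 0) (hy : ∀ i, y i ≠ 0) :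
    ∏ i, ∏ j, c.vertexWeight omega3 (x i) (y j) i j =
      (∏ i, ∏ j, vWeight sqrtOmega3 sqrtOmega3⁻¹ (x i) (y j) (c.left i j) (c.right i j)
        (c.top i j) (c.bottom i j)) * ((∏ i, x i ^ (1 / 2 : ℂ)) * ∏ i, y i ^ (1 / 2 : ℂ)) := by
  obtain ⟨hdeg, hb⟩ := c.isDWBC_iff.1 hc
  simp only [fun i j => vertexWeight_eq c i j (hx i) (hy j) (hdeg i j), Finset.prod_mul_distrib]
  rw [mul_assoc]
  congr 2
  · refine Finset.prod_congr rfl fun i _ => ?_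
    refine (Fin.prod_div_succ (fun j => gaugeFactor (x i) (c.1 i j))
      fun j => gaugeFactor_ne_zero (hx i) _).trans ?_
    simp [hb.1 i, gaugeFactor]
  · rw [Finset.prod_comm]
    refine Finset.prod_congr rfl fun j _ => ?_
    refine (Fin.prod_div_succ (fun i => gaugeFactor (y j) (c.2 i j))
      fun i => gaugeFactor_ne_zero (hy j) _).trans ?_
    simp [hb.2.1, hb.2.2, gaugeFactor]

theorem normalizedZ_eq_eval (n : ℕ) (z : Fin (2 * n) → ℂ) (hz : ∀ i, z i ≠ 0) :
    normalizedZ omega3 n z = MvPolynomial.eval z (sixVertexPoly n) := by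
  classical
  have h1 : partitionFunction omega3 n z =
      dwPartition sqrtOmega3 sqrtOmega3⁻¹ n (rowParam z) (colParam z) *
        ∏ i, z i ^ (1 / 2 : ℂ) := by
    rw [partitionFunction, dwPartition_eq_sum, Finset.sum_mul]
    rw [← Equiv.prod_comp (rowColEquiv n), Fintype.prod_sum_type]
    refine Eq.trans ?_ (Finset.sum_subset
      (s₁ := univ.filter fun c : ArrowConfig n => c.IsDWBC) ?_ ?_)
    · refine Finset.sum_congr rfl fun c hc => ?_
      exact prod_vertexWeight c (Finset.mem_filter.1 hc).2 (rowParam z) (colParam z)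
        (fun _ => hz _) fun _ => hz _
    · intro c hc
      simp only [Finset.mem_filter, Finset.mem_univ, true_and] at hc ⊢
      exact (c.isDWBC_iff.1 hc).2
    · intro c hc hc'
      simp only [Finset.mem_filter, Finset.mem_univ, true_and] at hc hc'
      rw [c.isDWBC_iff] at hc'
      push Not at hc'
      obtain ⟨i, j, hij⟩ : ∃ i j, c.inDegree i j ≠ 2 := by
        by_contra hcon
        push Not at hcon
        exact hc' hcon hc
      rw [Finset.prod_eq_zero (Finset.mem_univ i), zero_mul]
      exact Finset.prod_eq_zero (Finset.mem_univ j) (vWeight_eq_zero _ _ _ _ c i j hij)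
  rw [eval_sixVertexPoly, normalizedZ, h1, sixVertexValue, omega3Diff, Finset.prod_inv_distrib]
  have h2 : ∏ i, z i ^ (1 / 2 : ℂ) ≠ 0 :=
    Finset.prod_ne_zero_iff.2 fun i _ => gaugeFactor_ne_zero (hz i) true
  field_simp

end GaugeTransformation

/-! ### Integrals of rational functions in one variable -/

section ContourIntegral

namespace ClosedCurve

theorem intervalIntegrable (γ : ClosedCurve) {f : ℂ → ℂ}
    (hf : ContinuousOn (fun t => f (γ.toFun t)) (Set.Icc 0 1)) :
    IntervalIntegrable (fun t => f (γ.toFun t) * deriv γ.toFun t) MeasureTheory.volume 0 1 :=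
  γ.integrable.continuousOn_mul (by rwa [Set.uIcc_of_le zero_le_one])

/-- The fundamental theorem of calculus in the version that tolerates the finitely many parameters
where the curve is not differentiable. -/
theorem integral_eq_zero_of_hasDerivAt (γ : ClosedCurve) {f F : ℂ → ℂ}
    (hF : ∀ t ∈ Set.Icc (0 : ℝ) 1, HasDerivAt F (f (γ.toFun t)) (γ.toFun t))
    (hf : ContinuousOn (fun t => f (γ.toFun t)) (Set.Icc 0 1)) : γ.integral f = 0 := by
  obtain ⟨s, hs⟩ := γ.differentiable
  have h := MeasureTheory.integral_eq_of_hasDerivAt_off_countable (a := (0 : ℝ)) (b := 1)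
    (fun t => F (γ.toFun t)) (fun t => f (γ.toFun t) * deriv γ.toFun t) (s := s)
    s.countable_toSet ?_ ?_ (γ.intervalIntegrable hf)
  · rw [integral, h, γ.closed, sub_self]
  · rw [Set.uIcc_of_le zero_le_one]
    intro t ht
    exact (hF t ht).continuousAt.comp_continuousWithinAt (γ.continuousOn t ht)
  · intro t ht
    rw [min_eq_left zero_le_one, max_eq_right zero_le_one] at ht
    exact (hF t (Set.Ioo_subset_Icc_self ht.1)).comp t (hs t ht.1 ht.2).hasDerivAt

end ClosedCurve

namespace Contour

/-- Continuity of a function along a contour. -/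
def ContinuousAlong (Γ : Contour) (f : ℂ → ℂ) : Prop :=
  ∀ γ ∈ Γ, ContinuousOn (fun t => f (γ.toFun t)) (Set.Icc 0 1)

theorem integral_congr {Γ : Contour} {f g : ℂ → ℂ}
    (h : ∀ γ ∈ Γ, ∀ t ∈ Set.Icc (0 : ℝ) 1, f (γ.toFun t) = g (γ.toFun t)) :
    Γ.integral f = Γ.integral g := by
  unfold integral
  congr 2
  refine List.map_congr_left fun γ hγ => ?_
  refine intervalIntegral.integral_congr fun t ht => ?_
  rw [Set.uIcc_of_le zero_le_one] at ht
  simp only [h γ hγ t ht]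

theorem integral_const_mul (Γ : Contour) (c : ℂ) (f : ℂ → ℂ) :
    Γ.integral (fun w => c * f w) = c * Γ.integral f := by
  unfold integral
  have h : ∀ γ : ClosedCurve, γ.integral (fun w => c * f w) = c * γ.integral f := by
    intro γ
    unfold ClosedCurve.integral
    rw [← intervalIntegral.integral_const_mul]
    simp only [mul_assoc]
  simp only [h, List.sum_map_mul_left]
  ring

theorem integral_add {Γ : Contour} {f g : ℂ → ℂ} (hf : Γ.ContinuousAlong f)
    (hg : Γ.ContinuousAlong g) :
    Γ.integral (fun w => f w + g w) = Γ.integral f + Γ.integral g := by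
  unfold integral
  rw [← mul_add, ← List.sum_map_add]
  congr 2
  refine List.map_congr_left fun γ hγ => ?_
  unfold ClosedCurve.integral
  rw [← intervalIntegral.integral_add (γ.intervalIntegrable (hf γ hγ))
    (γ.intervalIntegrable (hg γ hγ))]
  simp only [add_mul]

theorem integral_zero (Γ : Contour) : Γ.integral (fun _ => 0) = 0 := by
  simpa using Γ.integral_const_mul 0 fun _ => 0

theorem integral_sum {ι : Type*} {Γ : Contour} (s : Finset ι) {f : ι → ℂ → ℂ}
    (hf : ∀ i ∈ s, Γ.ContinuousAlong (f i)) :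
    Γ.integral (fun w => ∑ i ∈ s, f i w) = ∑ i ∈ s, Γ.integral (f i) := by
  classical
  induction s using Finset.induction_on with
  | empty => simpa using Γ.integral_zero
  | insert a s ha ih =>
    simp only [Finset.sum_insert ha]
    rw [integral_add (hf a (Finset.mem_insert_self a s)),
      ih fun i hi => hf i (Finset.mem_insert_of_mem hi)]
    intro γ hγ
    exact continuousOn_finsetSum _ fun i hi => hf i (Finset.mem_insert_of_mem hi) γ hγ

theorem integral_eq_zero_of_hasDerivAt {Γ : Contour} {f F : ℂ → ℂ}
    (hF : ∀ γ ∈ Γ, ∀ t ∈ Set.Icc (0 : ℝ) 1, HasDerivAt F (f (γ.toFun t)) (γ.toFun t))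
    (hf : Γ.ContinuousAlong f) : Γ.integral f = 0 := by
  unfold integral
  rw [List.map_congr_left fun γ hγ => γ.integral_eq_zero_of_hasDerivAt (hF γ hγ) (hf γ hγ)]
  simp

theorem continuousAlong_of_continuousAt {Γ : Contour} {f : ℂ → ℂ}
    (hf : ∀ γ ∈ Γ, ∀ t ∈ Set.Icc (0 : ℝ) 1, ContinuousAt f (γ.toFun t)) : Γ.ContinuousAlong f :=
  fun γ hγ t ht => (hf γ hγ t ht).comp_continuousWithinAt (γ.continuousOn t ht)

/-- The rational function `w ^ k / ∏ (w - c)`. -/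
def poleFun (k : ℕ) (cs : List ℂ) (w : ℂ) : ℂ := w ^ k / (cs.map fun c => w - c).prod

theorem prod_sub_ne_zero {Γ : Contour} {cs : List ℂ} (h : ∀ c ∈ cs, Γ.Avoids c) :
    ∀ γ ∈ Γ, ∀ t ∈ Set.Icc (0 : ℝ) 1, (cs.map fun c => γ.toFun t - c).prod ≠ 0 := by
  intro γ hγ t ht h0
  obtain ⟨c, hc, h1⟩ := List.mem_map.1 (List.prod_eq_zero_iff.1 h0)
  exact h c hc γ hγ t ht (sub_eq_zero.1 h1)

theorem continuousAlong_poleFun {Γ : Contour} {cs : List ℂ} (h : ∀ c ∈ cs, Γ.Avoids c) (k : ℕ) :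
    Γ.ContinuousAlong (poleFun k cs) := by
  refine continuousAlong_of_continuousAt fun γ hγ t ht => ?_
  refine ContinuousAt.div (by fun_prop) ?_ (prod_sub_ne_zero h γ hγ t ht)
  exact (continuous_list_prod _ fun c _ => by fun_prop).continuousAt

theorem poleFun_perm {cs ds : List ℂ} (h : cs.Perm ds) (k : ℕ) : poleFun k cs = poleFun k ds := by
  ext w
  rw [poleFun, poleFun, (h.map _).prod_eq]

/-- From w / (w - c) = 1 + c / (w - c): the power in the numerator is lowered. -/
theorem integral_poleFun_succ {Γ : Contour} {c : ℂ} {cs : List ℂ}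
    (h : ∀ d ∈ c :: cs, Γ.Avoids d) (k : ℕ) :
    Γ.integral (poleFun (k + 1) (c :: cs)) =
      Γ.integral (poleFun k cs) + c * Γ.integral (poleFun k (c :: cs)) := by
  have h' : ∀ d ∈ cs, Γ.Avoids d := fun d hd => h d (List.mem_cons_of_mem _ hd)
  rw [← integral_const_mul, ← integral_add (continuousAlong_poleFun h' k)]
  · refine integral_congr fun γ hγ t ht => ?_
    have h1 := prod_sub_ne_zero h' γ hγ t ht
    have h2 := sub_ne_zero.2 (h c List.mem_cons_self γ hγ t ht)
    simp only [poleFun, List.map_cons, List.prod_cons]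
    field_simp
    ring
  · intro γ hγ
    exact continuousOn_const.mul (continuousAlong_poleFun h k γ hγ)

/-- Partial fractions for two distinct poles. -/
theorem integral_poleFun_cons_cons {Γ : Contour} {a b : ℂ} {cs : List ℂ} (hab : a ≠ b)
    (h : ∀ d ∈ a :: b :: cs, Γ.Avoids d) (k : ℕ) :
    (a - b) * Γ.integral (poleFun k (a :: b :: cs)) =
      Γ.integral (poleFun k (a :: cs)) - Γ.integral (poleFun k (b :: cs)) := by
  have ha : ∀ d ∈ a :: cs, Γ.Avoids d := fun d hd => h d (by
    rcases List.mem_cons.1 hd with rfl | hd <;> simp [*])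
  have hb : ∀ d ∈ b :: cs, Γ.Avoids d := fun d hd => h d (by
    rcases List.mem_cons.1 hd with rfl | hd <;> simp [*])
  rw [sub_eq_add_neg _ (Γ.integral (poleFun k (b :: cs))), ← neg_one_mul (Γ.integral _),
    ← integral_const_mul, ← integral_const_mul, ← integral_add (continuousAlong_poleFun ha k)]
  · refine integral_congr fun γ hγ t ht => ?_
    have h1 := prod_sub_ne_zero (fun d hd => ha d (List.mem_cons_of_mem _ hd)) γ hγ t ht
    have h2 := sub_ne_zero.2 (ha a List.mem_cons_self γ hγ t ht)
    have h3 := sub_ne_zero.2 (hb b List.mem_cons_self γ hγ t ht)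
    simp only [poleFun, List.map_cons, List.prod_cons]
    field_simp
    ring
  · intro γ hγ
    exact continuousOn_const.mul (continuousAlong_poleFun hb k γ hγ)

theorem integral_pow (Γ : Contour) (k : ℕ) : Γ.integral (fun w => w ^ k) = 0 := by
  refine integral_eq_zero_of_hasDerivAt (F := fun w => w ^ (k + 1) / (k + 1)) ?_ ?_
  · intro γ _ t _
    have h := (hasDerivAt_pow (k + 1) (γ.toFun t)).div_const ((k : ℂ) + 1)
    have hk : (k : ℂ) + 1 ≠ 0 := Nat.cast_add_one_ne_zero k
    convert! h using 1
    push_cast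
    field_simp
  · exact continuousAlong_of_continuousAt fun γ _ t _ => by fun_prop

theorem integral_poleFun_nil (Γ : Contour) (k : ℕ) : Γ.integral (poleFun k []) = 0 := by
  refine (integral_congr fun γ _ t _ => ?_).trans (Γ.integral_pow k)
  simp [poleFun]

theorem integral_poleFun_replicate {Γ : Contour} {a : ℂ} (ha : Γ.Avoids a) (m : ℕ) :
    Γ.integral (poleFun 0 (List.replicate (m + 2) a)) = 0 := by
  have hav : ∀ d ∈ List.replicate (m + 2) a, Γ.Avoids d := fun d hd => by
    rw [List.eq_of_mem_replicate hd]; exact ha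
  refine integral_eq_zero_of_hasDerivAt
    (F := fun w => (-1 / ((m : ℂ) + 1)) * ((w - a) ^ (m + 1))⁻¹) ?_ (continuousAlong_poleFun hav 0)
  intro γ hγ t ht
  have h0 : γ.toFun t - a ≠ 0 := sub_ne_zero.2 (ha γ hγ t ht)
  have h1 := ((((hasDerivAt_id (γ.toFun t)).sub_const a).pow (m + 1)).inv
    (pow_ne_zero _ h0)).const_mul (-1 / ((m : ℂ) + 1))
  have hk : (m : ℂ) + 1 ≠ 0 := Nat.cast_add_one_ne_zero m
  convert! h1 using 1
  simp only [poleFun, List.map_replicate, List.prod_replicate, id]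
  push_cast
  field_simp
  simp
  ring

/-- Without a numerator, and with all poles of the same index, only simple poles contribute. -/
theorem integral_poleFun_zero_of_index_eq {Γ : Contour} {ι : ℂ} (cs : List ℂ)
    (h : ∀ c ∈ cs, Γ.Avoids c ∧ Γ.index c = ι) :
    Γ.integral (poleFun 0 cs) = if cs.length = 1 then ι else 0 := by
  induction hn : cs.length using Nat.strong_induction_on generalizing cs with
  | _ n ih =>
    match cs, h, hn with
    | [], _, hn => subst hn; simpa using Γ.integral_poleFun_nil 0
    | [a], h, hn =>
      subst hn
      rw [if_pos List.length_singleton, ← (h a (by simp)).2, index]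
      refine integral_congr fun γ _ t _ => ?_
      simp [poleFun]
    | a :: b :: cs, h, hn =>
      by_cases hall : ∀ c ∈ b :: cs, c = a
      · have : a :: b :: cs = List.replicate (cs.length + 2) a := by
          rw [List.eq_replicate_iff]
          refine ⟨rfl, fun c hc => ?_⟩
          rcases List.mem_cons.1 hc with rfl | hc
          · rfl
          · exact hall c hc
        rw [this, integral_poleFun_replicate (h a (by simp)).1, if_neg]
        simp only [List.length_cons] at hn
        omega
      -- Two distinct poles are brought to the front. Partial fractions reduce the integral to a
      -- difference of two shorter ones, which are equal by induction.
      · push Not at hall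
        obtain ⟨c, hc, hca⟩ := hall
        have hp : (a :: b :: cs).Perm (a :: c :: (b :: cs).erase c) :=
          (List.perm_cons_erase hc).cons a
        have hlen := hp.length_eq
        have h' : ∀ d ∈ a :: c :: (b :: cs).erase c, Γ.Avoids d ∧ Γ.index d = ι :=
          fun d hd => h d (hp.mem_iff.2 hd)
        simp only [List.length_cons] at hn hlen
        have h1 := ih (n - 1) (by omega) (a :: (b :: cs).erase c) (fun d hd => h' d (by
          rcases List.mem_cons.1 hd with rfl | hd <;> simp [*])) (by simp only [List.length_cons]; omega)
        have h2 := ih (n - 1) (by omega) (c :: (b :: cs).erase c) (fun d hd => h' d (by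
          rcases List.mem_cons.1 hd with rfl | hd <;> simp [*])) (by simp only [List.length_cons]; omega)
        have h3 := integral_poleFun_cons_cons hca.symm (fun d hd => (h' d hd).1) 0
        rw [h1, h2, sub_self] at h3
        rw [poleFun_perm hp, if_neg (by omega)]
        exact (mul_eq_zero.1 h3).resolve_left (sub_ne_zero.2 hca.symm)

/-- The integral of a rational function depends polynomially on the poles, up to a power of a
common multiple of the differences of enclosed and excluded poles. -/
theorem integral_poleFun_polynomial {τ : Type*} (D : MvPolynomial τ ℂ) (k : ℕ)
    (as bs : List (MvPolynomial τ ℂ)) (hD : ∀ a ∈ as, ∀ b ∈ bs, (a - b) ∣ D) :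
    ∃ (M : ℕ) (Q : MvPolynomial τ ℂ), ∀ (z : τ → ℂ) (Γ : Contour),
      Γ.Separates {x | ∃ a ∈ as, x = MvPolynomial.eval z a}
        {x | ∃ b ∈ bs, x = MvPolynomial.eval z b} →
      MvPolynomial.eval z D ^ M * Γ.integral (poleFun k
        (as.map (MvPolynomial.eval z) ++ bs.map (MvPolynomial.eval z))) =
        MvPolynomial.eval z Q := by
  have hsep : ∀ (as bs as' bs' : List (MvPolynomial τ ℂ)) (z : τ → ℂ) (Γ : Contour),
      (∀ a ∈ as', a ∈ as) → (∀ b ∈ bs', b ∈ bs) →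
      Γ.Separates {x | ∃ a ∈ as, x = MvPolynomial.eval z a}
        {x | ∃ b ∈ bs, x = MvPolynomial.eval z b} →
      Γ.Separates {x | ∃ a ∈ as', x = MvPolynomial.eval z a}
        {x | ∃ b ∈ bs', x = MvPolynomial.eval z b} := by
    rintro as bs as' bs' z Γ h1 h2 ⟨h3, h4⟩
    refine ⟨?_, ?_⟩
    · rintro _ ⟨a, ha, rfl⟩
      exact h3 _ ⟨a, h1 a ha, rfl⟩
    · rintro _ ⟨a, ha, rfl⟩
      exact h4 _ ⟨a, h2 a ha, rfl⟩
  have hav : ∀ (as bs : List (MvPolynomial τ ℂ)) (z : τ → ℂ) (Γ : Contour),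
      Γ.Separates {x | ∃ a ∈ as, x = MvPolynomial.eval z a}
        {x | ∃ b ∈ bs, x = MvPolynomial.eval z b} →
      ∀ d ∈ as.map (MvPolynomial.eval z) ++ bs.map (MvPolynomial.eval z), Γ.Avoids d := by
    intro as bs z Γ h d hd
    simp only [List.mem_append, List.mem_map] at hd
    rcases hd with ⟨a, ha, rfl⟩ | ⟨a, ha, rfl⟩
    · exact (h.1 _ ⟨a, ha, rfl⟩).1
    · exact (h.2 _ ⟨a, ha, rfl⟩).1
  induction k generalizing as bs with
  | zero =>
    induction hn : as.length + bs.length using Nat.strong_induction_on generalizing as bs with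
    | _ n ih =>
      match as, bs, hD, hn with
      -- If only one side has poles, the integral is constant: all poles have the same index, and
      -- coincidences among them do no harm.
      | [], bs, hD, hn =>
        refine ⟨0, 0, fun z Γ h => ?_⟩
        rw [List.map_nil, List.nil_append, integral_poleFun_zero_of_index_eq (ι := 0)]
        · simp
        · intro c hc
          obtain ⟨b, hb, rfl⟩ := List.mem_map.1 hc
          exact h.2 _ ⟨b, hb, rfl⟩
      | a :: as, [], hD, hn =>
        refine ⟨0, if as.length = 0 then 1 else 0, fun z Γ h => ?_⟩
        rw [List.map_nil, List.append_nil, integral_poleFun_zero_of_index_eq (ι := 1)]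
        · simp [apply_ite]
        · intro c hc
          obtain ⟨b, hb, rfl⟩ := List.mem_map.1 hc
          exact h.1 _ ⟨b, hb, rfl⟩
      -- An enclosed pole and an excluded one are separated by partial fractions. The price is a
      -- division by `a - b`, which is paid for by one more factor `D`.
      | a :: as, b :: bs, hD, hn =>
        simp only [List.length_cons] at hn
        obtain ⟨E, hE⟩ := hD a List.mem_cons_self b List.mem_cons_self
        obtain ⟨M₁, Q₁, h₁⟩ := ih (n - 1) (by omega) (a :: as) bs
          (fun x hx y hy => hD x hx y (List.mem_cons_of_mem _ hy))
          (by simp only [List.length_cons]; omega)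
        obtain ⟨M₂, Q₂, h₂⟩ := ih (n - 1) (by omega) as (b :: bs)
          (fun x hx y hy => hD x (List.mem_cons_of_mem _ hx) y hy)
          (by simp only [List.length_cons]; omega)
        refine ⟨M₁ + M₂ + 1, E * (D ^ M₂ * Q₁ - D ^ M₁ * Q₂), fun z Γ h => ?_⟩
        have e1 := h₁ z Γ (hsep _ _ _ _ z Γ (fun x hx => hx)
          (fun y hy => List.mem_cons_of_mem _ hy) h)
        have e2 := h₂ z Γ (hsep _ _ _ _ z Γ (fun x hx => List.mem_cons_of_mem _ hx)
          (fun y hy => hy) h)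
        have hne : MvPolynomial.eval z a ≠ MvPolynomial.eval z b := by
          intro hab
          have e3 := (h.1 _ ⟨a, List.mem_cons_self, rfl⟩).2
          have e4 := (h.2 _ ⟨b, List.mem_cons_self, rfl⟩).2
          rw [hab, e4] at e3
          exact zero_ne_one e3
        have hp : ((a :: as).map (MvPolynomial.eval z) ++ (b :: bs).map (MvPolynomial.eval z)).Perm
            (MvPolynomial.eval z a :: MvPolynomial.eval z b ::
              (as.map (MvPolynomial.eval z) ++ bs.map (MvPolynomial.eval z))) :=
          List.Perm.cons _ List.perm_middle
        have hp2 : (as.map (MvPolynomial.eval z) ++ (b :: bs).map (MvPolynomial.eval z)).Perm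
            (MvPolynomial.eval z b ::
              (as.map (MvPolynomial.eval z) ++ bs.map (MvPolynomial.eval z))) :=
          List.perm_middle
        have e5 := integral_poleFun_cons_cons hne
          (fun d hd => hav _ _ z Γ h d (hp.mem_iff.2 hd)) 0
        rw [← poleFun_perm hp, ← poleFun_perm hp2] at e5
        simp only [map_mul, map_sub, map_pow, ← e1, ← e2]
        rw [pow_succ, hE, map_mul, map_sub]
        simp only [List.map_cons, List.cons_append] at e5 ⊢
        linear_combination (MvPolynomial.eval z E) * ((MvPolynomial.eval z a -
          MvPolynomial.eval z b) * MvPolynomial.eval z E) ^ (M₁ + M₂) * e5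
  | succ k ih =>
    match as, bs, hD with
    | [], [], hD =>
      exact ⟨0, 0, fun z Γ _ => by simpa using Γ.integral_poleFun_nil (k + 1)⟩
    | a :: as, bs, hD =>
      obtain ⟨M₁, Q₁, h₁⟩ := ih as bs fun x hx y hy => hD x (List.mem_cons_of_mem _ hx) y hy
      obtain ⟨M₂, Q₂, h₂⟩ := ih (a :: as) bs hD
      refine ⟨M₁ + M₂, D ^ M₂ * Q₁ + a * D ^ M₁ * Q₂, fun z Γ h => ?_⟩
      have e1 := h₁ z Γ (hsep _ _ _ _ z Γ (fun x hx => List.mem_cons_of_mem _ hx)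
        (fun y hy => hy) h)
      have e2 := h₂ z Γ h
      have e3 := integral_poleFun_succ (hav _ _ z Γ h) k
      simp only [map_add, map_mul, map_pow, ← e1, ← e2]
      simp only [List.map_cons, List.cons_append, List.append_eq] at e3 ⊢
      rw [e3]
      ring
    | [], b :: bs, hD =>
      obtain ⟨M₁, Q₁, h₁⟩ := ih [] bs fun x hx y hy => hD x hx y (List.mem_cons_of_mem _ hy)
      obtain ⟨M₂, Q₂, h₂⟩ := ih [] (b :: bs) hD
      refine ⟨M₁ + M₂, D ^ M₂ * Q₁ + b * D ^ M₁ * Q₂, fun z Γ h => ?_⟩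
      have e1 := h₁ z Γ (hsep _ _ _ _ z Γ (fun x hx => hx)
        (fun y hy => List.mem_cons_of_mem _ hy) h)
      have e2 := h₂ z Γ h
      have e3 := integral_poleFun_succ (hav _ _ z Γ h) k
      simp only [map_add, map_mul, map_pow, ← e1, ← e2]
      simp only [List.map_cons, List.map_nil, List.nil_append] at e3 ⊢
      rw [e3]
      ring

end Contour

end ContourIntegral

/-! ### Iterated integrals -/

section IteratedContourIntegral

namespace Contour

theorem integral_polynomial (Γ : Contour) (p : Polynomial ℂ) : Γ.integral (fun w => p.eval w) = 0 := by
  simp only [Polynomial.eval_eq_sum, Polynomial.sum]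
  rw [integral_sum]
  · simp only [integral_const_mul, integral_pow, mul_zero, Finset.sum_const_zero]
  · exact fun i _ => continuousAlong_of_continuousAt fun γ _ t _ => by fun_prop

/-- The residue formula for simple poles. -/
theorem integral_pow_mul_inv_prod {κ : Type*} [DecidableEq κ] {Γ : Contour} (s : Finset κ)
    (v : κ → ℂ) (hv : Set.InjOn v s) (hΓ : ∀ i ∈ s, Γ.Avoids (v i)) (k : ℕ) :
    Γ.integral (fun w => w ^ k * (∏ i ∈ s, (w - v i))⁻¹) =
      ∑ i ∈ s, v i ^ k * (Lagrange.nodalWeight s v i * Γ.index (v i)) := by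
  classical
  set N : Polynomial ℂ := Polynomial.X ^ k
  -- Division by the nodal polynomial: the quotient integrates to zero, and the remainder is the
  -- Lagrange interpolant of the values of `N` at the nodes, whose partial fractions have the
  -- `nodalWeight`s as residues.
  set R := N %ₘ Lagrange.nodal s v with hR
  have hmonic := Lagrange.nodal_monic (s := s) (v := v)
  have hdecomp := Polynomial.modByMonic_add_div N (Lagrange.nodal s v)
  have hReval : ∀ i ∈ s, R.eval (v i) = v i ^ k := by
    intro i hi
    have h := congrArg (Polynomial.eval (v i)) hdecomp
    rw [Polynomial.eval_add, Polynomial.eval_mul, Lagrange.eval_nodal_at_node hi, zero_mul,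
      add_zero] at h
    rw [hR, h]
    simp [N]
  have hdeg : R.degree < s.card := by
    rw [← Lagrange.degree_nodal (s := s) (v := v)]
    exact Polynomial.degree_modByMonic_lt _ hmonic
  have hRint := Lagrange.eq_interpolate_of_eval_eq (fun i => v i ^ k) hv hdeg hReval
  have hpoint : ∀ γ ∈ Γ, ∀ t ∈ Set.Icc (0 : ℝ) 1,
      γ.toFun t ^ k * (∏ i ∈ s, (γ.toFun t - v i))⁻¹ =
        (N /ₘ Lagrange.nodal s v).eval (γ.toFun t) +
          ∑ i ∈ s, v i ^ k * Lagrange.nodalWeight s v i * (γ.toFun t - v i)⁻¹ := by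
    intro γ hγ t ht
    have hne : ∀ i ∈ s, γ.toFun t ≠ v i := fun i hi => hΓ i hi γ hγ t ht
    have h0 : ∏ i ∈ s, (γ.toFun t - v i) ≠ 0 :=
      Finset.prod_ne_zero_iff.2 fun i hi => sub_ne_zero.2 (hne i hi)
    have h := congrArg (Polynomial.eval (γ.toFun t)) hdecomp
    rw [← hR, hRint, Polynomial.eval_add, Polynomial.eval_mul,
      Lagrange.eval_interpolate_not_at_node _ hne, Lagrange.eval_nodal] at h
    have h' : γ.toFun t ^ k = N.eval (γ.toFun t) := by simp [N]
    rw [h', ← h, add_mul, mul_comm (∏ i ∈ s, (γ.toFun t - v i)) (∑ i ∈ s, _), mul_assoc,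
      mul_inv_cancel₀ h0, mul_one, mul_comm (∏ i ∈ s, (γ.toFun t - v i)) (Polynomial.eval _ _),
      mul_assoc, mul_inv_cancel₀ h0, mul_one, add_comm]
    congr 1
    exact Finset.sum_congr rfl fun i _ => by ring
  rw [integral_congr (g := fun w => (N /ₘ Lagrange.nodal s v).eval w +
    ∑ i ∈ s, v i ^ k * Lagrange.nodalWeight s v i * (w - v i)⁻¹) hpoint, integral_add, integral_polynomial, zero_add, integral_sum]
  · refine Finset.sum_congr rfl fun i _ => ?_
    rw [integral_const_mul, index, mul_assoc]
  · exact fun i hi => continuousAlong_of_continuousAt fun γ hγ t ht =>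
      continuousAt_const.mul ((by fun_prop : ContinuousAt (fun w => w - v i) _).inv₀
        (sub_ne_zero.2 (hΓ i hi γ hγ t ht)))
  · exact continuousAlong_of_continuousAt fun γ _ t _ => by fun_prop
  · intro γ hγ
    refine continuousOn_finsetSum _ fun i hi => ?_
    exact continuousAlong_of_continuousAt (Γ := Γ) (f := fun w => _ * (w - v i)⁻¹)
      (fun γ hγ t ht => continuousAt_const.mul
        ((by fun_prop : ContinuousAt (fun w => w - v i) _).inv₀
          (sub_ne_zero.2 (hΓ i hi γ hγ t ht)))) γ hγ

theorem iterated_congr {n : ℕ} {Γ : Fin n → Contour} {f g : (Fin n → ℂ) → ℂ}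
    (h : ∀ w, (∀ l, ∃ γ ∈ Γ l, ∃ t ∈ Set.Icc (0 : ℝ) 1, w l = γ.toFun t) → f w = g w) :
    iterated n Γ f = iterated n Γ g := by
  induction n with
  | zero => exact h _ fun l => l.elim0
  | succ n ih =>
    refine integral_congr fun γ hγ t ht => ih fun w hw => h _ fun l => ?_
    refine Fin.cases ?_ (fun l => ?_) l
    · exact ⟨γ, hγ, t, ht, rfl⟩
    · exact hw l

/-- A finite sum of products of functions of one variable can be integrated variable by variable,
without Fubini. All integrands of the proof have this form, since their denominators factor and
their numerators are polynomials. -/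
theorem iterated_sum_prod {ι : Type*} (s : Finset ι) {n : ℕ} (Γ : Fin n → Contour) (c : ι → ℂ)
    (h : ι → Fin n → ℂ → ℂ) (hc : ∀ i ∈ s, ∀ l, (Γ l).ContinuousAlong (h i l)) :
    iterated n Γ (fun w => ∑ i ∈ s, c i * ∏ l, h i l (w l)) =
      ∑ i ∈ s, c i * ∏ l, (Γ l).integral (h i l) := by
  induction n generalizing c with
  | zero => simp [iterated]
  | succ n ih =>
    simp only [iterated, Fin.prod_univ_succ, Fin.cons_zero, Fin.cons_succ]
    have h1 : ∀ w : ℂ, iterated n (fun l => Γ l.succ)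
        (fun ws => ∑ i ∈ s, c i * (h i 0 w * ∏ l : Fin n, h i l.succ (ws l))) =
        ∑ i ∈ s, (c i * ∏ l : Fin n, (Γ l.succ).integral (h i l.succ)) * h i 0 w := by
      intro w
      have h2 := ih (fun l => Γ l.succ) (fun i => c i * h i 0 w) (fun i l => h i l.succ)
        fun i hi l => hc i hi l.succ
      simp only [mul_assoc] at h2
      rw [h2]
      exact Finset.sum_congr rfl fun i _ => by ring
    simp only [h1]
    rw [integral_sum]
    · refine Finset.sum_congr rfl fun i _ => ?_
      rw [integral_const_mul]
      ring
    · intro i hi γ hγ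
      exact continuousOn_const.mul (hc i hi 0 γ hγ)

open MvPolynomial in
theorem iterated_eval_mul {τ : Type*} {n : ℕ} (Γ : Fin n → Contour)
    (p : MvPolynomial (Fin n) (MvPolynomial τ ℂ)) (z : τ → ℂ) (g : Fin n → ℂ → ℂ)
    (hg : ∀ l, (Γ l).ContinuousAlong (g l)) :
    iterated n Γ (fun w => eval w (map (eval z) p) * ∏ l, g l (w l)) =
      ∑ d ∈ p.support, eval z (coeff d p) * ∏ l, (Γ l).integral (fun x => x ^ d l * g l x) := by
  rw [← iterated_sum_prod]
  · congr 1
    ext w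
    rw [eval_map, eval₂_eq', Finset.sum_mul]
    simp only [Finset.prod_mul_distrib]
    exact Finset.sum_congr rfl fun d _ => by ring
  · intro d _ l γ hγ
    exact ((continuousAlong_of_continuousAt (Γ := Γ l) (f := fun x => x ^ d l)
      fun γ _ t _ => by fun_prop) γ hγ).mul (hg l γ hγ)

-- Each monomial of the numerator yields a product of integrals covered by
-- `integral_poleFun_polynomial`. The exponent and the polynomial depend on neither the point nor
-- the contours.
open MvPolynomial in
theorem iterated_polynomial {τ : Type*} {n : ℕ} (p : MvPolynomial (Fin n) (MvPolynomial τ ℂ))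
    (D : MvPolynomial τ ℂ) (as bs : Fin n → List (MvPolynomial τ ℂ))
    (hD : ∀ l, ∀ a ∈ as l, ∀ b ∈ bs l, (a - b) ∣ D) :
    ∃ (M : ℕ) (Q : MvPolynomial τ ℂ), ∀ (z : τ → ℂ) (Γ : Fin n → Contour),
      (∀ l, (Γ l).Separates {x | ∃ a ∈ as l, x = eval z a} {x | ∃ b ∈ bs l, x = eval z b}) →
      eval z D ^ M * iterated n Γ (fun w => eval w (map (eval z) p) *
        ∏ l, poleFun 0 ((as l).map (eval z) ++ (bs l).map (eval z)) (w l)) = eval z Q := by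
  choose M Q hMQ using fun (d : Fin n →₀ ℕ) (l : Fin n) =>
    integral_poleFun_polynomial D (d l) (as l) (bs l) (hD l)
  -- The exponents are added up over all monomials; a single monomial is compensated by the powers
  -- of `D` that belong to the others.
  refine ⟨∑ d ∈ p.support, ∑ l, M d l, ∑ d ∈ p.support, coeff d p *
    (D ^ (∑ d ∈ p.support.erase d, ∑ l, M d l) * ∏ l, Q d l), fun z Γ h => ?_⟩
  rw [iterated_eval_mul, Finset.mul_sum, map_sum]
  · refine Finset.sum_congr rfl fun d hd => ?_
    rw [map_mul, map_mul, map_prod, map_pow, ← Finset.add_sum_erase _ _ hd, pow_add,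
      ← Finset.prod_pow_eq_pow_sum]
    simp only [← fun l => hMQ d l z (Γ l) (h l), Finset.prod_mul_distrib]
    have : ∀ l, (Γ l).integral (fun x => x ^ d l *
        poleFun 0 ((as l).map (eval z) ++ (bs l).map (eval z)) x) =
        (Γ l).integral (poleFun (d l) ((as l).map (eval z) ++ (bs l).map (eval z))) := by
      intro l
      congr 1
      ext x
      simp [poleFun, div_eq_mul_inv]
    simp only [this]
    ring
  · intro l
    refine continuousAlong_poleFun (fun d hd => ?_) 0
    simp only [List.mem_append, List.mem_map] at hd
    rcases hd with ⟨a, ha, rfl⟩ | ⟨a, ha, rfl⟩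
    · exact ((h l).1 _ ⟨a, ha, rfl⟩).1
    · exact ((h l).2 _ ⟨a, ha, rfl⟩).1

open MvPolynomial in
/-- The residue formula for simple poles: the enclosed poles are the `v (e i)` with `i ∈ s' l`. -/
theorem iterated_residues {τ κ ι : Type*} [DecidableEq κ] {n : ℕ} (Γ : Fin n → Contour)
    (p : MvPolynomial (Fin n) (MvPolynomial τ ℂ)) (z : τ → ℂ) (s : Fin n → Finset κ)
    (v : κ → ℂ) (hv : ∀ l, Set.InjOn v (s l)) (hΓ : ∀ l, ∀ i ∈ s l, (Γ l).Avoids (v i))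
    (s' : Fin n → Finset ι) (e : ι ↪ κ) (hs : ∀ l, (s' l).map e ⊆ s l)
    (h1 : ∀ l, ∀ i ∈ s' l, (Γ l).index (v (e i)) = 1)
    (h0 : ∀ l, ∀ i ∈ s l, i ∉ (s' l).map e → (Γ l).index (v i) = 0) :
    iterated n Γ (fun w => eval w (map (eval z) p) * ∏ l, (∏ i ∈ s l, (w l - v i))⁻¹) =
      ∑ f ∈ Fintype.piFinset s', eval (fun l => v (e (f l))) (map (eval z) p) *
        ∏ l, Lagrange.nodalWeight (s l) v (e (f l)) := by
  have hone : ∀ l k, (Γ l).integral (fun w => w ^ k * (∏ i ∈ s l, (w - v i))⁻¹) =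
      ∑ i ∈ s' l, v (e i) ^ k * Lagrange.nodalWeight (s l) v (e i) := by
    intro l k
    rw [integral_pow_mul_inv_prod (s l) v (hv l) (hΓ l) k, ← Finset.sum_subset (hs l),
      Finset.sum_map]
    · exact Finset.sum_congr rfl fun i hi => by rw [h1 l i hi, mul_one]
    · intro i hi hi'
      rw [h0 l i hi hi', mul_zero, mul_zero]
  rw [iterated_eval_mul (g := fun l x => (∏ i ∈ s l, (x - v i))⁻¹)]
  · simp only [hone, Finset.prod_univ_sum, Finset.mul_sum]
    rw [Finset.sum_comm]
    refine Finset.sum_congr rfl fun f _ => ?_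
    rw [eval_map, eval₂_eq', Finset.sum_mul]
    simp only [Finset.prod_mul_distrib]
    exact Finset.sum_congr rfl fun d _ => by ring
  · intro l
    refine continuousAlong_of_continuousAt fun γ hγ t ht => ?_
    refine ContinuousAt.inv₀ (by fun_prop) ?_
    exact Finset.prod_ne_zero_iff.2 fun i hi => sub_ne_zero.2 (hΓ l i hi γ hγ t ht)

end Contour

end IteratedContourIntegral

/-! ### The contour integral as a rational function and as a sum of residues -/

section ContourResidues

open MvPolynomial in
/-- The numerator of the integrand of `contourZ`. -/
def zNumerator (n : ℕ) : MvPolynomial (Fin n) (MvPolynomial (Fin (2 * n)) ℂ) :=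
  ∏ l : Fin n, ((C (C omega3 * X ⟨2 * l, by omega⟩) - C (C omega3⁻¹) * X l) *
    ∏ m with l < m, ((X m - X l) * (C (C omega3) * X l - C (C omega3⁻¹) * X m)))

/-- The value of the numerator of the integrand of `contourZ`. -/
def zNumeratorValue (n : ℕ) (z : Fin (2 * n) → ℂ) (w : Fin n → ℂ) : ℂ :=
  ∏ l : Fin n, ((omega3 * z ⟨2 * l, by omega⟩ - omega3⁻¹ * w l) *
    ∏ m with l < m, ((w m - w l) * (omega3 * w l - omega3⁻¹ * w m)))

theorem eval_zNumerator (n : ℕ) (z : Fin (2 * n) → ℂ) (w : Fin n → ℂ) :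
    MvPolynomial.eval w (MvPolynomial.map (MvPolynomial.eval z) (zNumerator n)) =
      zNumeratorValue n z w := by
  simp [zNumerator, zNumeratorValue, map_prod]

/-- The indices of the poles `z i` of the `l`-th variable. -/
def innerPoles (n : ℕ) (l : Fin n) : Finset (Fin (2 * n)) := univ.filter fun i => i.val ≤ 2 * l.val

/-- The indices of the poles `q⁻² z i` of the `l`-th variable. -/
def outerPoles (n : ℕ) (l : Fin n) : Finset (Fin (2 * n)) := univ.filter fun i => 2 * l.val ≤ i.val

theorem zIntegrand_eq (n : ℕ) (z : Fin (2 * n) → ℂ) (w : Fin n → ℂ) :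
    zIntegrand omega3 n z w = (∏ l, (omega3 ^ (outerPoles n l).card)⁻¹) *
      (zNumeratorValue n z w * ∏ l, ((∏ i ∈ innerPoles n l, (w l - z i)) *
        ∏ i ∈ outerPoles n l, (w l - omega3 ^ (-2 : ℤ) * z i))⁻¹) := by
  have h1 : ∀ l i, omega3 * w l - omega3⁻¹ * z i =
      omega3 * (w l - omega3 ^ (-2 : ℤ) * z i) := by
    intro l i
    have := omega3_ne_zero
    rw [zpow_neg, zpow_ofNat]
    field_simp
  rw [zIntegrand, zNumeratorValue, ← Finset.prod_mul_distrib, ← Finset.prod_mul_distrib]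
  refine Finset.prod_congr rfl fun l _ => ?_
  simp only [h1, Finset.prod_mul_distrib, Finset.prod_const, innerPoles, outerPoles]
  rw [div_eq_mul_inv, mul_left_comm (∏ i with _, _), mul_inv]
  ring

open MvPolynomial in
/-- The product of the differences `z i - q⁻² z j`. -/
def poleResultant (n : ℕ) : MvPolynomial (Fin (2 * n)) ℂ :=
  ∏ x : Fin (2 * n) × Fin (2 * n), (X x.1 - C (omega3 ^ (-2 : ℤ)) * X x.2)

theorem contour_iterated_const_mul {n : ℕ} (Γ : Fin n → Contour) (c : ℂ) (f : (Fin n → ℂ) → ℂ) :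
    Contour.iterated n Γ (fun w => c * f w) = c * Contour.iterated n Γ f := by
  induction n with
  | zero => rfl
  | succ n ih =>
    simp only [Contour.iterated, ih, Contour.integral_const_mul]

/-- The prefactor of `contourZ`. -/
def zPrefactor (n : ℕ) (z : Fin (2 * n) → ℂ) : ℂ :=
  ∏ i, ∏ j with i < j, (omega3 * z i - omega3⁻¹ * z j)

theorem zIntegrand_eq_poleFun (n : ℕ) (z : Fin (2 * n) → ℂ) (w : Fin n → ℂ) :
    zIntegrand omega3 n z w = (∏ l, (omega3 ^ (outerPoles n l).card)⁻¹) *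
      (MvPolynomial.eval w (MvPolynomial.map (MvPolynomial.eval z) (zNumerator n)) *
        ∏ l, Contour.poleFun 0
          (((innerPoles n l).toList.map MvPolynomial.X).map (MvPolynomial.eval z) ++
            ((outerPoles n l).toList.map fun i =>
              MvPolynomial.C (omega3 ^ (-2 : ℤ)) * MvPolynomial.X i).map (MvPolynomial.eval z))
          (w l)) := by
  rw [zIntegrand_eq, eval_zNumerator]
  congr 2
  refine Finset.prod_congr rfl fun l _ => ?_
  rw [Contour.poleFun, pow_zero, one_div, List.map_append, List.prod_append]
  simp only [List.map_map, Function.comp_def, MvPolynomial.eval_X, MvPolynomial.eval_C, map_mul,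
    Finset.prod_map_toList]

theorem AdmissibleContours.separates {n : ℕ} {z : Fin (2 * n) → ℂ} {Γ : Fin n → Contour}
    (hΓ : AdmissibleContours omega3 n z Γ) (l : Fin n) (s t : List (Fin (2 * n))) :
    (Γ l).Separates
      {x | ∃ a ∈ s.map (MvPolynomial.X (R := ℂ)), x = MvPolynomial.eval z a}
      {x | ∃ b ∈ t.map (fun i => MvPolynomial.C (omega3 ^ (-2 : ℤ)) * MvPolynomial.X (R := ℂ) i),
        x = MvPolynomial.eval z b} := by
  refine ⟨?_, ?_⟩
  · rintro _ ⟨a, ha, rfl⟩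
    obtain ⟨i, -, rfl⟩ := List.mem_map.1 ha
    rw [MvPolynomial.eval_X]
    exact (hΓ l).1 _ (Set.mem_range_self i)
  · rintro _ ⟨a, ha, rfl⟩
    obtain ⟨i, -, rfl⟩ := List.mem_map.1 ha
    rw [map_mul, MvPolynomial.eval_X, MvPolynomial.eval_C]
    exact (hΓ l).2 _ (Set.mem_range_self i)

open MvPolynomial in
theorem sub_dvd_poleResultant (n : ℕ) (i j : Fin (2 * n)) :
    (X i - C (omega3 ^ (-2 : ℤ)) * X j : MvPolynomial (Fin (2 * n)) ℂ) ∣ poleResultant n := by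
  unfold poleResultant
  rw [Fintype.prod_prod_type, ← Finset.mul_prod_erase _ _ (Finset.mem_univ i),
    ← Finset.mul_prod_erase _ _ (Finset.mem_univ j), mul_assoc]
  exact dvd_mul_right _ _

-- The first representation of the integral. It holds at every admissible point, also if some z_i
-- coincide and the poles are not simple.
open MvPolynomial in
theorem contourZ_polynomial (n : ℕ) : ∃ (M : ℕ) (Q : MvPolynomial (Fin (2 * n)) ℂ),
    ∀ (z : Fin (2 * n) → ℂ) (Γ : Fin n → Contour), AdmissibleContours omega3 n z Γ →
      eval z (poleResultant n) ^ M * contourZ omega3 n z Γ = eval z Q := by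
  obtain ⟨M, Q, h⟩ := Contour.iterated_polynomial (zNumerator n) (poleResultant n)
    (fun l => (innerPoles n l).toList.map X)
    (fun l => (outerPoles n l).toList.map fun i => C (omega3 ^ (-2 : ℤ)) * X i) (by
      intro l a ha b hb
      obtain ⟨i, -, rfl⟩ := List.mem_map.1 ha
      obtain ⟨j, -, rfl⟩ := List.mem_map.1 hb
      exact sub_dvd_poleResultant n i j)
  obtain ⟨Q', hQ'⟩ : ∃ Q' : MvPolynomial (Fin (2 * n)) ℂ, ∀ z, eval z Q' =
      (-1) ^ n.choose 2 * zPrefactor n z * ∏ l, (omega3 ^ (outerPoles n l).card)⁻¹ :=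
    ⟨C ((-1) ^ n.choose 2) * (∏ i, ∏ j with i < j, (C omega3 * X i - C omega3⁻¹ * X j)) *
      C (∏ l, (omega3 ^ (outerPoles n l).card)⁻¹), fun z => by
        simp only [zPrefactor, eval_C, map_prod, map_sub, map_mul, eval_X]⟩
  refine ⟨M, Q' * Q, fun z Γ hΓ => ?_⟩
  have h1 := h z Γ fun l => hΓ.separates l _ _
  rw [contourZ, funext (zIntegrand_eq_poleFun n z), contour_iterated_const_mul, map_mul, ← h1, hQ',
    zPrefactor]
  ring

/-- A term of the residue sum for `contourZ`. -/
def residueTerm (n : ℕ) (z : Fin (2 * n) → ℂ) (p : Fin n → Fin (2 * n)) : ℂ :=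
  zPrefactor n z * zNumeratorValue n z (fun l => z (p l)) /
    ((∏ l, ∏ i ∈ (innerPoles n l).erase (p l), (z (p l) - z i)) *
      ∏ l, ∏ i ∈ outerPoles n l, (omega3 * z (p l) - omega3⁻¹ * z i))

/-- The second representation. At generic points all poles are simple, and exactly those at the z_i
are enclosed. -/
theorem contourZ_eq_residues {n : ℕ} {z : Fin (2 * n) → ℂ} (hz : HasDistinctCubes z)
    {Γ : Fin n → Contour} (hΓ : AdmissibleContours omega3 n z Γ) :
    contourZ omega3 n z Γ = (-1) ^ n.choose 2 *
      ∑ p ∈ Fintype.piFinset (innerPoles n), residueTerm n z p := by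
  have hq0 := omega3_ne_zero
  have hqq : omega3 ^ (-2 : ℤ) = omega3 := by
    rw [zpow_neg, zpow_ofNat]
    refine inv_eq_of_mul_eq_one_right ?_
    rw [← pow_succ, omega3_pow_three]
  -- The excluded poles are q⁻² z_i = q z_i.
  set v : Fin (2 * n) ⊕ Fin (2 * n) → ℂ := Sum.elim z fun i => omega3 * z i with hv
  have hres := Contour.iterated_residues Γ (zNumerator n) z
    (fun l => (innerPoles n l).disjSum (outerPoles n l)) v ?_ ?_ (innerPoles n)
    Function.Embedding.inl ?_ ?_ ?_
  · rw [contourZ]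
    have h2 : zIntegrand omega3 n z = fun w => (∏ l, (omega3 ^ (outerPoles n l).card)⁻¹) *
        (MvPolynomial.eval w (MvPolynomial.map (MvPolynomial.eval z) (zNumerator n)) *
          ∏ l, (∏ i ∈ (innerPoles n l).disjSum (outerPoles n l), (w l - v i))⁻¹) := by
      ext w
      rw [zIntegrand_eq, eval_zNumerator]
      congr 2
      refine Finset.prod_congr rfl fun l _ => ?_
      rw [Finset.prod_disjSum, hqq]
      rfl
    rw [h2, contour_iterated_const_mul, hres]
    simp only [Finset.mul_sum]
    refine Finset.sum_congr rfl fun p hp => ?_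
    have hnodal : ∀ l, Lagrange.nodalWeight ((innerPoles n l).disjSum (outerPoles n l)) v
        (Sum.inl (p l)) = omega3 ^ (outerPoles n l).card *
          ((∏ i ∈ (innerPoles n l).erase (p l), (z (p l) - z i)) *
            ∏ i ∈ outerPoles n l, (omega3 * z (p l) - omega3⁻¹ * z i))⁻¹ := by
      intro l
      have he : ((innerPoles n l).disjSum (outerPoles n l)).erase (Sum.inl (p l)) =
          ((innerPoles n l).erase (p l)).disjSum (outerPoles n l) := by
        ext (i | i) <;> simp
      rw [Lagrange.nodalWeight, he, Finset.prod_disjSum, ← Finset.prod_const, mul_inv,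
        ← Finset.prod_inv_distrib, ← Finset.prod_inv_distrib, mul_left_comm,
        ← Finset.prod_mul_distrib]
      congr 1
      refine Finset.prod_congr rfl fun i _ => ?_
      have h3 : omega3 * z (p l) - omega3⁻¹ * z i = omega3 * (z (p l) - omega3 * z i) := by
        rw [omega3_inv]; ring
      rw [h3, mul_inv, mul_inv_cancel_left₀ hq0]
      rfl
    have hvl : ∀ i, v (Sum.inl i) = z i := fun _ => rfl
    have hc : ∏ l, omega3 ^ (outerPoles n l).card ≠ 0 :=
      Finset.prod_ne_zero_iff.2 fun l _ => pow_ne_zero _ hq0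
    simp only [Function.Embedding.inl_apply, hnodal, Finset.prod_mul_distrib,
      Finset.prod_inv_distrib, eval_zNumerator, hvl, residueTerm, zPrefactor]
    rw [div_eq_mul_inv]
    linear_combination ((-1) ^ n.choose 2 * (∏ i, ∏ j with i < j, (omega3 * z i - omega3⁻¹ * z j)) *
      zNumeratorValue n z (fun l => z (p l)) *
      ((∏ l, ∏ i ∈ (innerPoles n l).erase (p l), (z (p l) - z i)) *
      ∏ l, ∏ i ∈ outerPoles n l, (omega3 * z (p l) - omega3⁻¹ * z i))⁻¹) *
        inv_mul_cancel₀ hc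
  · intro l x _ y _ hxy
    have h3 := omega3_pow_three
    rcases x with i | i <;> rcases y with j | j <;>
      simp only [hv, Sum.elim_inl, Sum.elim_inr] at hxy
    · exact congrArg _ (hz.eq_of_mul_eq (c := 1) (d := 1) (one_pow 3) (one_pow 3) (by simpa using hxy)).1
    · exact absurd (hz.eq_of_mul_eq (one_pow 3) h3 (by simpa using hxy)).2.symm omega3_ne_one
    · exact absurd (hz.eq_of_mul_eq h3 (one_pow 3) (by simpa using hxy)).2 omega3_ne_one
    · exact congrArg _ (hz.eq_of_mul_eq h3 h3 hxy).1
  · intro l x _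
    rcases x with i | i
    · exact ((hΓ l).1 _ ⟨i, rfl⟩).1
    · exact ((hΓ l).2 _ ⟨i, by simp [hqq, hv]⟩).1
  · intro l x hx
    obtain ⟨i, hi, rfl⟩ := Finset.mem_map.1 hx
    exact Finset.inl_mem_disjSum.2 hi
  · intro l i _
    exact ((hΓ l).1 _ ⟨i, rfl⟩).2
  · intro l x hx hx'
    rcases x with i | i
    · exact absurd (Finset.mem_map.2 ⟨i, Finset.inl_mem_disjSum.1 hx, rfl⟩) hx'
    · exact ((hΓ l).2 _ ⟨i, by simp [hqq, hv]⟩).2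

end ContourResidues

/-! ### Cancellation in the residues -/

section ResidueNumerators

variable {A : Type*} [CommRing A] [Algebra ℂ A]

/-- The linear form `q a - q⁻¹ b`. -/
def qSub (a b : A) : A := algebraMap ℂ A omega3 * a - algebraMap ℂ A omega3⁻¹ * b

theorem qSub_def (a b : ℂ) : qSub a b = omega3 * a - omega3⁻¹ * b := rfl

theorem map_qSub {B : Type*} [CommRing B] [Algebra ℂ B] (φ : A →ₐ[ℂ] B) (a b : A) :
    φ (qSub a b) = qSub (φ a) (φ b) := by
  simp [qSub]

theorem qSub_eq_mul (a b : ℂ) : qSub a b = omega3 * (a - omega3 * b) := by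
  rw [qSub_def, omega3_inv]; ring

theorem qSub_eq_zero_iff (a b : ℂ) : qSub a b = 0 ↔ b = omega3 ^ 2 * a := by
  rw [qSub_eq_mul, mul_eq_zero, or_iff_right omega3_ne_zero, sub_eq_zero]
  have := omega3_pow_three
  constructor
  · rintro rfl; linear_combination (-b) * this
  · rintro rfl; linear_combination (-a) * this

/-- The product of `q v_i - q⁻¹ v_j` over `j > i`. -/
def upperProd {N : ℕ} (v : Fin N → A) (i : Fin N) : A :=
  ∏ j, if i < j then qSub (v i) (v j) else 1

/-- The factor that is left of the poles `q⁻² v_j` in a residue of the `l`-th variable at `v_a`. -/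
def nodeFactor {n : ℕ} (v : Fin (2 * n) → A) (l : Fin n) (a : Fin (2 * n)) : A :=
  if a.val = 2 * l.val then 1
  else qSub (v ⟨2 * l, by omega⟩) (v a) *
    ∏ j, if a < j ∧ j.val < 2 * l.val then qSub (v a) (v j) else 1

/-- The numerator of a residue of the integrand of `contourZ`, after cancellation. -/
def residueNumerator {n : ℕ} (v : Fin (2 * n) → A) (p : Fin n → Fin (2 * n)) : A :=
  (∏ i, if ∃ l, p l = i then 1 else upperProd v i) * (∏ l, nodeFactor v l (p l)) *
    ∏ l, ∏ m, if l < m then (v (p m) - v (p l)) * qSub (v (p l)) (v (p m)) else 1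

/-- The denominator of a residue of the integrand of `contourZ`, after cancellation. -/
def residueDenominator {n : ℕ} (v : Fin (2 * n) → A) (p : Fin n → Fin (2 * n)) : A :=
  ∏ l : Fin n, ∏ i, if i.val ≤ 2 * l.val ∧ i ≠ p l then v (p l) - v i else 1

theorem map_residueNumerator {B : Type*} [CommRing B] [Algebra ℂ B] (φ : A →ₐ[ℂ] B) {n : ℕ}
    (v : Fin (2 * n) → A) (p : Fin n → Fin (2 * n)) :
    φ (residueNumerator v p) = residueNumerator (fun i => φ (v i)) p := by
  simp only [residueNumerator, upperProd, nodeFactor, map_mul, map_prod, apply_ite φ, map_one,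
    map_sub, map_qSub]

theorem map_residueDenominator {B : Type*} [CommRing B] [Algebra ℂ B] (φ : A →ₐ[ℂ] B) {n : ℕ}
    (v : Fin (2 * n) → A) (p : Fin n → Fin (2 * n)) :
    φ (residueDenominator v p) = residueDenominator (fun i => φ (v i)) p := by
  simp only [residueDenominator, map_prod, apply_ite φ, map_one, map_sub]

/-- The poles q⁻² z_j of the l-th variable disappear from its residue at z_a. They come from j ≥ 2l.
If a < 2l, all of them occur in the prefactor, which has every j > a; if a = 2l, the missing factor
j = a is the linear factor of the numerator. -/
theorem upperProd_mul_qSub {n : ℕ} (v : Fin (2 * n) → A) (l : Fin n) (a : Fin (2 * n))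
    (ha : a.val ≤ 2 * l.val) :
    upperProd v a * qSub (v ⟨2 * l, by omega⟩) (v a) =
      nodeFactor v l a * ∏ i ∈ outerPoles n l, qSub (v a) (v i) := by
  rw [outerPoles, Finset.prod_filter, nodeFactor, upperProd]
  split_ifs with h
  · have ha' : (⟨2 * l, by omega⟩ : Fin (2 * n)) = a := Fin.ext h.symm
    have h1 : qSub (v a) (v a) = ∏ j, if j = a then qSub (v a) (v j) else 1 := by
      rw [Finset.prod_ite_eq' Finset.univ a, if_pos (Finset.mem_univ a)]
    rw [ha', h1, ← Finset.prod_mul_distrib, one_mul]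
    refine Finset.prod_congr rfl fun j _ => ?_
    simp only [Fin.ext_iff, Fin.lt_def]
    split_ifs <;> first | omega | simp
  · rw [mul_assoc, ← Finset.prod_mul_distrib, mul_comm]
    congr 1
    refine Finset.prod_congr rfl fun j _ => ?_
    simp only [Fin.lt_def]
    split_ifs <;> first | omega | simp

/-- The choices of distinct poles `p l ≤ 2 l`. -/
def residueIndices (n : ℕ) : Finset (Fin n → Fin (2 * n)) :=
  (Fintype.piFinset (innerPoles n)).filter Function.Injective

theorem mem_residueIndices {n : ℕ} {p : Fin n → Fin (2 * n)} :
    p ∈ residueIndices n ↔ (∀ l, (p l).val ≤ 2 * l.val) ∧ Function.Injective p := by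
  simp [residueIndices, innerPoles]

theorem HasDistinctCubes.qSub_ne_zero {ι : Type*} {z : ι → ℂ} (hz : HasDistinctCubes z) (i j : ι) :
    qSub (z i) (z j) ≠ 0 := by
  intro h
  rw [qSub_eq_zero_iff] at h
  have h1 := (hz.eq_of_mul_eq (c := 1) (d := omega3 ^ 2) (i := j) (j := i) (one_pow 3)
    (by rw [← pow_mul, mul_comm, pow_mul, omega3_pow_three, one_pow]) (by simpa using h)).2
  apply omega3_ne_one
  rw [← omega3_pow_three, pow_succ, ← h1, one_mul]

/-- The prefactor is a product over lines i. As `p` is injective, each chosen line is used for the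
cancellation of exactly one variable; the other lines keep their full factor `upperProd`. -/
theorem residueTerm_eq {n : ℕ} {z : Fin (2 * n) → ℂ} (hz : HasDistinctCubes z)
    {p : Fin n → Fin (2 * n)} (hp : p ∈ residueIndices n) :
    residueTerm n z p = residueNumerator z p / residueDenominator z p := by
  obtain ⟨hp, hinj⟩ := mem_residueIndices.1 hp
  have h1 : zPrefactor n z = (∏ i, if ∃ l, p l = i then 1 else upperProd z i) *
      ∏ l, upperProd z (p l) := by
    have h2 : ∏ l, upperProd z (p l) = ∏ i, if ∃ l, p l = i then upperProd z i else 1 := by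
      rw [← Finset.prod_filter, ← Finset.prod_image (f := upperProd z) (g := p) hinj.injOn]
      congr 1
      ext i
      simp
    rw [h2, ← Finset.prod_mul_distrib, zPrefactor]
    refine Finset.prod_congr rfl fun i _ => ?_
    rw [Finset.prod_filter]
    split_ifs
    · exact (one_mul _).symm
    · exact (mul_one _).symm
  have h2 : zNumeratorValue n z (fun l => z (p l)) =
      (∏ l : Fin n, qSub (z ⟨2 * l, by omega⟩) (z (p l))) *
        ∏ l, ∏ m, if l < m then (z (p m) - z (p l)) * qSub (z (p l)) (z (p m)) else 1 := by
    rw [zNumeratorValue, ← Finset.prod_mul_distrib]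
    refine Finset.prod_congr rfl fun l _ => ?_
    rw [Finset.prod_filter]
    rfl
  have h3 : ∏ l, ∏ i ∈ (innerPoles n l).erase (p l), (z (p l) - z i) = residueDenominator z p := by
    rw [residueDenominator]
    refine Finset.prod_congr rfl fun l _ => ?_
    rw [← Finset.prod_filter]
    refine Finset.prod_congr ?_ fun i _ => rfl
    ext i
    simp [innerPoles, and_comm]
  have h4 : (∏ l, upperProd z (p l)) * ∏ l : Fin n, qSub (z ⟨2 * l, by omega⟩) (z (p l)) =
      (∏ l, nodeFactor z l (p l)) * ∏ l, ∏ i ∈ outerPoles n l, qSub (z (p l)) (z i) := by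
    rw [← Finset.prod_mul_distrib, ← Finset.prod_mul_distrib]
    exact Finset.prod_congr rfl fun l _ => upperProd_mul_qSub z l (p l) (hp l)
  have h5 : ∏ l, ∏ i ∈ outerPoles n l, qSub (z (p l)) (z i) ≠ 0 :=
    Finset.prod_ne_zero_iff.2 fun l _ => Finset.prod_ne_zero_iff.2 fun i _ => hz.qSub_ne_zero _ _
  rw [residueTerm, h1, h2, h3, residueNumerator]
  change _ / (_ * ∏ l, ∏ i ∈ outerPoles n l, qSub (z (p l)) (z i)) = _
  rw [mul_comm (residueDenominator z p), ← div_div]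
  congr 1
  rw [div_eq_iff h5]
  linear_combination (∏ i, if ∃ l, p l = i then 1 else upperProd z i) *
    (∏ l, ∏ m, if l < m then (z (p m) - z (p l)) * qSub (z (p l)) (z (p m)) else 1) * h4

/-- Two variables with the same pole contribute nothing, because the numerator contains w_m - w_l.
-/
theorem contourZ_eq_sum {n : ℕ} {z : Fin (2 * n) → ℂ} (hz : HasDistinctCubes z)
    {Γ : Fin n → Contour} (hΓ : AdmissibleContours omega3 n z Γ) :
    contourZ omega3 n z Γ = (-1) ^ n.choose 2 *
      ∑ p ∈ residueIndices n, residueNumerator z p / residueDenominator z p := by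
  rw [contourZ_eq_residues hz hΓ]
  congr 1
  rw [← Finset.sum_congr rfl fun p hp => residueTerm_eq hz hp, residueIndices, Finset.sum_filter]
  refine Finset.sum_congr rfl fun p _ => ?_
  split_ifs with h
  · rfl
  · rw [Function.not_injective_iff] at h
    obtain ⟨l, m, hlm, hne⟩ := h
    wlog hlt : l < m generalizing l m
    · exact this m l hlm.symm hne.symm (lt_of_le_of_ne (not_lt.1 hlt) hne.symm)
    have : zNumeratorValue n z (fun l => z (p l)) = 0 := by
      refine Finset.prod_eq_zero (Finset.mem_univ l) ?_
      rw [Finset.prod_eq_zero (i := m) (by simpa using hlt), mul_zero]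
      simp only [hlm, sub_self, zero_mul]
    rw [residueTerm, this, mul_zero, zero_div]

end ResidueNumerators

/-! ### The contour integral is a polynomial -/

section ContourPolynomial

theorem HasDistinctCubes.exists_admissibleContours {n : ℕ} {z : Fin (2 * n) → ℂ}
    (hz : HasDistinctCubes z) : ∃ Γ : Fin n → Contour, AdmissibleContours omega3 n z Γ := by
  obtain ⟨Γ, hΓ⟩ := Contour.exists_separates (univ.image z)
    (univ.image fun i => omega3 ^ (-2 : ℤ) * z i) (by
      rw [Finset.disjoint_left]
      intro x hx hx'
      obtain ⟨i, -, rfl⟩ := Finset.mem_image.1 hx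
      obtain ⟨j, -, hj⟩ := Finset.mem_image.1 hx'
      have hqq : omega3 ^ (-2 : ℤ) = omega3 := by
        rw [zpow_neg, zpow_ofNat]
        refine inv_eq_of_mul_eq_one_right ?_
        rw [← pow_succ, omega3_pow_three]
      rw [hqq] at hj
      exact omega3_ne_one (hz.eq_of_mul_eq (d := 1) omega3_pow_three (one_pow 3)
        (by simpa using hj)).2)
  exact ⟨fun _ => Γ, fun _ => by simpa using hΓ⟩

theorem HasDistinctCubes.injective {ι : Type*} {z : ι → ℂ} (hz : HasDistinctCubes z) :
    Function.Injective z := fun i j hij => hz.2 (by simp only [hij])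

theorem residueDenominator_ne_zero {A : Type*} [CommRing A] [IsDomain A] [Algebra ℂ A] {n : ℕ}
    {v : Fin (2 * n) → A} (hv : Function.Injective v) (p : Fin n → Fin (2 * n)) :
    residueDenominator v p ≠ 0 := by
  refine Finset.prod_ne_zero_iff.2 fun l _ => Finset.prod_ne_zero_iff.2 fun i _ => ?_
  split_ifs with h
  · exact sub_ne_zero.2 (hv.ne h.2.symm)
  · exact one_ne_zero

-- X_a - X_b is irreducible of degree 1 and vanishes where all coordinates are 1, whereas X_i - c
-- X_j takes the value 1 - c there.
open MvPolynomial in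
theorem MvPolynomial.isRelPrime_X_sub_X {σ : Type*} {a b : σ} (hab : a ≠ b) (c : ℂ) (hc : c ≠ 1)
    (i j : σ) : IsRelPrime (X a - X b : MvPolynomial σ ℂ) (X i - C c * X j) := by
  classical
  have hcoeff : coeff (Finsupp.single a 1) (X a - X b : MvPolynomial σ ℂ) = 1 := by
    rw [coeff_sub, coeff_X, coeff_X, if_pos rfl, if_neg, sub_zero]
    intro h
    exact hab (Finsupp.single_left_injective one_ne_zero h).symm
  have hirr : Irreducible (X a - X b : MvPolynomial σ ℂ) := by
    refine irreducible_of_totalDegree_eq_one (le_antisymm ?_ ?_) fun x hx => ?_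
    · refine (totalDegree_sub _ _).trans ?_
      simp [totalDegree_X]
    · have h := le_totalDegree (p := (X a - X b : MvPolynomial σ ℂ)) (s := Finsupp.single a 1)
        (by rw [mem_support_iff, hcoeff]; exact one_ne_zero)
      simpa using h
    · exact isUnit_of_dvd_one (hcoeff ▸ hx _)
  rw [hirr.isRelPrime_iff_not_dvd]
  rintro ⟨g, hg⟩
  have h := congrArg (eval fun _ => (1 : ℂ)) hg
  simp only [map_sub, map_mul, eval_X, eval_C, sub_self, zero_mul, mul_one] at h
  exact hc (sub_eq_zero.1 h).symm

open MvPolynomial in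
theorem eval_residueNumerator {n : ℕ} (z : Fin (2 * n) → ℂ) (p : Fin n → Fin (2 * n)) :
    eval z (residueNumerator X p) = residueNumerator z p := by
  have h := map_residueNumerator (aeval z) (X : _ → MvPolynomial (Fin (2 * n)) ℂ) p
  simpa [coe_aeval_eq_eval] using h

open MvPolynomial in
theorem eval_residueDenominator {n : ℕ} (z : Fin (2 * n) → ℂ) (p : Fin n → Fin (2 * n)) :
    eval z (residueDenominator X p) = residueDenominator z p := by
  have h := map_residueDenominator (aeval z) (X : _ → MvPolynomial (Fin (2 * n)) ℂ) p
  simpa [coe_aeval_eq_eval] using h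

open MvPolynomial in
/-- The numerator of the residue sum over the common denominator. -/
def residueSumNumerator (n : ℕ) : MvPolynomial (Fin (2 * n)) ℂ :=
  C ((-1) ^ n.choose 2) * ∑ p ∈ residueIndices n, residueNumerator X p *
    ∏ p' ∈ (residueIndices n).erase p, residueDenominator X p'

open MvPolynomial in
/-- The common denominator of the residue sum. -/
def residueSumDenominator (n : ℕ) : MvPolynomial (Fin (2 * n)) ℂ :=
  ∏ p ∈ residueIndices n, residueDenominator X p

open MvPolynomial in
theorem eval_residueSumNumerator {n : ℕ} {z : Fin (2 * n) → ℂ} (hz : Function.Injective z) :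
    eval z (residueSumNumerator n) = eval z (residueSumDenominator n) * ((-1) ^ n.choose 2 *
      ∑ p ∈ residueIndices n, residueNumerator z p / residueDenominator z p) := by
  rw [residueSumNumerator, residueSumDenominator, map_mul, eval_C, map_sum, mul_left_comm,
    Finset.mul_sum (a := eval z _)]
  congr 1
  refine Finset.sum_congr rfl fun p hp => ?_
  rw [map_mul, map_prod, map_prod, ← Finset.mul_prod_erase _ _ hp, eval_residueNumerator,
    eval_residueDenominator]
  have := residueDenominator_ne_zero hz p
  field_simp

open MvPolynomial in
theorem isRelPrime_residueSumDenominator (n : ℕ) :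
    IsRelPrime (residueSumDenominator n) (poleResultant n) := by
  unfold residueSumDenominator residueDenominator poleResultant
  refine IsRelPrime.prod_left fun p _ => IsRelPrime.prod_left fun l _ =>
    IsRelPrime.prod_left fun i _ => ?_
  split_ifs with h
  · refine IsRelPrime.prod_right fun x _ => MvPolynomial.isRelPrime_X_sub_X h.2.symm _ ?_ _ _
    rw [zpow_neg, zpow_ofNat]
    intro h1
    apply omega3_ne_one
    rw [← omega3_pow_three, pow_succ, inv_eq_one.1 h1, one_mul]
  · exact isRelPrime_one_left

open MvPolynomial in
/-- The contour integral is a polynomial, namely the residue sum. -/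
theorem exists_contourZ_eq_eval (n : ℕ) : ∃ P : MvPolynomial (Fin (2 * n)) ℂ,
    residueSumNumerator n = residueSumDenominator n * P ∧
    ∀ z Γ, AdmissibleContours omega3 n z Γ → contourZ omega3 n z Γ = eval z P := by
  obtain ⟨M, Q, hQ⟩ := contourZ_polynomial n
  -- Both representations hold at generic points, for which contours exist; cross-multiplied, they
  -- give a polynomial identity.
  have h1 : poleResultant n ^ M * residueSumNumerator n = residueSumDenominator n * Q := by
    refine sub_eq_zero.1 (MvPolynomial.eq_zero_of_eval_generic _ fun z hz => ?_)
    obtain ⟨Γ, hΓ⟩ := hz.exists_admissibleContours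
    rw [map_sub, map_mul, map_mul, map_pow, ← hQ z Γ hΓ, eval_residueSumNumerator hz.injective,
      contourZ_eq_sum hz hΓ]
    ring
  -- The two denominators are coprime, so the one made of differences divides its own numerator.
  obtain ⟨P, hP⟩ := ((isRelPrime_residueSumDenominator n).pow_right).dvd_of_dvd_mul_left
    (Dvd.intro _ h1.symm)
  refine ⟨P, hP, fun z Γ hΓ => ?_⟩
  have hne : residueSumDenominator n ≠ 0 :=
    Finset.prod_ne_zero_iff.2 fun p _ => residueDenominator_ne_zero (X_injective) p
  have h2 : poleResultant n ^ M * P = Q := by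
    apply mul_left_cancel₀ hne
    rw [← h1, hP]
    ring
  -- If z_i = q⁻² z_j, the same point would have index 1 and index 0.
  have h3 : eval z (poleResultant n) ≠ 0 := by
    rw [poleResultant, map_prod]
    refine Finset.prod_ne_zero_iff.2 fun x _ h => ?_
    rw [map_sub, map_mul, eval_X, eval_X, eval_C, sub_eq_zero] at h
    rcases n with _ | n
    · exact x.1.elim0
    · have h4 := ((hΓ 0).1 _ (Set.mem_range_self x.1)).2
      have h5 := ((hΓ 0).2 _ (Set.mem_range_self x.2)).2
      rw [h, h5] at h4
      exact zero_ne_one h4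
  have h4 := hQ z Γ hΓ
  rw [← h2, map_mul, map_pow] at h4
  exact mul_left_cancel₀ (pow_ne_zero M h3) h4

/-- The polynomial that agrees with the contour integrals. -/
def contourPoly (n : ℕ) : MvPolynomial (Fin (2 * n)) ℂ := (exists_contourZ_eq_eval n).choose

theorem residueSumNumerator_eq (n : ℕ) :
    residueSumNumerator n = residueSumDenominator n * contourPoly n :=
  (exists_contourZ_eq_eval n).choose_spec.1

theorem contourZ_eq_eval {n : ℕ} {z : Fin (2 * n) → ℂ} {Γ : Fin n → Contour}
    (hΓ : AdmissibleContours omega3 n z Γ) :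
    contourZ omega3 n z Γ = MvPolynomial.eval z (contourPoly n) :=
  (exists_contourZ_eq_eval n).choose_spec.2 z Γ hΓ

open MvPolynomial in
theorem eval_contourPoly {n : ℕ} {z : Fin (2 * n) → ℂ} (hz : Function.Injective z) :
    eval z (contourPoly n) = (-1) ^ n.choose 2 *
      ∑ p ∈ residueIndices n, residueNumerator z p / residueDenominator z p := by
  have h := eval_residueSumNumerator hz
  rw [residueSumNumerator_eq, map_mul] at h
  refine mul_left_cancel₀ ?_ h
  rw [residueSumDenominator, map_prod]
  refine Finset.prod_ne_zero_iff.2 fun p _ => ?_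
  rw [eval_residueDenominator]
  exact residueDenominator_ne_zero hz p

end ContourPolynomial

/-! ### The degree of the contour polynomial -/

section ContourDegree

open MvPolynomial

theorem degreeOf_qSub_X_le {σ : Type*} [DecidableEq σ] (k a b : σ) :
    (qSub (X a) (X b) : MvPolynomial σ ℂ).degreeOf k ≤
      (if a = k then 1 else 0) + (if b = k then 1 else 0) := by
  have h1 := (degreeOf_C_mul_le (X a) k omega3).trans (MvPolynomial.degreeOf_X_le k a)
  have h2 := (degreeOf_C_mul_le (X b) k omega3⁻¹).trans (MvPolynomial.degreeOf_X_le k b)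
  refine (degreeOf_sub_le k _ _).trans (max_le (h1.trans ?_) (h2.trans ?_)) <;> omega

theorem degreeOf_ite_le {σ : Type*} {P : Prop} [Decidable P] (k : σ) (f : MvPolynomial σ ℂ)
    (d : ℕ) (h : P → f.degreeOf k ≤ d) :
    (if P then f else 1).degreeOf k ≤ if P then d else 0 := by
  split_ifs with hP
  · exact h hP
  · exact (degreeOf_one k).le

theorem Fin.card_filter_lt_val {N : ℕ} (a : Fin N) (b : ℕ) (hb : b ≤ N) :
    #{j : Fin N | a < j ∧ j.val < b} = b - 1 - a.val := by
  have : (univ.filter fun j : Fin N => a < j ∧ j.val < b).map Fin.valEmbedding =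
      Finset.Ioo a.val b := by
    ext x
    simp only [Finset.mem_map, Finset.mem_filter, Finset.mem_univ, true_and, Finset.mem_Ioo,
      Fin.valEmbedding_apply, Fin.lt_def]
    constructor
    · rintro ⟨j, h, rfl⟩; exact h
    · intro h; exact ⟨⟨x, by omega⟩, h, rfl⟩
  rw [← Finset.card_map Fin.valEmbedding, this, Nat.card_Ioo]
  omega

/-- Bounds the degree in z_k of a product of the q z_a - q⁻¹ z_j over a < j < b, the shape shared by
`upperProd` and `nodeFactor`. -/
theorem Fin.sum_ite_lt {N : ℕ} (a k : Fin N) (b : ℕ) (hb : b ≤ N) :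
    (∑ j, if a < j ∧ j.val < b then (if a = k then 1 else 0) + (if j = k then 1 else 0) else 0) =
      if a = k then b - 1 - k.val else if a < k ∧ k.val < b then 1 else 0 := by
  rw [← Finset.sum_filter, Finset.sum_add_distrib, Finset.sum_ite_eq', Finset.sum_const,
    Fin.card_filter_lt_val a b hb]
  simp only [Finset.mem_filter, Finset.mem_univ, true_and, smul_eq_mul]
  split_ifs with h1 h2
  · subst h1
    exact absurd h2.1 (lt_irrefl _)
  · subst h1; omega
  all_goals simp

theorem degreeOf_upperProd_le {N : ℕ} (k i : Fin N) :
    (upperProd (X : Fin N → MvPolynomial (Fin N) ℂ) i).degreeOf k ≤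
      if i = k then N - 1 - k.val else if i < k then 1 else 0 := by
  have h := Fin.sum_ite_lt i k N le_rfl
  simp only [Fin.is_lt, and_true] at h
  rw [← h]
  exact MvPolynomial.degreeOf_prod_le_of_le _ _ _ _ fun j _ =>
    degreeOf_ite_le _ _ _ fun _ => degreeOf_qSub_X_le _ _ _

theorem degreeOf_nodeFactor_le {n : ℕ} (k : Fin (2 * n)) (l : Fin n) (a : Fin (2 * n))
    (ha : a.val ≤ 2 * l.val) :
    (nodeFactor (X : _ → MvPolynomial (Fin (2 * n)) ℂ) l a).degreeOf k ≤
      if a = k then 2 * l.val - k.val else if a < k ∧ k.val ≤ 2 * l.val then 1 else 0 := by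
  rw [nodeFactor]
  split_ifs with h1 h2 h2
  · simp
  · simp
  · simp
  all_goals
    refine (degreeOf_mul_le _ _ _).trans ((Nat.add_le_add (degreeOf_qSub_X_le _ _ _)
      (MvPolynomial.degreeOf_prod_le_of_le _ _ _ _ fun j _ =>
        degreeOf_ite_le _ _ _ fun _ => degreeOf_qSub_X_le _ _ _)).trans ?_)
    rw [Fin.sum_ite_lt a k (2 * l.val) (by omega)]
    simp only [Fin.ext_iff, Fin.lt_def] at *
    split_ifs <;> omega

theorem Fin.sum_sum_ite_lt {n : ℕ} (e : Fin n → ℕ) :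
    (∑ l, ∑ m, if l < m then 2 * (e l + e m) else 0) = ∑ l, 2 * (n - 1) * e l := by
  have h1 : ∀ l m : Fin n, (if l < m then 2 * (e l + e m) else 0) =
      (if l < m then 2 * e l else 0) + if l < m then 2 * e m else 0 := by
    intro l m
    split_ifs <;> ring
  simp only [h1, Finset.sum_add_distrib]
  rw [Finset.sum_comm (f := fun l m => if l < m then 2 * e m else 0), ← Finset.sum_add_distrib]
  refine Finset.sum_congr rfl fun l _ => ?_
  rw [← Finset.sum_add_distrib, Finset.sum_congr rfl (g := fun m => if m ≠ l then 2 * e l else 0)]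
  · rw [← Finset.sum_filter, Finset.sum_const, Finset.filter_ne', Finset.card_erase_of_mem
      (Finset.mem_univ l), Finset.card_univ, Fintype.card_fin, smul_eq_mul]
    ring
  · intro m _
    rcases lt_trichotomy l m with h | h | h
    · simp [h, h.ne', h.not_gt]
    · simp [h]
    · simp [h, h.ne, h.not_gt]

theorem MvPolynomial.degreeOf_X_sub_X {σ : Type*} [DecidableEq σ] {a b : σ} (hab : a ≠ b) (k : σ) :
    (X a - X b : MvPolynomial σ ℂ).degreeOf k = if a = k then 1 else if b = k then 1 else 0 := by
  have hle : ∀ k, (X a - X b : MvPolynomial σ ℂ).degreeOf k ≤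
      if a = k then 1 else if b = k then 1 else 0 := by
    intro k
    refine (degreeOf_sub_le k _ _).trans (max_le ?_ ?_)
    · refine (MvPolynomial.degreeOf_X_le k a).trans ?_
      split_ifs <;> omega
    · refine (MvPolynomial.degreeOf_X_le k b).trans ?_
      split_ifs <;> omega
  have hge : ∀ {a b : σ}, a ≠ b → 1 ≤ (X a - X b : MvPolynomial σ ℂ).degreeOf a := by
    intro a b hab
    have h := monomial_le_degreeOf (f := (X a - X b : MvPolynomial σ ℂ)) a
      (m := Finsupp.single a 1) (by
        rw [mem_support_iff, coeff_sub, coeff_X, coeff_X, if_pos rfl, if_neg, sub_zero]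
        · exact one_ne_zero
        · intro h
          exact hab (Finsupp.single_left_injective one_ne_zero h).symm)
    simpa using h
  refine le_antisymm (hle k) ?_
  split_ifs with h1 h2
  · subst h1
    exact hge hab
  · subst h2
    rw [← neg_sub, degreeOf_neg]
    exact hge hab.symm
  · exact Nat.zero_le _

theorem degreeOf_residueDenominator {n : ℕ} (k : Fin (2 * n)) {p : Fin n → Fin (2 * n)}
    (hp : p ∈ residueIndices n) :
    (residueDenominator (X : _ → MvPolynomial (Fin (2 * n)) ℂ) p).degreeOf k =
      ∑ l : Fin n, if p l = k then 2 * l.val else if k.val ≤ 2 * l.val then 1 else 0 := by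
  obtain ⟨hp, hinj⟩ := mem_residueIndices.1 hp
  have hne : ∀ l : Fin n, ∀ i, (if i.val ≤ 2 * l.val ∧ i ≠ p l then X (p l) - X i else 1 :
      MvPolynomial (Fin (2 * n)) ℂ) ≠ 0 := by
    intro l i
    split_ifs with h
    · exact sub_ne_zero.2 (X_injective.ne h.2.symm)
    · exact one_ne_zero
  rw [residueDenominator, degreeOf_prod_eq _ _ fun l _ => Finset.prod_ne_zero_iff.2 fun i _ => hne l i]
  refine Finset.sum_congr rfl fun l _ => ?_
  rw [degreeOf_prod_eq _ _ fun i _ => hne l i]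
  have h1 : ∀ i, (if i.val ≤ 2 * l.val ∧ i ≠ p l then X (p l) - X i else 1 :
      MvPolynomial (Fin (2 * n)) ℂ).degreeOf k =
      if i.val ≤ 2 * l.val ∧ i ≠ p l then (if p l = k then 1 else if i = k then 1 else 0) else 0 := by
    intro i
    split_ifs with h <;> first | exact degreeOf_one k | (rw [degreeOf_X_sub_X h.2.symm]; simp [*])
  simp only [h1]
  rw [← Finset.sum_filter]
  split_ifs with h2 h3
  · have h4 : (univ.filter fun i : Fin (2 * n) => i.val ≤ 2 * l.val ∧ i ≠ p l) =
        (Finset.Iic (⟨2 * l, by omega⟩ : Fin (2 * n))).erase (p l) := by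
      ext i
      simp [Fin.le_def, and_comm]
    rw [h4, Finset.sum_const, Finset.card_erase_of_mem (by simpa [Fin.le_def] using hp l),
      Fin.card_Iic]
    simp
  · rw [Finset.sum_ite_eq', if_pos]
    simpa using ⟨h3, fun h => h2 h.symm⟩
  · rw [Finset.sum_ite_eq', if_neg]
    simpa using fun h => absurd h h3

/-- Each residue, as a rational function, has degree at most n - 1 in z_k. The prefactor has degree
at most 2n - 1, and each of the n variables lowers the balance by at least 1. -/
theorem degreeOf_residueNumerator_le {n : ℕ} (k : Fin (2 * n)) {p : Fin n → Fin (2 * n)}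
    (hp : p ∈ residueIndices n) :
    (residueNumerator (X : _ → MvPolynomial (Fin (2 * n)) ℂ) p).degreeOf k ≤
      n - 1 + (residueDenominator (X : _ → MvPolynomial (Fin (2 * n)) ℂ) p).degreeOf k := by
  rw [degreeOf_residueDenominator k hp]
  obtain ⟨hp, hinj⟩ := mem_residueIndices.1 hp
  set U : Fin (2 * n) → ℕ := fun i => if i = k then 2 * n - 1 - k.val else if i < k then 1 else 0
    with hU
  set B : Fin n → ℕ := fun l => if p l = k then 2 * l.val - k.val else
    if p l < k ∧ k.val ≤ 2 * l.val then 1 else 0 with hB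
  have h1 : (residueNumerator (X : _ → MvPolynomial (Fin (2 * n)) ℂ) p).degreeOf k ≤
      (∑ i, if ∃ l, p l = i then 0 else U i) + ∑ l, B l +
        ∑ l, 2 * (n - 1) * (if p l = k then 1 else 0) := by
    rw [residueNumerator, ← Fin.sum_sum_ite_lt]
    refine (degreeOf_mul_le _ _ _).trans (Nat.add_le_add ((degreeOf_mul_le _ _ _).trans
      (Nat.add_le_add ?_ ?_)) ?_)
    · refine MvPolynomial.degreeOf_prod_le_of_le _ _ _ _ fun i _ => ?_
      split_ifs
      · exact (degreeOf_one k).le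
      · exact degreeOf_upperProd_le k i
    · exact MvPolynomial.degreeOf_prod_le_of_le _ _ _ _ fun l _ =>
        degreeOf_nodeFactor_le k l (p l) (hp l)
    · refine MvPolynomial.degreeOf_prod_le_of_le _ _ _ _ fun l _ =>
        MvPolynomial.degreeOf_prod_le_of_le _ _ _ _ fun m _ => degreeOf_ite_le _ _ _ fun _ => ?_
      have h2 := degreeOf_qSub_X_le k (p l) (p m)
      have h3 := MvPolynomial.degreeOf_X_le k (p l)
      have h4 := MvPolynomial.degreeOf_X_le k (p m)
      have h5 := degreeOf_sub_le k (X (p m) : MvPolynomial (Fin (2 * n)) ℂ) (X (p l))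
      have h6 := degreeOf_mul_le k (X (p m) - X (p l) : MvPolynomial (Fin (2 * n)) ℂ)
        (qSub (X (p l)) (X (p m)))
      omega
  -- The bound for the full prefactor: 2n - 1 - k for the line k itself and 1 for each of the k
  -- lines before it.
  have h2 : (∑ i, if ∃ l, p l = i then 0 else U i) + ∑ l, U (p l) = 2 * n - 1 := by
    have h3 : ∑ l, U (p l) = ∑ i, if ∃ l, p l = i then U i else 0 := by
      rw [← Finset.sum_filter, ← Finset.sum_image (f := U) (g := p) hinj.injOn]
      congr 1
      ext i
      simp
    have h4 : ∀ i, U i = (if i = k then 2 * n - 1 - k.val else 0) + if i < k then 1 else 0 := by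
      intro i
      simp only [hU]
      split_ifs with h5 h6 <;> simp_all
    rw [h3, ← Finset.sum_add_distrib, Finset.sum_congr rfl (g := U) (fun i _ => by split_ifs <;> simp)]
    simp only [h4, Finset.sum_add_distrib, Finset.sum_ite_eq', Finset.mem_univ, if_true]
    rw [← Finset.sum_filter, Finset.sum_const, Finset.filter_gt_eq_Iio, Fin.card_Iio, smul_eq_mul]
    omega
  -- The balance for one variable; the summand 1 is its gain. For `p l = k` the cross factors
  -- contribute 2(n - 1), compensated by the denominator and the lost line.
  have h3 : ∑ l, (B l + 1 + 2 * (n - 1) * (if p l = k then 1 else 0)) ≤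
      ∑ l : Fin n, ((if p l = k then 2 * l.val else if k.val ≤ 2 * l.val then 1 else 0) +
        U (p l)) := by
    refine Finset.sum_le_sum fun l _ => ?_
    have h4 := hp l
    simp only [hB, hU, Fin.ext_iff, Fin.lt_def]
    split_ifs <;> omega
  simp only [Finset.sum_add_distrib, Finset.sum_const, Finset.card_univ, Fintype.card_fin,
    smul_eq_mul, mul_one] at h3
  have hk := k.isLt
  omega

/-- Over the common denominator every summand exceeds the degree of the denominator by at most n -
1, and degrees are additive in the quotient. -/
theorem degreeOf_contourPoly_le (n : ℕ) (k : Fin (2 * n)) :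
    (contourPoly n).degreeOf k ≤ n - 1 := by
  by_cases h0 : contourPoly n = 0
  · rw [h0, degreeOf_zero]
    exact Nat.zero_le _
  have hne : ∀ p : Fin n → Fin (2 * n),
      residueDenominator (X : _ → MvPolynomial (Fin (2 * n)) ℂ) p ≠ 0 :=
    residueDenominator_ne_zero X_injective
  have hΛ : residueSumDenominator n ≠ 0 := Finset.prod_ne_zero_iff.2 fun p _ => hne p
  have h1 := congrArg (degreeOf k) (residueSumNumerator_eq n)
  rw [degreeOf_mul_eq hΛ h0] at h1
  have h2 : (residueSumNumerator n).degreeOf k ≤ n - 1 + (residueSumDenominator n).degreeOf k := by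
    rw [residueSumNumerator, residueSumDenominator]
    refine (degreeOf_C_mul_le _ _ _).trans (MvPolynomial.degreeOf_sum_le_of_le _ _ _ _ fun p hp => ?_)
    rw [← Finset.mul_prod_erase _ _ hp,
      degreeOf_mul_eq (hne p) (Finset.prod_ne_zero_iff.2 fun p _ => hne p), ← add_assoc]
    exact (degreeOf_mul_le _ _ _).trans
      (Nat.add_le_add_right (degreeOf_residueNumerator_le k hp) _)
  omega

end ContourDegree

/-! ### Wheel condition and recursion for the residue sum -/

section ContourRecursion

/-- The factor q z_i - q⁻¹ z_j survives in `upperProd` if i is not a pole, in `nodeFactor` if the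
variable l at i has 2l > j, and in the cross factors if j is the pole of a later variable. Only the
remaining case gives a nonzero residue. -/
theorem residueNumerator_eq_zero_of_factor {n : ℕ} {z : Fin (2 * n) → ℂ} {p : Fin n → Fin (2 * n)}
    {i j : Fin (2 * n)} (hp : ∀ l, (p l).val ≤ 2 * l.val) (hij : i < j) (h : qSub (z i) (z j) = 0)
    (hne : residueNumerator z p ≠ 0) :
    (∃ l, p l = i ∧ 2 * l.val ≤ j.val) ∧ ∀ m, p m ≠ j := by
  simp only [residueNumerator, mul_ne_zero_iff, Finset.prod_ne_zero_iff, Finset.mem_univ,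
    true_implies] at hne
  obtain ⟨⟨h1, h2⟩, h3⟩ := hne
  obtain ⟨l, hl⟩ : ∃ l, p l = i := by
    by_contra hno
    have h4 := h1 i
    rw [if_neg hno, upperProd, Finset.prod_ne_zero_iff] at h4
    exact h4 j (Finset.mem_univ j) (by rw [if_pos hij, h])
  have hlj : 2 * l.val ≤ j.val := by
    by_contra hno
    have h4 := h2 l
    rw [hl, nodeFactor, if_neg (by rw [Fin.lt_def] at hij; omega), mul_ne_zero_iff,
      Finset.prod_ne_zero_iff] at h4
    exact h4.2 j (Finset.mem_univ j) (by rw [if_pos ⟨hij, by omega⟩, h])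
  refine ⟨⟨l, hl, hlj⟩, fun m hm => ?_⟩
  have hml := hp m
  rw [hm] at hml
  have hlm : l < m := by
    refine lt_of_le_of_ne (by rw [Fin.le_def]; omega) ?_
    rintro rfl
    exact hij.ne (hl.symm.trans hm)
  exact h3 l m (by rw [if_pos hlm, hl, hm, h, mul_zero])

/-- A nonzero residue cannot have a pole at j because of the pair (i, j), and must have one because
of the pair (j, k). -/
theorem contourPoly_wheel {n : ℕ} {z : Fin (2 * n) → ℂ} (hz : Function.Injective z)
    {i j k : Fin (2 * n)} (hij : i < j) (hjk : j < k) (h1 : z j = omega3 ^ 2 * z i)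
    (h2 : z k = omega3 ^ 2 * z j) : MvPolynomial.eval z (contourPoly n) = 0 := by
  rw [eval_contourPoly hz, Finset.sum_eq_zero, mul_zero]
  intro p hp
  obtain ⟨hp, -⟩ := mem_residueIndices.1 hp
  rw [div_eq_zero_iff]
  left
  by_contra hne
  obtain ⟨-, h3⟩ := residueNumerator_eq_zero_of_factor hp hij ((qSub_eq_zero_iff _ _).2 h1) hne
  obtain ⟨⟨l, hl, -⟩, -⟩ :=
    residueNumerator_eq_zero_of_factor hp hjk ((qSub_eq_zero_iff _ _).2 h2) hne
  exact h3 l hl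

/-- The embedding of indices that leaves out `x` and `x + 1`. -/
def skipPair {n : ℕ} (x : Fin (2 * n + 1)) (k : Fin (2 * n)) : Fin (2 * (n + 1)) :=
  x.castSucc.succAbove (x.succAbove k)

theorem val_skipPair {n : ℕ} (x : Fin (2 * n + 1)) (k : Fin (2 * n)) :
    (skipPair x k).val = if k.val < x.val then k.val else k.val + 2 := by
  simp only [skipPair, Fin.succAbove, Fin.lt_def]
  split_ifs <;> simp_all <;> omega

theorem prod_univ_skipPair {A : Type*} [CommMonoid A] {n : ℕ} (x : Fin (2 * n + 1))
    (g : Fin (2 * (n + 1)) → A) :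
    ∏ i, g i = g x.castSucc * g x.succ * ∏ k, g (skipPair x k) := by
  have h := Fin.prod_univ_succAbove (n := 2 * n + 1) g x.castSucc
  rw [Fin.prod_univ_succAbove _ x] at h
  rw [mul_assoc]
  have hx : x.castSucc.succAbove x = x.succ := by simp [Fin.succAbove]
  rw [hx] at h
  exact h

theorem skipPair_injective {n : ℕ} (x : Fin (2 * n + 1)) : Function.Injective (skipPair x) :=
  Fin.succAbove_right_injective.comp Fin.succAbove_right_injective

theorem exists_skipPair_eq {n : ℕ} {x : Fin (2 * n + 1)} {i : Fin (2 * (n + 1))}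
    (h1 : i ≠ x.castSucc) (h2 : i ≠ x.succ) : ∃ k, skipPair x k = i := by
  obtain ⟨j, rfl⟩ := Fin.exists_succAbove_eq (n := 2 * n + 1) h1
  obtain ⟨k, rfl⟩ := Fin.exists_succAbove_eq (x := j) (y := x) (by
    rintro rfl
    exact h2 (by simp [Fin.succAbove]))
  exact ⟨k, rfl⟩

/-- The variable whose residue can be taken at both `x` and `x + 1`. -/
def pairIndex {n : ℕ} (x : Fin (2 * n + 1)) : Fin (n + 1) := ⟨(x.val + 1) / 2, by omega⟩

/-- Extend a choice of poles by the choice of the pole `x`. -/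
def insertPole {n : ℕ} (x : Fin (2 * n + 1)) (p : Fin n → Fin (2 * n)) :
    Fin (n + 1) → Fin (2 * (n + 1)) :=
  Fin.insertNth (α := fun _ => Fin (2 * (n + 1))) (pairIndex x) x.castSucc
    fun l => skipPair x (p l)

theorem insertPole_same {n : ℕ} (x : Fin (2 * n + 1)) (p : Fin n → Fin (2 * n)) :
    insertPole x p (pairIndex x) = x.castSucc :=
  Fin.insertNth_apply_same (α := fun _ => Fin (2 * (n + 1))) _ _ _

theorem insertPole_succAbove {n : ℕ} (x : Fin (2 * n + 1)) (p : Fin n → Fin (2 * n)) (l : Fin n) :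
    insertPole x p ((pairIndex x).succAbove l) = skipPair x (p l) :=
  Fin.insertNth_apply_succAbove (α := fun _ => Fin (2 * (n + 1))) _ _ _ _

theorem val_succAbove_pairIndex {n : ℕ} (x : Fin (2 * n + 1)) (l : Fin n) :
    ((pairIndex x).succAbove l).val =
      if l.val < (x.val + 1) / 2 then l.val else l.val + 1 := by
  simp only [pairIndex, Fin.succAbove, Fin.lt_def]
  split_ifs <;> simp_all

theorem insertPole_mem {n : ℕ} (x : Fin (2 * n + 1)) {p : Fin n → Fin (2 * n)}
    (hp : p ∈ residueIndices n) : insertPole x p ∈ residueIndices (n + 1) := by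
  obtain ⟨hp, hinj⟩ := mem_residueIndices.1 hp
  rw [mem_residueIndices]
  refine ⟨fun l => ?_, ?_⟩
  · rcases Fin.eq_self_or_eq_succAbove (pairIndex x) l with rfl | ⟨l, rfl⟩
    · rw [insertPole_same, pairIndex]
      simp only [Fin.val_castSucc]
      omega
    · rw [insertPole_succAbove, val_skipPair, val_succAbove_pairIndex]
      have := hp l
      split_ifs <;> omega
  · intro l m hlm
    rcases Fin.eq_self_or_eq_succAbove (pairIndex x) l with rfl | ⟨l, rfl⟩ <;>
      rcases Fin.eq_self_or_eq_succAbove (pairIndex x) m with rfl | ⟨m, rfl⟩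
    · rfl
    · rw [insertPole_same, insertPole_succAbove] at hlm
      exact absurd hlm.symm (Fin.succAbove_ne _ _)
    · rw [insertPole_same, insertPole_succAbove] at hlm
      exact absurd hlm (Fin.succAbove_ne _ _)
    · rw [insertPole_succAbove, insertPole_succAbove] at hlm
      rw [hinj (skipPair_injective x hlm)]

theorem insertPole_injective {n : ℕ} (x : Fin (2 * n + 1)) :
    Function.Injective (insertPole (n := n) x) := by
  intro p p' h
  ext1 l
  have := congrFun h ((pairIndex x).succAbove l)
  rw [insertPole_succAbove, insertPole_succAbove] at this
  exact skipPair_injective x this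

/-- In a nonzero residue some variable l has its pole at x, and x ≤ 2l ≤ x + 1, which determines l.
No variable has its pole at x + 1, so deleting l and both lines leaves a choice of poles of smaller
size. -/
theorem exists_insertPole_eq {n : ℕ} {x : Fin (2 * n + 1)} {z : Fin (2 * (n + 1)) → ℂ}
    (hx : z x.succ = omega3 ^ 2 * z x.castSucc) {p : Fin (n + 1) → Fin (2 * (n + 1))}
    (hp : p ∈ residueIndices (n + 1)) (hne : residueNumerator z p ≠ 0) :
    ∃ p' ∈ residueIndices n, insertPole x p' = p := by
  obtain ⟨hp, hinj⟩ := mem_residueIndices.1 hp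
  obtain ⟨⟨l₀, h1, h2⟩, h3⟩ := residueNumerator_eq_zero_of_factor hp
    (i := x.castSucc) (j := x.succ) (Fin.castSucc_lt_succ) ((qSub_eq_zero_iff _ _).2 hx) hne
  have h4 := hp l₀
  rw [h1] at h4
  simp only [Fin.val_castSucc, Fin.val_succ] at h2 h4
  have h5 : l₀ = pairIndex x := by
    ext
    simp only [pairIndex]
    omega
  subst h5
  have h6 : ∀ l, ∃ k, skipPair x k = p ((pairIndex x).succAbove l) := by
    intro l
    refine exists_skipPair_eq (fun h => ?_) (h3 _)
    rw [← h1] at h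
    exact Fin.succAbove_ne _ _ (hinj h)
  choose p' hp' using h6
  refine ⟨p', mem_residueIndices.2 ⟨fun l => ?_, fun l m hlm => ?_⟩, ?_⟩
  · have h7 := hp ((pairIndex x).succAbove l)
    rw [← hp', val_skipPair, val_succAbove_pairIndex] at h7
    split_ifs at h7 <;> omega
  · have h7 := congrArg (skipPair x) hlm
    rw [hp', hp'] at h7
    exact Fin.succAbove_right_injective (hinj h7)
  · ext1 l
    rcases Fin.eq_self_or_eq_succAbove (pairIndex x) l with rfl | ⟨l, rfl⟩
    · rw [insertPole_same, h1]
    · rw [insertPole_succAbove, hp']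

end ContourRecursion

section ContourRecursion

variable {n : ℕ} (x : Fin (2 * n + 1)) (z : Fin (2 * (n + 1)) → ℂ)

/-- The factor in which the two lines `x` and `x + 1` meet an earlier line. -/
def pairFactor (k : Fin (2 * n)) : ℂ :=
  if k.val < x.val then qSub (z (skipPair x k)) (z x.castSucc) * qSub (z (skipPair x k)) (z x.succ)
  else 1

theorem upperProd_skipPair (k : Fin (2 * n)) :
    upperProd z (skipPair x k) = pairFactor x z k * upperProd (fun k => z (skipPair x k)) k := by
  rw [upperProd, prod_univ_skipPair x, pairFactor, upperProd]
  congr 1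
  · simp only [Fin.lt_def, val_skipPair, Fin.val_castSucc, Fin.val_succ]
    split_ifs <;> first | omega | simp
  · refine Finset.prod_congr rfl fun j _ => ?_
    simp only [Fin.lt_def, val_skipPair]
    split_ifs <;> first | omega | rfl

theorem upperProd_succ :
    upperProd z x.succ = ∏ k, if k.val < x.val then 1 else qSub (z x.succ) (z (skipPair x k)) := by
  rw [upperProd, prod_univ_skipPair x]
  simp only [Fin.lt_def, val_skipPair, Fin.val_castSucc, Fin.val_succ]
  rw [if_neg (by omega), if_neg (by omega), one_mul, one_mul]
  refine Finset.prod_congr rfl fun j _ => ?_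
  split_ifs <;> first | omega | rfl

theorem nodeFactor_skipPair (l : Fin n) (a : Fin (2 * n)) (ha : a.val ≤ 2 * l.val) :
    nodeFactor z ((pairIndex x).succAbove l) (skipPair x a) =
      (if l.val < (x.val + 1) / 2 then 1 else pairFactor x z a) *
        nodeFactor (fun k => z (skipPair x k)) l a := by
  have h1 : (skipPair x a).val = 2 * ((pairIndex x).succAbove l).val ↔ a.val = 2 * l.val := by
    rw [val_skipPair, val_succAbove_pairIndex]
    split_ifs <;> omega
  simp only [nodeFactor, h1]
  by_cases h2 : a.val = 2 * l.val
  · rw [if_pos h2, if_pos h2, mul_one]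
    split_ifs with h3
    · rfl
    · rw [pairFactor, if_neg (by omega)]
  rw [if_neg h2, if_neg h2, prod_univ_skipPair x, mul_left_comm]
  have h3 : (⟨2 * ((pairIndex x).succAbove l).val, by omega⟩ : Fin (2 * (n + 1))) =
      skipPair x ⟨2 * l.val, by omega⟩ := by
    ext
    simp only [val_skipPair, val_succAbove_pairIndex]
    split_ifs <;> omega
  rw [h3]
  congr 2
  · rw [pairFactor]
    simp only [Fin.lt_def, val_skipPair, val_succAbove_pairIndex, Fin.val_castSucc, Fin.val_succ]
    split_ifs <;> first | omega | simp
  · refine Finset.prod_congr rfl fun j _ => ?_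
    simp only [Fin.lt_def, val_skipPair, val_succAbove_pairIndex]
    split_ifs <;> first | omega | rfl

theorem residueDenominator_insertPole (p : Fin n → Fin (2 * n)) :
    residueDenominator z (insertPole x p) =
      ((if x.val % 2 = 0 then 1 else z x.castSucc - z x.succ) *
        ∏ k, if k.val < x.val then z x.castSucc - z (skipPair x k) else 1) *
      ((∏ l, if l.val < (x.val + 1) / 2 then 1 else
        (z (skipPair x (p l)) - z x.castSucc) * (z (skipPair x (p l)) - z x.succ)) *
        residueDenominator (fun k => z (skipPair x k)) p) := by
  rw [residueDenominator, Fin.prod_univ_succAbove _ (pairIndex x), residueDenominator,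
    ← Finset.prod_mul_distrib]
  simp only [insertPole_same, insertPole_succAbove]
  congr 1
  · rw [prod_univ_skipPair x]
    congr 1
    · simp only [ne_eq, Fin.ext_iff, pairIndex, Fin.val_castSucc, Fin.val_succ,
        not_true_eq_false, and_false, if_false, one_mul]
      split_ifs <;> first | omega | rfl
    · refine Finset.prod_congr rfl fun j _ => ?_
      simp only [ne_eq, Fin.ext_iff, val_skipPair, pairIndex, Fin.val_castSucc]
      split_ifs <;> first | omega | rfl
  · refine Finset.prod_congr rfl fun l _ => ?_
    rw [prod_univ_skipPair x]
    congr 1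
    · simp only [ne_eq, Fin.ext_iff, val_skipPair, val_succAbove_pairIndex, Fin.val_castSucc,
        Fin.val_succ]
      split_ifs <;> first | omega | simp
    · refine Finset.prod_congr rfl fun j _ => ?_
      have h1 : (skipPair x j).val ≤ 2 * ((pairIndex x).succAbove l).val ↔ j.val ≤ 2 * l.val := by
        rw [val_skipPair, val_succAbove_pairIndex]
        split_ifs <;> omega
      simp only [ne_eq, (skipPair_injective x).eq_iff, h1]

end ContourRecursion

section ContourRecursion

variable {n : ℕ} (x : Fin (2 * n + 1)) (z : Fin (2 * (n + 1)) → ℂ)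

theorem prod_cross_insertPole (p : Fin n → Fin (2 * n)) :
    (∏ l, ∏ m, if l < m then (z (insertPole x p m) - z (insertPole x p l)) *
        qSub (z (insertPole x p l)) (z (insertPole x p m)) else 1) =
      (∏ l : Fin n, if l.val < (x.val + 1) / 2 then
        (z x.castSucc - z (skipPair x (p l))) * qSub (z (skipPair x (p l))) (z x.castSucc)
        else (z (skipPair x (p l)) - z x.castSucc) *
          qSub (z x.castSucc) (z (skipPair x (p l)))) *
      ∏ l, ∏ m, if l < m then (z (skipPair x (p m)) - z (skipPair x (p l))) *
        qSub (z (skipPair x (p l))) (z (skipPair x (p m))) else 1 := by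
  simp only [Fin.prod_univ_succAbove _ (pairIndex x), insertPole_same, insertPole_succAbove,
    lt_self_iff_false, if_false, one_mul]
  rw [Finset.prod_mul_distrib, ← mul_assoc, ← Finset.prod_mul_distrib]
  congr 1
  · refine Finset.prod_congr rfl fun l _ => ?_
    simp only [Fin.lt_def, val_succAbove_pairIndex]
    simp only [pairIndex]
    split_ifs <;> first | omega | simp
  · refine Finset.prod_congr rfl fun l _ => Finset.prod_congr rfl fun m _ => ?_
    simp only [(Fin.strictMono_succAbove (pairIndex x)).lt_iff_lt]

theorem prod_upperProd_insertPole (p : Fin n → Fin (2 * n)) :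
    (∏ i, if ∃ l, insertPole x p l = i then 1 else upperProd z i) =
      upperProd z x.succ * ((∏ k, if ∃ l, p l = k then 1 else pairFactor x z k) *
        ∏ k, if ∃ l, p l = k then 1 else upperProd (fun k => z (skipPair x k)) k) := by
  have h1 : ∃ l, insertPole x p l = x.castSucc := ⟨_, insertPole_same x p⟩
  have h0 : ∀ l, skipPair x (p l) ≠ x.succ := by
    intro l h
    have h2 := congrArg Fin.val h
    rw [val_skipPair, Fin.val_succ] at h2
    split_ifs at h2 <;> omega
  have h2 : ¬∃ l, insertPole x p l = x.succ := by
    rintro ⟨l, hl⟩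
    rcases Fin.eq_self_or_eq_succAbove (pairIndex x) l with rfl | ⟨l, rfl⟩
    · rw [insertPole_same] at hl
      exact (Fin.castSucc_lt_succ).ne hl
    · rw [insertPole_succAbove] at hl
      exact h0 _ hl
  have h3 : ∀ k, (∃ l, insertPole x p l = skipPair x k) ↔ ∃ l, p l = k := by
    intro k
    constructor
    · rintro ⟨l, hl⟩
      rcases Fin.eq_self_or_eq_succAbove (pairIndex x) l with rfl | ⟨l, rfl⟩
      · rw [insertPole_same] at hl
        exact absurd hl.symm (Fin.succAbove_ne _ _)
      · rw [insertPole_succAbove] at hl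
        exact ⟨l, skipPair_injective x hl⟩
    · rintro ⟨l, rfl⟩
      exact ⟨_, insertPole_succAbove x p l⟩
  rw [prod_univ_skipPair x, if_pos h1, if_neg h2, one_mul, ← Finset.prod_mul_distrib]
  congr 1
  refine Finset.prod_congr rfl fun k _ => ?_
  simp only [h3, upperProd_skipPair]
  split_ifs <;> simp

/-- The ratio of the two residues does not depend on `p`. Stated without division; the factors are
grouped by the remaining variables l (`hl`), by the remaining lines k (`hk`), and by the lines at a
pole and the others (`hpair`). -/
theorem residueNumerator_insertPole (hx : z x.succ = omega3 ^ 2 * z x.castSucc)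
    {p : Fin n → Fin (2 * n)} (hp : p ∈ residueIndices n) :
    residueNumerator z (insertPole x p) * residueDenominator (fun k => z (skipPair x k)) p =
      (-1) ^ n * (∏ k, (omega3 * z x.castSucc - z (skipPair x k))) *
        residueNumerator (fun k => z (skipPair x k)) p *
          residueDenominator z (insertPole x p) := by
  obtain ⟨hp, hinj⟩ := mem_residueIndices.1 hp
  have hq3 := omega3_pow_three
  have hnode : nodeFactor z (pairIndex x) x.castSucc =
      if x.val % 2 = 0 then 1 else z x.castSucc - z x.succ := by
    rw [nodeFactor]
    simp only [Fin.val_castSucc]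
    by_cases h : x.val % 2 = 0
    · rw [if_pos h, if_pos]
      simp only [pairIndex]
      omega
    · have h1 : (⟨2 * (pairIndex x).val, by omega⟩ : Fin (2 * (n + 1))) = x.succ := by
        ext
        simp only [pairIndex, Fin.val_succ]
        omega
      rw [if_neg h, if_neg (by simp only [pairIndex]; omega), h1, Finset.prod_eq_one, mul_one, hx,
        qSub_def, omega3_inv]
      · linear_combination z x.castSucc * hq3
      · intro j _
        rw [if_neg]
        simp only [Fin.lt_def, pairIndex, Fin.val_castSucc]
        omega
  -- With z_{x+1} = q² z_x, the cross factors with the inserted pole become, up to -q², the pair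
  -- factor if l is earlier, and new denominator factors if l is later.
  have hl : ∀ l : Fin n, (if l.val < (x.val + 1) / 2 then 1 else pairFactor x z (p l)) *
      (if l.val < (x.val + 1) / 2 then
        (z x.castSucc - z (skipPair x (p l))) * qSub (z (skipPair x (p l))) (z x.castSucc)
        else (z (skipPair x (p l)) - z x.castSucc) *
          qSub (z x.castSucc) (z (skipPair x (p l)))) =
      -omega3 ^ 2 * (pairFactor x z (p l) * (if l.val < (x.val + 1) / 2 then 1 else
        (z (skipPair x (p l)) - z x.castSucc) * (z (skipPair x (p l)) - z x.succ))) := by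
    intro l
    have hpl := hp l
    split_ifs with h
    · rw [pairFactor, if_pos (by omega), hx]
      simp only [qSub_def, omega3_inv]
      linear_combination (z (skipPair x (p l)) - omega3 ^ 3 * z x.castSucc -
        z x.castSucc) * (omega3 * z (skipPair x (p l)) - omega3 ^ 2 * z x.castSucc) * hq3
    · rw [hx]
      simp only [qSub_def, omega3_inv]
      linear_combination pairFactor x z (p l) * (z (skipPair x (p l)) - z x.castSucc) *
        (-omega3 * z x.castSucc) * hq3
  -- Each remaining line contributes its factor q z_x - z_k of the recursion up to q², and a
  -- denominator factor if it precedes x.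
  have hk : upperProd z x.succ * ∏ k, pairFactor x z k =
      (∏ k, if k.val < x.val then z x.castSucc - z (skipPair x k) else 1) *
        ∏ k, (omega3 ^ 2 * (omega3 * z x.castSucc - z (skipPair x k))) := by
    rw [upperProd_succ, ← Finset.prod_mul_distrib, ← Finset.prod_mul_distrib]
    refine Finset.prod_congr rfl fun k _ => ?_
    rw [pairFactor]
    split_ifs with h
    · rw [hx]
      simp only [qSub_def, omega3_inv]
      linear_combination (-omega3 ^ 2 * z x.castSucc *
        (z (skipPair x k) - omega3 * z x.castSucc)) * hq3
    · rw [hx]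
      simp only [qSub_def, omega3_inv]
      ring
  have hpair : (∏ k, if ∃ l, p l = k then 1 else pairFactor x z k) * ∏ l, pairFactor x z (p l) =
      ∏ k, pairFactor x z k := by
    have h2 : ∏ l, pairFactor x z (p l) = ∏ k, if ∃ l, p l = k then pairFactor x z k else 1 := by
      rw [← Finset.prod_filter, ← Finset.prod_image (f := pairFactor x z) (g := p) hinj.injOn]
      congr 1
      ext i
      simp
    rw [h2, ← Finset.prod_mul_distrib]
    refine Finset.prod_congr rfl fun i _ => ?_
    split_ifs <;> simp
  have hl' := Finset.prod_congr rfl fun l (_ : l ∈ univ) => hl l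
  simp only [Finset.prod_mul_distrib, Finset.prod_const, Finset.card_univ, Fintype.card_fin] at hl' hk
  rw [residueNumerator, prod_cross_insertPole, prod_upperProd_insertPole,
    Fin.prod_univ_succAbove _ (pairIndex x), residueDenominator_insertPole, insertPole_same, hnode]
  simp only [insertPole_succAbove, fun l => nodeFactor_skipPair x z l (p l) (hp l),
    Finset.prod_mul_distrib]
  rw [residueNumerator]
  -- The constants collected from n variables and 2n lines.
  have hpow : (-omega3 ^ 2) ^ n * (omega3 ^ 2) ^ (2 * n) = (-1) ^ n := by
    rw [pow_mul, ← mul_pow]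
    congr 1
    linear_combination (-omega3 ^ 3 - 1) * hq3
  have key : ∀ U F N₁ h₀ f N₂ G N₃ D d₁ d₂ C F' F'' a b : ℂ, f * G = a * (F' * d₂) →
      U * F'' = d₁ * (b * C) → F * F' = F'' → a * b = (-1) ^ n →
      U * (F * N₁) * (h₀ * (f * N₂)) * (G * N₃) * D =
        (-1) ^ n * C * (N₁ * N₂ * N₃) * (h₀ * d₁ * (d₂ * D)) := by
    intro U F N₁ h₀ f N₂ G N₃ D d₁ d₂ C F' F'' a b e1 e2 e3 e4
    linear_combination (N₁ * h₀ * N₂ * N₃ * D) * (U * F * e1 + a * d₂ * U * e3 + a * d₂ * e2 +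
      d₂ * d₁ * C * e4)
  refine key _ _ _ _ _ _ _ _ _ _ _ _ _ _ _ _ hl' hk hpair hpow

/-- The recursion of the contour integral at adjacent variables. -/
theorem contourPoly_recursion (hz : Function.Injective z)
    (hx : z x.succ = omega3 ^ 2 * z x.castSucc) :
    MvPolynomial.eval z (contourPoly (n + 1)) =
      (∏ k, (omega3 * z x.castSucc - z (skipPair x k))) *
        MvPolynomial.eval (fun k => z (skipPair x k)) (contourPoly n) := by
  have hz' : Function.Injective fun k => z (skipPair x k) := hz.comp (skipPair_injective x)
  have hsum : ∑ p ∈ residueIndices n, ((-1) ^ n * (∏ k, (omega3 * z x.castSucc -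
      z (skipPair x k)))) * (residueNumerator (fun k => z (skipPair x k)) p /
        residueDenominator (fun k => z (skipPair x k)) p) =
      ∑ p ∈ residueIndices (n + 1), residueNumerator z p / residueDenominator z p := by
    -- Choices of poles outside the image of `insertPole x` have zero numerator.
    refine Finset.sum_of_injOn (insertPole x) (insertPole_injective x).injOn
      (fun p hp => insertPole_mem x hp) (fun p hp hp' => ?_) fun p hp => ?_
    · by_contra hne
      obtain ⟨p', h1, h2⟩ := exists_insertPole_eq hx hp fun h => hne (by rw [h, zero_div])
      exact hp' ⟨p', h1, h2⟩
    · rw [← mul_div_assoc, div_eq_div_iff (residueDenominator_ne_zero hz' p)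
        (residueDenominator_ne_zero hz _), residueNumerator_insertPole x z hx hp]
  rw [eval_contourPoly hz, eval_contourPoly hz', ← hsum, ← Finset.mul_sum, Nat.choose_succ_succ' n 1,
    Nat.choose_one_right, pow_add]
  have h1 : ((-1 : ℂ) ^ n) * (-1) ^ n = 1 := by rw [← mul_pow]; simp
  linear_combination ((-1) ^ n.choose 2 * (∏ k, (omega3 * z x.castSucc - z (skipPair x k))) *
    ∑ p ∈ residueIndices n, residueNumerator (fun k => z (skipPair x k)) p /
      residueDenominator (fun k => z (skipPair x k)) p) * h1

end ContourRecursion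

/-! ### Uniqueness from adjacent hyperplanes and increasing wheels -/

section Uniqueness

theorem HasDistinctCubes.injective_mul {ι κ : Type*} {z : ι → ℂ} (hz : HasDistinctCubes z)
    {c : κ → ℂ} {s : κ → ι} (hc : ∀ a, c a ^ 3 = 1) (h : ∀ a b, s a = s b → c a = c b → a = b) :
    Function.Injective fun a => c a * z (s a) := fun a b hab => by
  obtain ⟨h1, h2⟩ := hz.eq_of_mul_eq (hc a) (hc b) hab
  exact h a b h1 h2

theorem omega3_sq_pow_three : (omega3 ^ 2) ^ 3 = 1 := by
  rw [← pow_mul, mul_comm, pow_mul, omega3_pow_three, one_pow]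

theorem omega3_sq_ne_one : omega3 ^ 2 ≠ 1 := by
  intro h
  apply omega3_ne_one
  rw [← omega3_pow_three, pow_succ, h, one_mul]

theorem omega3_sq_ne : omega3 ^ 2 ≠ omega3 := by
  intro h
  apply omega3_ne_one
  exact mul_left_cancel₀ omega3_ne_zero (by rw [mul_one, ← sq, h])

/-- The wheel z_k, q² z_k, q z_k placed at (k, i, j) keeps all coordinates distinct; the residue sum
is only available at such points. -/
theorem HasDistinctCubes.injective_update_update {σ : Type*} [DecidableEq σ] {z : σ → ℂ}
    (hz : HasDistinctCubes z) {i j k : σ} (hki : k ≠ i) (hkj : k ≠ j) (hne : i ≠ j) :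
    Function.Injective (Function.update (Function.update z i
      (omega3 ^ 2 * z k)) j (omega3 ^ 2 * (omega3 ^ 2 * z k))) := by
  convert! hz.injective_mul
    (c := Function.update (Function.update 1 i (omega3 ^ 2)) j omega3)
    (s := Function.update (Function.update id i k) j k) ?_ ?_ using 1
  · ext a
    by_cases ha : a = j
    · subst ha
      simp only [Function.update_self]
      linear_combination omega3 * z k * omega3_pow_three
    · by_cases ha' : a = i
      · subst ha'; simp [ha]
      · simp [ha, ha']
  · intro a
    by_cases ha : a = j
    · subst ha; simpa using omega3_pow_three
    · by_cases ha' : a = i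
      · subst ha'; simpa [ha] using omega3_sq_pow_three
      · simp [ha, ha']
  · intro a b h1 h2
    have e1 := omega3_sq_ne
    have e2 := omega3_sq_ne_one
    have e3 := omega3_ne_one
    simp only [Function.update_apply, Pi.one_apply, id] at h1 h2
    split_ifs at h1 h2 <;> grind

open MvPolynomial in
/-- A polynomial vanishes on a hyperplane `z_j = q² z_i` if it vanishes at its generic points. -/
theorem MvPolynomial.eval_eq_zero_of_generic {σ : Type*} [Fintype σ] [DecidableEq σ]
    (E : MvPolynomial σ ℂ) {i j : σ} (c : ℂ)
    (h : ∀ z, HasDistinctCubes z → eval (Function.update z j (c * z i)) E = 0) (z : σ → ℂ)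
    (hz : z j = c * z i) : eval z E = 0 := by
  have heval : ∀ z : σ → ℂ, eval z (aeval (Function.update X j (C c * X i)) E) =
      eval (Function.update z j (c * z i)) E := by
    intro z
    have h1 : ((aeval z).comp (aeval (Function.update X j (C c * X i)))) =
        (aeval (Function.update z j (c * z i)) : MvPolynomial σ ℂ →ₐ[ℂ] ℂ) := by
      apply algHom_ext
      intro k
      by_cases hk : k = j
      · subst hk; simp
      · simp [hk]
    have h2 := DFunLike.congr_fun h1 E
    simpa [coe_aeval_eq_eval] using h2
  have h0 := MvPolynomial.eq_zero_of_eval_generic (aeval (Function.update X j (C c * X i)) E)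
    fun z hz => (heval z).trans (h z hz)
  have h1 := heval z
  rw [h0, map_zero, ← hz, Function.update_eq_self] at h1
  exact h1.symm

-- Zeros are counted on the hyperplane z_j = q² z_i, by induction on d = j - i. There E is a
-- polynomial in t = z_i of degree at most 2(n - 1). An index outside [i, j] gives one zero, from a
-- wheel; an index strictly between gives two, from closer pairs. For d ≥ 2 these are (2n - d - 1) +
-- 2(d - 1) = 2n + d - 3 > 2(n - 1) zeros.
open MvPolynomial in
theorem MvPolynomial.eq_zero_of_adjacent_of_wheel {n : ℕ} (hn : 1 ≤ n)
    (E : MvPolynomial (Fin (2 * n)) ℂ) (hd : ∀ k, E.degreeOf k ≤ n - 1)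
    (hadj : ∀ z, Function.Injective z → ∀ i j : Fin (2 * n), j.val = i.val + 1 →
      z j = omega3 ^ 2 * z i → eval z E = 0)
    (hwheel : ∀ z, Function.Injective z → ∀ i j k : Fin (2 * n), i < j → j < k →
      z j = omega3 ^ 2 * z i → z k = omega3 ^ 2 * z j → eval z E = 0) : E = 0 := by
  have hq3 := omega3_pow_three
  have hclaim : ∀ d, 1 ≤ d → ∀ i j : Fin (2 * n), j.val = i.val + d → ∀ z,
      z j = omega3 ^ 2 * z i → eval z E = 0 := by
    intro d
    induction d using Nat.strong_induction_on with
    | _ d ih =>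
    intro hd1 i j hij
    have hne : i ≠ j := by rintro rfl; omega
    refine MvPolynomial.eval_eq_zero_of_generic E _ fun z hz => ?_
    rcases Nat.eq_or_lt_of_le hd1 with rfl | hd2
    · refine hadj _ ?_ i j hij (by simp [hne])
      convert! hz.injective_mul (c := Function.update 1 j (omega3 ^ 2))
        (s := Function.update id j i) ?_ ?_ using 1
      · ext a
        by_cases ha : a = j
        · subst ha; simp
        · simp [ha]
      · intro a
        by_cases ha : a = j
        · subst ha; simpa using omega3_sq_pow_three
        · simp [ha]
      · intro a b h1 h2
        have e2 := omega3_sq_ne_one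
        simp only [Function.update_apply, Pi.one_apply, id] at h1 h2
        split_ifs at h1 h2 <;> simp_all
    · set f : Fin (2 * n) → Polynomial ℂ := Function.update (Function.update
        (fun k => Polynomial.C (z k)) i Polynomial.X) j (Polynomial.C (omega3 ^ 2) * Polynomial.X)
        with hf
      have hfe : ∀ t, (fun k => (f k).eval t) =
          Function.update (Function.update z i t) j (omega3 ^ 2 * t) := by
        intro t
        ext k
        by_cases hk : k = j
        · subst hk; simp [hf]
        · by_cases hk' : k = i
          · subst hk'; simp [hf, hk]
          · simp [hf, hk, hk']
      -- A pair (k, c) in `T` stands for the zero t = c * z k. Outside, t = q² z_k completes a wheel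
      -- with k before or after the pair. Inside, t = q z_k means z_k = q² z_i, and t = z_k means
      -- z_j = q² z_k.
      set O : Finset (Fin (2 * n)) := (Finset.Icc i j)ᶜ with hO
      set I : Finset (Fin (2 * n)) := Finset.Ioo i j with hI
      set T : Finset (Fin (2 * n) × ℂ) := O ×ˢ {omega3 ^ 2} ∪ I ×ˢ {omega3, 1} with hT
      have hT3 : ∀ x ∈ T, x.2 ^ 3 = 1 := by
        intro x hx
        simp only [hT, Finset.mem_union, Finset.mem_product, Finset.mem_singleton,
          Finset.mem_insert] at hx
        rcases hx with ⟨-, h⟩ | ⟨-, h | h⟩ <;> rw [h]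
        · exact omega3_sq_pow_three
        · exact hq3
        · exact one_pow 3
      have h0 : aeval f E = 0 := by
        refine Polynomial.eq_zero_of_natDegree_lt_card_of_eval_eq_zero' _
          (T.image fun x => x.2 * z x.1) (fun t ht => ?_) ?_
        · rw [MvPolynomial.eval_aeval_polynomial, hfe]
          obtain ⟨⟨k, c⟩, hx, rfl⟩ := Finset.mem_image.1 ht
          simp only [hT, Finset.mem_union, Finset.mem_product, Finset.mem_singleton,
            Finset.mem_insert, hO, hI, Finset.mem_compl, Finset.mem_Icc, Finset.mem_Ioo,
            not_and_or, not_le] at hx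
          rcases hx with ⟨hk, rfl⟩ | ⟨⟨hik, hkj⟩, rfl | rfl⟩
          · have hij' : i < j := by rw [Fin.lt_def]; omega
            have hki : k ≠ i := by
              rintro rfl
              exact hk.elim (lt_irrefl _) hij'.not_gt
            have hkj : k ≠ j := by
              rintro rfl
              exact hk.elim hij'.not_gt (lt_irrefl _)
            have hinj : Function.Injective (Function.update (Function.update z i
                (omega3 ^ 2 * z k)) j (omega3 ^ 2 * (omega3 ^ 2 * z k))) :=
              hz.injective_update_update hki hkj hne
            rcases hk with hk | hk
            · refine hwheel _ hinj k i j hk hij' ?_ ?_ <;>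
                simp only [Function.update_of_ne hkj, Function.update_of_ne hki,
                  Function.update_of_ne hne, Function.update_self]
            · refine hwheel _ hinj i j k hij' hk ?_ ?_
              · simp only [Function.update_of_ne hne, Function.update_self]
              · simp only [Function.update_of_ne hkj, Function.update_of_ne hki,
                  Function.update_self]
                linear_combination (-omega3 ^ 3 - 1) * z k * hq3
          · refine ih (k.val - i.val) ?_ ?_ i k ?_ _ ?_
            · rw [Fin.lt_def] at hkj hik; omega
            · rw [Fin.lt_def] at hkj hik; omega
            · rw [Fin.lt_def] at hkj hik; omega
            · simp only [Function.update_of_ne hkj.ne, Function.update_of_ne hik.ne',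
                Function.update_of_ne hne, Function.update_self]
              linear_combination (-z k) * hq3
          · refine ih (j.val - k.val) ?_ ?_ k j ?_ _ ?_
            · rw [Fin.lt_def] at hkj hik; omega
            · rw [Fin.lt_def] at hkj hik; omega
            · rw [Fin.lt_def] at hkj hik; omega
            · simp [Function.update_of_ne hkj.ne, Function.update_of_ne hik.ne']
        · rw [Finset.card_image_of_injOn]
          · refine (MvPolynomial.natDegree_aeval_le f E).trans_lt ?_
            have hdeg : ∀ k, E.degreeOf k * (f k).natDegree ≤
                (if k = i then n - 1 else 0) + if k = j then n - 1 else 0 := by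
              intro k
              by_cases hk : k = j
              · subst hk
                rw [if_neg hne.symm, if_pos rfl, zero_add]
                refine (Nat.mul_le_mul (hd k) ?_).trans (mul_one _).le
                simp only [hf, Function.update_self]
                exact (Polynomial.natDegree_C_mul_le _ _).trans Polynomial.natDegree_X_le
              · by_cases hk' : k = i
                · subst hk'
                  simpa [hf, hk] using hd k
                · simp [hf, hk, hk']
            refine (Finset.sum_le_sum fun k _ => hdeg k).trans_lt ?_
            have hcard : T.card = O.card * 1 + I.card * 2 := by
              rw [hT, Finset.card_union_of_disjoint, Finset.card_product, Finset.card_product,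
                Finset.card_singleton, Finset.card_pair omega3_ne_one]
              refine Finset.disjoint_product.2 (Or.inl ?_)
              rw [hO, hI, ← Finset.subset_compl_iff_disjoint_left, compl_compl]
              exact Finset.Ioo_subset_Icc_self
            rw [hcard, hO, hI, Finset.card_compl, Fin.card_Icc, Fin.card_Ioo, Fintype.card_fin,
              Finset.sum_add_distrib]
            simp only [Finset.sum_ite_eq', Finset.mem_univ, if_true]
            have := j.isLt
            omega
          · rintro ⟨k, c⟩ hx ⟨k', c'⟩ hx' hxx
            obtain ⟨h1, h2⟩ := hz.eq_of_mul_eq (hT3 _ hx) (hT3 _ hx') hxx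
            exact Prod.ext h1 h2
      have h1 := congrArg (Polynomial.eval (z i)) h0
      rw [MvPolynomial.eval_aeval_polynomial, hfe, Function.update_eq_self] at h1
      simpa using h1
  have hn0 : 0 < 2 * n := by omega
  -- As a polynomial in its first variable, of degree at most n - 1, E has the 2n - 1 zeros q z_k.
  refine MvPolynomial.eq_zero_of_roots E ⟨0, hn0⟩ (n - 1) (hd _) fun z hz => ?_
  refine ⟨((univ : Finset (Fin (2 * n))).erase ⟨0, hn0⟩).image fun k => omega3 * z k, ?_, ?_⟩
  · rw [Finset.card_image_of_injective, Finset.card_erase_of_mem (Finset.mem_univ _),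
      Finset.card_univ, Fintype.card_fin]
    · omega
    · exact hz.injective_mul (c := fun _ => omega3) (s := id) (fun _ => hq3) fun a b h _ => h
  · intro t ht
    obtain ⟨k, hk, rfl⟩ := Finset.mem_image.1 ht
    have hk0 := Finset.ne_of_mem_erase hk
    refine hclaim k.val ?_ ⟨0, hn0⟩ k (by simp) _ ?_
    · rw [ne_eq, Fin.ext_iff] at hk0
      simp only at hk0
      omega
    · simp only [Function.update_of_ne hk0, Function.update_self]
      linear_combination (-z k) * hq3

end Uniqueness

/-! ### The two polynomials coincide -/

section ContourEqSixVertex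

theorem contourPoly_zero (z : Fin (2 * 0) → ℂ) : MvPolynomial.eval z (contourPoly 0) = 1 := by
  have h := contourZ_eq_eval (n := 0) (z := z) (Γ := Fin.elim0) fun l => l.elim0
  rw [← h]
  simp [contourZ, Contour.iterated, zIntegrand]

/-- By induction, the recursions make the difference vanish for adjacent pairs; the wheel conditions
give the other hypothesis of the uniqueness lemma. -/
theorem contourPoly_eq_sixVertexPoly (n : ℕ) : contourPoly n = sixVertexPoly n := by
  induction n with
  | zero =>
    refine MvPolynomial.funext fun z => ?_
    rw [contourPoly_zero, eval_sixVertexPoly, sixVertexValue_zero]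
  | succ n ih =>
    refine sub_eq_zero.1 (MvPolynomial.eq_zero_of_adjacent_of_wheel (Nat.le_add_left 1 n) _
      (fun k => ?_) (fun z hz i j hij h => ?_) fun z hz i j k hij hjk h1 h2 => ?_)
    · exact (MvPolynomial.degreeOf_sub_le k _ _).trans
        (max_le (degreeOf_contourPoly_le _ k) (degreeOf_sixVertexPoly (n + 1) k).le)
    · obtain ⟨x, rfl⟩ : ∃ x : Fin (2 * n + 1), x.castSucc = i :=
        ⟨⟨i, by omega⟩, rfl⟩
      obtain rfl : x.succ = j := Fin.ext hij.symm
      have hx : x.castSucc.succAbove x = x.succ := by simp [Fin.succAbove]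
      rw [map_sub, contourPoly_recursion x z hz h,
        sixVertexPoly_recursion n z x.castSucc x (by rw [hx]; exact h), ih, sub_eq_zero]
      rfl
    · rw [map_sub, contourPoly_wheel hz hij hjk h1 h2, zero_sub, neg_eq_zero]
      refine sixVertexPoly_wheel _ z hij.ne (hij.trans hjk).ne hjk.ne h1 ?_
      rw [h2, h1]
      linear_combination omega3 * z i * omega3_pow_three

theorem contourZ_eq_eval_sixVertexPoly {n : ℕ} {z : Fin (2 * n) → ℂ} {Γ : Fin n → Contour}
    (hΓ : AdmissibleContours omega3 n z Γ) :
    contourZ omega3 n z Γ = MvPolynomial.eval z (sixVertexPoly n) := by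
  rw [contourZ_eq_eval hΓ, contourPoly_eq_sixVertexPoly]

/-- The point 0 equals its own multiple by q⁻², so it cannot be both enclosed and excluded. -/
theorem AdmissibleContours.ne_zero {n : ℕ} {z : Fin (2 * n) → ℂ} {Γ : Fin n → Contour}
    (hΓ : AdmissibleContours omega3 n z Γ) (i : Fin (2 * n)) : z i ≠ 0 := by
  intro h
  have hn : 0 < n := by have := i.isLt; omega
  have h1 := ((hΓ ⟨0, hn⟩).1 _ (Set.mem_range_self i)).2
  have h2 := ((hΓ ⟨0, hn⟩).2 _ (Set.mem_range_self i)).2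
  simp only [h, mul_zero] at h1 h2
  exact zero_ne_one (h2.symm.trans h1)

end ContourEqSixVertex

/-! ### Integrals with a single enclosed pole -/

section ContourSubstitution

namespace Contour

theorem integral_poleFun_eq_zero {Γ : Contour} (cs : List ℂ)
    (h : ∀ c ∈ cs, Γ.Avoids c ∧ Γ.index c = 0) (k : ℕ) : Γ.integral (poleFun k cs) = 0 := by
  induction k generalizing cs with
  | zero => simpa using integral_poleFun_zero_of_index_eq cs h
  | succ k ih =>
    match cs, h with
    | [], _ => exact integral_poleFun_nil Γ (k + 1)
    | c :: cs, h =>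
      rw [integral_poleFun_succ (fun d hd => (h d hd).1), ih (c :: cs) h,
        ih cs fun d hd => h d (List.mem_cons_of_mem _ hd), mul_zero, add_zero]

/-- The residue formula for a single enclosed pole, which is simple. -/
theorem integral_poleFun_cons {Γ : Contour} {a : ℂ} (ha : Γ.Avoids a) (ha' : Γ.index a = 1)
    (bs : List ℂ) (h : ∀ b ∈ bs, Γ.Avoids b ∧ Γ.index b = 0) (k : ℕ) :
    Γ.integral (poleFun k (a :: bs)) = a ^ k / (bs.map fun b => a - b).prod := by
  induction bs with
  | nil =>
    simp only [List.map_nil, List.prod_nil, div_one]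
    induction k with
    | zero =>
      rw [pow_zero, ← ha', index]
      exact integral_congr fun γ _ t _ => by simp [poleFun]
    | succ k ih => rw [integral_poleFun_succ (by simpa using ha), integral_poleFun_nil, ih]; ring
  | cons b bs ih =>
    have hab : a ≠ b := by
      rintro rfl
      rw [(h a List.mem_cons_self).2] at ha'
      exact zero_ne_one ha'
    have h1 := integral_poleFun_cons_cons (cs := bs) hab (fun d hd => by
      rcases List.mem_cons.1 hd with rfl | hd
      · exact ha
      · exact (h d hd).1) k
    rw [ih fun d hd => h d (List.mem_cons_of_mem _ hd), integral_poleFun_eq_zero (b :: bs) h,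
      sub_zero] at h1
    rw [List.map_cons, List.prod_cons, ← div_div, div_right_comm, ← h1,
      mul_div_cancel_left₀ _ (sub_ne_zero.2 hab)]

open MvPolynomial in
/-- If the first integral evaluates polynomials at `a`, then it can be carried out. -/
theorem iterated_succ_eval_mul {τ : Type*} {n : ℕ} (Γ : Fin (n + 1) → Contour)
    (p : MvPolynomial (Fin (n + 1)) (MvPolynomial τ ℂ)) (z : τ → ℂ) (g : Fin (n + 1) → ℂ → ℂ)
    (hg : ∀ l, (Γ l).ContinuousAlong (g l)) (a C : ℂ)
    (h : ∀ k, (Γ 0).integral (fun x => x ^ k * g 0 x) = C * a ^ k) :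
    iterated (n + 1) Γ (fun w => eval w (map (eval z) p) * ∏ l, g l (w l)) =
      C * iterated n (fun l => Γ l.succ) fun w =>
        eval (Fin.cons a w : Fin (n + 1) → ℂ) (map (eval z) p) * ∏ l, g l.succ (w l) := by
  have h1 : (fun w : Fin n → ℂ => eval (Fin.cons a w : Fin (n + 1) → ℂ) (map (eval z) p) *
      ∏ l, g l.succ (w l)) = fun w => ∑ d ∈ p.support, (eval z (coeff d p) * a ^ d 0) *
        ∏ l : Fin n, (fun x => x ^ d l.succ * g l.succ x) (w l) := by
    ext w
    rw [eval_map, eval₂_eq', Finset.sum_mul]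
    refine Finset.sum_congr rfl fun d _ => ?_
    simp only [Fin.prod_univ_succ, Fin.cons_zero, Fin.cons_succ, Finset.prod_mul_distrib]
    ring
  rw [iterated_eval_mul Γ p z g hg, h1, iterated_sum_prod p.support (fun l => Γ l.succ)
    (fun d => eval z (coeff d p) * a ^ d 0) (fun d l x => x ^ d l.succ * g l.succ x),
    Finset.mul_sum]
  · refine Finset.sum_congr rfl fun d _ => ?_
    rw [Fin.prod_univ_succ, h]
    ring
  · intro d _ l γ hγ
    exact ((continuousAlong_of_continuousAt (Γ := Γ l.succ) (f := fun x => x ^ d l.succ)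
      fun γ _ t _ => by fun_prop) γ hγ).mul (hg l.succ γ hγ)

theorem index_replicate {Γ : Contour} (h : Γ.Avoids 0) (r : ℕ) :
    Γ.integral (fun u => (u ^ r)⁻¹) = if r = 1 then Γ.index 0 else 0 := by
  have h1 := integral_poleFun_zero_of_index_eq (Γ := Γ) (ι := Γ.index 0) (List.replicate r 0)
    fun c hc => by rw [List.eq_of_mem_replicate hc]; exact ⟨h, rfl⟩
  rw [List.length_replicate] at h1
  rw [← h1]
  exact integral_congr fun γ _ t _ => by simp [poleFun]

/-- The value of the integral of `u ^ k / (u ^ m (1 + c u))` around `0`. -/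
def residueAtZero (c : ℂ) (k m : ℕ) : ℂ := if k < m then (-c) ^ (m - 1 - k) else 0

/-- Repeated use of 1 / (u ^ (r + 1) (1 + c u)) = 1 / u ^ (r + 1) - c / (u ^ r (1 + c u)), the
coefficients of a geometric series. For c = 0 the excluded set is empty, which is the case y = 1 of
the theorem. -/
theorem integral_residueAtZero {Γ : Contour} {c : ℂ}
    (h : Γ.Separates {0} {p | 1 + p * c = 0}) (k m : ℕ) :
    Γ.integral (fun u => u ^ k * (u ^ m * (1 + u * c))⁻¹) = residueAtZero c k m := by
  have h0 := h.1 0 rfl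
  have hu : ∀ γ ∈ Γ, ∀ t ∈ Set.Icc (0 : ℝ) 1, γ.toFun t ≠ 0 := h0.1
  have hc : ∀ γ ∈ Γ, ∀ t ∈ Set.Icc (0 : ℝ) 1, 1 + γ.toFun t * c ≠ 0 := fun γ hγ t ht h1 =>
    (h.2 _ h1).1 γ hγ t ht rfl
  have hpow : ∀ j : ℕ, Γ.integral (fun u => u ^ j * (1 + u * c)⁻¹) = 0 := by
    intro j
    by_cases hc0 : c = 0
    · simpa [hc0] using integral_pow Γ j
    · have h1 := h.2 (-c⁻¹) (by simp [hc0])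
      have h2 := integral_poleFun_eq_zero (Γ := Γ) [-c⁻¹] (by simpa using h1) j
      have h3 := integral_const_mul Γ c⁻¹ (poleFun j [-c⁻¹])
      rw [h2, mul_zero] at h3
      rw [← h3]
      refine integral_congr fun γ hγ t ht => ?_
      have h4 := hc γ hγ t ht
      have h5 : γ.toFun t - -c⁻¹ = c⁻¹ * (1 + γ.toFun t * c) := by field_simp; ring
      simp only [poleFun, List.map_cons, List.map_nil, List.prod_cons, List.prod_nil, mul_one, h5]
      field_simp
  have hneg : ∀ r : ℕ, Γ.integral (fun u => (u ^ (r + 1) * (1 + u * c))⁻¹) = (-c) ^ r := by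
    intro r
    have hstep : ∀ r : ℕ, Γ.integral (fun u => (u ^ (r + 1) * (1 + u * c))⁻¹) =
        Γ.integral (fun u => (u ^ (r + 1))⁻¹) +
          (-c) * Γ.integral (fun u => (u ^ r * (1 + u * c))⁻¹) := by
      intro r
      rw [← integral_const_mul, ← integral_add]
      · refine integral_congr fun γ hγ t ht => ?_
        have h4 := hc γ hγ t ht
        have h5 := hu γ hγ t ht
        field_simp
        ring
      · exact continuousAlong_of_continuousAt fun γ hγ t ht =>
          ContinuousAt.inv₀ (by fun_prop) (pow_ne_zero _ (hu γ hγ t ht))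
      · exact continuousAlong_of_continuousAt fun γ hγ t ht => continuousAt_const.mul
          (ContinuousAt.inv₀ (by fun_prop) (mul_ne_zero (pow_ne_zero _ (hu γ hγ t ht))
            (hc γ hγ t ht)))
    induction r with
    | zero =>
      rw [hstep, index_replicate h0.1, if_pos rfl, h0.2]
      have h1 := hpow 0
      simp only [pow_zero, one_mul] at h1 ⊢
      rw [h1, mul_zero, add_zero]
    | succ r ih =>
      rw [hstep, index_replicate h0.1, if_neg (by omega), ih, zero_add, pow_succ']
  rw [residueAtZero]
  split_ifs with hkm
  · rw [← hneg]
    refine integral_congr fun γ hγ t ht => ?_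
    have h5 := hu γ hγ t ht
    obtain ⟨j, rfl⟩ : ∃ j, m = k + (j + 1) := ⟨m - 1 - k, by omega⟩
    rw [pow_add, show k + (j + 1) - 1 - k = j by omega, mul_assoc, mul_inv, ← mul_assoc,
      mul_inv_cancel₀ (pow_ne_zero _ h5), one_mul]
  · rw [← hpow (k - m)]
    refine integral_congr fun γ hγ t ht => ?_
    have h5 := hu γ hγ t ht
    obtain ⟨j, rfl⟩ : ∃ j, k = m + j := ⟨k - m, by omega⟩
    rw [pow_add, show m + j - m = j by omega, mul_inv, mul_mul_mul_comm,
      mul_inv_cancel₀ (pow_ne_zero _ h5), one_mul]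

end Contour

end ContourSubstitution

/-! ### Möbius change of variables -/

section ContourChangeOfVariables

open MeasureTheory in
theorem ClosedCurve.exists_map (γ : ClosedCurve) {φ φ' : ℂ → ℂ}
    (h : ∀ t ∈ Set.Icc (0 : ℝ) 1, HasDerivAt φ (φ' (γ.toFun t)) (γ.toFun t))
    (h' : ContinuousOn (fun t => φ' (γ.toFun t)) (Set.Icc 0 1)) :
    ∃ γ' : ClosedCurve, (∀ t, γ'.toFun t = φ (γ.toFun t)) ∧
      ∀ f, γ'.integral f = γ.integral fun u => f (φ u) * φ' u := by
  obtain ⟨s, hs⟩ := γ.differentiable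
  have hderiv : ∀ t ∈ Set.Ioo (0 : ℝ) 1, t ∉ s →
      HasDerivAt (fun t => φ (γ.toFun t)) (φ' (γ.toFun t) * deriv γ.toFun t) t := fun t ht hts =>
    (h t (Set.Ioo_subset_Icc_self ht)).comp t (hs t ht hts).hasDerivAt
  have hae : ∀ᵐ t ∂(volume : Measure ℝ), t ∈ Set.uIoc (0 : ℝ) 1 →
      φ' (γ.toFun t) * deriv γ.toFun t = deriv (fun t => φ (γ.toFun t)) t := by
    -- The interval of integration contains its right end 1, where differentiability is not assumed.
    have h0 : ∀ᵐ t ∂(volume : Measure ℝ), t ∉ (insert 1 s : Finset ℝ) :=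
      measure_eq_zero_iff_ae_notMem.1 ((insert 1 s : Finset ℝ).finite_toSet.measure_zero volume)
    filter_upwards [h0] with t ht ht'
    rw [Set.uIoc_of_le zero_le_one] at ht'
    rw [Finset.mem_insert, not_or] at ht
    exact (hderiv t ⟨ht'.1, lt_of_le_of_ne ht'.2 ht.1⟩ ht.2).deriv.symm
  refine ⟨⟨fun t => φ (γ.toFun t), fun t ht =>
      (h t ht).continuousAt.comp_continuousWithinAt (γ.continuousOn t ht), by rw [γ.closed],
      ⟨s, fun t ht hts => (hderiv t ht hts).differentiableAt⟩,
      (γ.intervalIntegrable h').congr_ae ((ae_restrict_iff' measurableSet_uIoc).2 hae)⟩,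
    fun t => rfl, fun f => ?_⟩
  unfold ClosedCurve.integral
  refine intervalIntegral.integral_congr_ae ?_
  filter_upwards [hae] with t ht ht'
  rw [← ht ht', mul_assoc]

namespace Contour

/-- The image of a contour under a holomorphic map, and the change of variables in an integral. -/
theorem exists_map (Γ : Contour) {φ φ' : ℂ → ℂ}
    (h : ∀ γ ∈ Γ, ∀ t ∈ Set.Icc (0 : ℝ) 1, HasDerivAt φ (φ' (γ.toFun t)) (γ.toFun t))
    (h' : Γ.ContinuousAlong φ') :
    ∃ Γ' : Contour, (∀ γ' ∈ Γ', ∃ γ ∈ Γ, ∀ t, γ'.toFun t = φ (γ.toFun t)) ∧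
      ∀ f, Γ'.integral f = Γ.integral fun u => f (φ u) * φ' u := by
  induction Γ with
  | nil => exact ⟨[], by simp, fun f => by simp [integral]⟩
  | cons γ Γ ih =>
    obtain ⟨γ', h1, h2⟩ := γ.exists_map (h γ List.mem_cons_self) (h' γ List.mem_cons_self)
    obtain ⟨Γ', h3, h4⟩ := ih (fun γ hγ => h γ (List.mem_cons_of_mem _ hγ))
      fun γ hγ => h' γ (List.mem_cons_of_mem _ hγ)
    refine ⟨γ' :: Γ', ?_, fun f => ?_⟩
    · intro δ hδ
      rcases List.mem_cons.1 hδ with rfl | hδ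
      · exact ⟨γ, List.mem_cons_self, h1⟩
      · obtain ⟨δ', h5, h6⟩ := h3 δ hδ
        exact ⟨δ', List.mem_cons_of_mem _ h5, h6⟩
    · have h5 := h4 f
      simp only [integral, List.map_cons, List.sum_cons, mul_add] at h5 ⊢
      rw [h5, h2]

theorem iterated_map {Γ Γ' : Contour} {φ φ' : ℂ → ℂ}
    (h : ∀ f, Γ'.integral f = Γ.integral fun u => f (φ u) * φ' u) {n : ℕ} (f : (Fin n → ℂ) → ℂ) :
    iterated n (fun _ => Γ') f =
      iterated n (fun _ => Γ) fun u => f (fun l => φ (u l)) * ∏ l, φ' (u l) := by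
  induction n with
  | zero =>
    simp only [iterated, Finset.univ_eq_empty, Finset.prod_empty, mul_one]
    congr 1
    ext l
    exact l.elim0
  | succ n ih =>
    simp only [iterated, h, ih]
    congr 1
    ext u
    rw [mul_comm, ← contour_iterated_const_mul]
    congr 1
    ext v
    rw [Fin.prod_univ_succ]
    simp only [Fin.cons_zero, Fin.cons_succ]
    have : (fun l : Fin (n + 1) => φ ((Fin.cons u v : Fin (n + 1) → ℂ) l)) =
        Fin.cons (φ u) fun l => φ (v l) := by
      ext l
      refine Fin.cases ?_ (fun l => ?_) l <;> simp
    rw [this]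
    ring

/-- The Möbius map that takes `(w - 1) / (q w - q⁻¹)` to `w`. -/
def moebius (u : ℂ) : ℂ := (1 - omega3⁻¹ * u) / (1 - omega3 * u)

/-- The derivative of `moebius`. -/
def moebiusDeriv (u : ℂ) : ℂ := (omega3 - omega3⁻¹) / (1 - omega3 * u) ^ 2

/-- The inverse of `moebius`. -/
def moebiusInv (w : ℂ) : ℂ := (w - 1) / (omega3 * w - omega3⁻¹)

theorem one_sub_omega3_mul_ne_zero {u : ℂ} (hu : u ≠ omega3⁻¹) : 1 - omega3 * u ≠ 0 := by
  intro h
  exact hu (eq_inv_of_mul_eq_one_right (by linear_combination -h))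

theorem hasDerivAt_moebius {u : ℂ} (hu : u ≠ omega3⁻¹) :
    HasDerivAt moebius (moebiusDeriv u) u := by
  have h0 := one_sub_omega3_mul_ne_zero hu
  have h1 : HasDerivAt (fun u : ℂ => 1 - omega3⁻¹ * u) (-omega3⁻¹) u := by
    simpa using ((hasDerivAt_id u).const_mul omega3⁻¹).const_sub 1
  have h2 : HasDerivAt (fun u : ℂ => 1 - omega3 * u) (-omega3) u := by
    simpa using ((hasDerivAt_id u).const_mul omega3).const_sub 1
  convert! h1.div h2 h0 using 1
  rw [moebiusDeriv]
  ring

theorem continuousAt_moebiusDeriv {u : ℂ} (hu : u ≠ omega3⁻¹) : ContinuousAt moebiusDeriv u :=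
  ContinuousAt.div (by fun_prop) (by fun_prop) (pow_ne_zero _ (one_sub_omega3_mul_ne_zero hu))

theorem omega3_sub_inv_ne_zero : omega3 - omega3⁻¹ ≠ 0 := by
  have := omega3Diff_ne_zero
  rw [omega3Diff] at this
  intro h
  exact this (by linear_combination -h)

theorem omega3_mul_sub_inv_ne_zero {w : ℂ} (hw : w ≠ omega3) : omega3 * w - omega3⁻¹ ≠ 0 := by
  intro h
  apply hw
  rw [omega3_inv] at h
  exact mul_left_cancel₀ omega3_ne_zero (by linear_combination h)

theorem moebiusInv_ne (w : ℂ) : moebiusInv w ≠ omega3⁻¹ := by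
  by_cases hw : w = omega3
  · rw [moebiusInv, hw, omega3_inv, ← sq, sub_self, div_zero]
    exact (pow_ne_zero 2 omega3_ne_zero).symm
  · intro h
    rw [moebiusInv, div_eq_iff (omega3_mul_sub_inv_ne_zero hw), omega3_inv] at h
    have h1 : omega3 = 1 := by
      linear_combination h + (w - omega3) * omega3_pow_three
    exact omega3_ne_one h1

theorem moebius_moebiusInv {w : ℂ} (hw : w ≠ omega3) : moebius (moebiusInv w) = w := by
  have h0 := omega3_mul_sub_inv_ne_zero hw
  have h1 := one_sub_omega3_mul_ne_zero (moebiusInv_ne w)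
  have h2 : moebiusInv w * (omega3 * w - omega3⁻¹) = w - 1 := div_mul_cancel₀ _ h0
  rw [moebius, div_eq_iff h1]
  linear_combination h2

theorem moebius_sub_moebius {u v : ℂ} (hu : u ≠ omega3⁻¹) (hv : v ≠ omega3⁻¹) :
    moebius u - moebius v =
      (omega3 - omega3⁻¹) * (u - v) / ((1 - omega3 * u) * (1 - omega3 * v)) := by
  have h1 := one_sub_omega3_mul_ne_zero hu
  have h2 := one_sub_omega3_mul_ne_zero hv
  rw [moebius, moebius, div_sub_div _ _ h1 h2]
  congr 1
  ring

theorem moebius_ne {u : ℂ} (hu : u ≠ omega3⁻¹) : moebius u ≠ omega3 := by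
  intro h
  rw [moebius, div_eq_iff (one_sub_omega3_mul_ne_zero hu), omega3_inv] at h
  exact omega3_ne_one (by linear_combination -h)

/-- Images of contours under `moebius`. -/
theorem exists_moebius_map {Γ : Contour} (hΓ : Γ.Avoids omega3⁻¹)
    (hΓ' : Γ.index omega3⁻¹ = 0) : ∃ Γ' : Contour,
      (∀ f, Γ'.integral f = Γ.integral fun u => f (moebius u) * moebiusDeriv u) ∧
      (Γ'.Avoids omega3 ∧ Γ'.index omega3 = 0) ∧
      ∀ w, w ≠ omega3 → Γ.Avoids (moebiusInv w) →
        Γ'.Avoids w ∧ Γ'.index w = Γ.index (moebiusInv w) := by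
  obtain ⟨Γ', h1, h2⟩ := Γ.exists_map
    (fun γ hγ t ht => hasDerivAt_moebius (hΓ γ hγ t ht))
    (continuousAlong_of_continuousAt fun γ hγ t ht => continuousAt_moebiusDeriv (hΓ γ hγ t ht))
  have hcont : ∀ a, Γ.Avoids a → Γ.ContinuousAlong fun u => (u - a)⁻¹ := fun a ha =>
    continuousAlong_of_continuousAt fun γ hγ t ht =>
      ContinuousAt.inv₀ (by fun_prop) (sub_ne_zero.2 (ha γ hγ t ht))
  refine ⟨Γ', h2, ⟨fun γ' hγ' t ht => ?_, ?_⟩, fun w hw hav => ⟨fun γ' hγ' t ht => ?_, ?_⟩⟩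
  · obtain ⟨γ, hγ, h3⟩ := h1 γ' hγ'
    rw [h3]
    exact moebius_ne (hΓ γ hγ t ht)
  -- The point q is the image of infinity, so the logarithmic derivative of `moebius u - q` has only
  -- the pole q⁻¹, with residue -1.
  · rw [index, h2, ← neg_eq_zero, ← hΓ', index, ← neg_one_mul, ← integral_const_mul]
    refine integral_congr fun γ hγ t ht => ?_
    have h4 := one_sub_omega3_mul_ne_zero (hΓ γ hγ t ht)
    have h5 : moebius (γ.toFun t) - omega3 = (1 - omega3) / (1 - omega3 * γ.toFun t) := by
      rw [moebius, omega3_inv]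
      field_simp
      ring
    have h6 : γ.toFun t - omega3⁻¹ = -omega3⁻¹ * (1 - omega3 * γ.toFun t) := by
      have := omega3_ne_zero
      field_simp
      ring
    have h7 : 1 - omega3 ≠ 0 := sub_ne_zero.2 omega3_ne_one.symm
    rw [h5, h6, moebiusDeriv, mul_inv, inv_div]
    have h8 : omega3 - omega3⁻¹ = omega3 * (1 - omega3) := by rw [omega3_inv]; ring
    rw [h8, inv_neg, inv_inv]
    field_simp
  · obtain ⟨γ, hγ, h3⟩ := h1 γ' hγ'
    rw [h3, ← sub_ne_zero, ← moebius_moebiusInv hw,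
      moebius_sub_moebius (hΓ γ hγ t ht) (moebiusInv_ne w)]
    exact div_ne_zero (mul_ne_zero omega3_sub_inv_ne_zero (sub_ne_zero.2 (hav γ hγ t ht)))
      (mul_ne_zero (one_sub_omega3_mul_ne_zero (hΓ γ hγ t ht))
        (one_sub_omega3_mul_ne_zero (moebiusInv_ne w)))
  -- The logarithmic derivative of `moebius u - w` has residue 1 at the preimage of w and -1 at q⁻¹,
  -- around which the index is zero.
  · have h3 := integral_add (g := fun u => -1 * (u - omega3⁻¹)⁻¹) (hcont _ hav) fun γ hγ =>
      continuousOn_const.mul (hcont _ hΓ γ hγ)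
    rw [integral_const_mul, ← index, ← index, hΓ', mul_zero, add_zero] at h3
    rw [index, h2, ← h3]
    refine integral_congr fun γ hγ t ht => ?_
    have h4 := one_sub_omega3_mul_ne_zero (hΓ γ hγ t ht)
    have h5 := one_sub_omega3_mul_ne_zero (moebiusInv_ne w)
    have h6 := sub_ne_zero.2 (hav γ hγ t ht)
    have h7 := omega3_sub_inv_ne_zero
    have h8 : γ.toFun t - omega3⁻¹ = -omega3⁻¹ * (1 - omega3 * γ.toFun t) := by
      have := omega3_ne_zero
      field_simp
      ring
    have h9 : moebius (γ.toFun t) - w = (omega3 - omega3⁻¹) * (γ.toFun t - moebiusInv w) /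
        ((1 - omega3 * γ.toFun t) * (1 - omega3 * moebiusInv w)) := by
      conv_lhs => rw [← moebius_moebiusInv hw]
      exact moebius_sub_moebius (hΓ γ hγ t ht) (moebiusInv_ne w)
    rw [h9, h8, moebiusDeriv, mul_inv, inv_neg, inv_inv, inv_div]
    generalize omega3 - omega3⁻¹ = κ at h7 ⊢
    field_simp
    ring

end Contour

end ContourChangeOfVariables

/-! ### The integral at the parameters α, 1, …, 1, β -/

section EdgeParameters

theorem omega3_zpow_neg_two : omega3 ^ (-2 : ℤ) = omega3 := by
  rw [zpow_neg, zpow_ofNat]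
  refine inv_eq_of_mul_eq_one_right ?_
  rw [← pow_succ, omega3_pow_three]

/-- The first integral in `contourZ` is the residue at `z 0`. -/
theorem iterated_zIntegrand_succ {n : ℕ} {z : Fin (2 * (n + 1)) → ℂ} {Γ : Fin (n + 1) → Contour}
    (hΓ : AdmissibleContours omega3 (n + 1) z Γ) :
    Contour.iterated (n + 1) Γ (zIntegrand omega3 (n + 1) z) =
      (∏ i, qSub (z 0) (z i))⁻¹ * Contour.iterated n (fun l => Γ l.succ) fun w =>
        zNumeratorValue (n + 1) z (Fin.cons (z 0) w : Fin (n + 1) → ℂ) *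
          ∏ l : Fin n, ((∏ i with i.val ≤ 2 * (l.val + 1), (w l - z i)) *
            ∏ i with 2 * (l.val + 1) ≤ i.val, qSub (w l) (z i))⁻¹ := by
  have hav : ∀ l i, (Γ l).Avoids (z i) ∧ (Γ l).index (z i) = 1 := fun l i =>
    (hΓ l).1 _ (Set.mem_range_self i)
  have hav' : ∀ l i, (Γ l).Avoids (omega3 * z i) ∧ (Γ l).index (omega3 * z i) = 0 := fun l i =>
    (hΓ l).2 _ ⟨i, by simp only [omega3_zpow_neg_two]⟩
  set g : Fin (n + 1) → ℂ → ℂ := fun l x => ((∏ i with i.val ≤ 2 * l.val, (x - z i)) *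
    ∏ i with 2 * l.val ≤ i.val, qSub x (z i))⁻¹ with hg
  have h := Contour.iterated_succ_eval_mul Γ (zNumerator (n + 1)) z g ?_ (z 0)
    (∏ i, qSub (z 0) (z i))⁻¹ ?_
  · simp only [eval_zNumerator] at h
    have h1 : zIntegrand omega3 (n + 1) z = fun w => zNumeratorValue (n + 1) z w *
        ∏ l, g l (w l) := by
      ext w
      rw [zIntegrand, zNumeratorValue, ← Finset.prod_mul_distrib]
      rfl
    rw [h1, h]
    rfl
  · intro l
    refine Contour.continuousAlong_of_continuousAt fun γ hγ t ht => ContinuousAt.inv₀ ?_ ?_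
    · unfold qSub
      fun_prop
    · refine mul_ne_zero (Finset.prod_ne_zero_iff.2 fun i _ => ?_)
        (Finset.prod_ne_zero_iff.2 fun i _ => ?_)
      · exact sub_ne_zero.2 ((hav l i).1 γ hγ t ht)
      · rw [qSub_eq_mul]
        exact mul_ne_zero omega3_ne_zero (sub_ne_zero.2 ((hav' l i).1 γ hγ t ht))
  · intro k
    have h1 := Contour.integral_poleFun_cons (hav 0 0).1 (hav 0 0).2
      ((univ : Finset (Fin (2 * (n + 1)))).toList.map fun i => omega3 * z i) (by
        intro b hb
        obtain ⟨i, -, rfl⟩ := List.mem_map.1 hb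
        exact hav' 0 i) k
    have h2 := Contour.integral_const_mul (Γ 0) (∏ _i : Fin (2 * (n + 1)), omega3)⁻¹
      (Contour.poleFun k (z 0 :: (univ : Finset (Fin (2 * (n + 1)))).toList.map
        fun i => omega3 * z i))
    rw [h1] at h2
    simp only [Contour.poleFun, List.map_cons, List.prod_cons, List.map_map, Function.comp_def,
      Finset.prod_map_toList] at h2
    have h3 : (∏ i, qSub (z 0) (z i)) = (∏ _i : Fin (2 * (n + 1)), omega3) *
        ∏ i, (z 0 - omega3 * z i) := by
      simp only [qSub_eq_mul, Finset.prod_mul_distrib]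
    rw [h3, mul_inv, mul_comm (_ * _) (z 0 ^ k), mul_left_comm, ← div_eq_mul_inv, ← h2]
    congr 1
    ext x
    -- The first variable has the single enclosed pole z_0, and all indices give excluded poles.
    have h4 : (univ.filter fun i : Fin (2 * (n + 1)) => i.val ≤ 2 * (0 : Fin (n + 1)).val) = {0} := by
      ext i
      simp only [Fin.val_zero, mul_zero, Nat.le_zero, Finset.mem_filter, Finset.mem_univ, true_and,
        Finset.mem_singleton]
      exact Fin.val_eq_zero_iff
    have h5 : (univ.filter fun i : Fin (2 * (n + 1)) => 2 * (0 : Fin (n + 1)).val ≤ i.val) =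
        univ := by
      ext i
      simp
    simp only [hg, h4, h5, Finset.prod_singleton, qSub_eq_mul, Finset.prod_mul_distrib]
    rw [div_eq_mul_inv, mul_inv, mul_inv, mul_inv]
    ring

/-- The parameters `α, 1, …, 1, β`. -/
def edgeParams (n : ℕ) (α β : ℂ) (i : Fin (2 * (n + 1))) : ℂ :=
  if i.val = 0 then α else if i.val = 2 * n + 1 then β else 1

theorem prod_edgeParams {n : ℕ} (α β : ℂ) (f : Fin (2 * (n + 1)) → ℂ → ℂ) :
    ∏ i, f i (edgeParams n α β i) = f 0 α * ((∏ k : Fin (2 * n), f k.castSucc.succ 1) *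
      f (Fin.last (2 * n + 1)) β) := by
  have h := Fin.prod_univ_succ (n := 2 * n + 1) fun i => f i (edgeParams n α β i)
  rw [Fin.prod_univ_castSucc fun i : Fin (2 * n + 1) => f i.succ (edgeParams n α β i.succ)] at h
  refine h.trans ?_
  have h1 : ∀ k : Fin (2 * n), edgeParams n α β k.castSucc.succ = 1 := by
    intro k
    have := k.isLt
    simp only [edgeParams, Fin.val_succ, Fin.val_castSucc]
    rw [if_neg (by omega), if_neg (by omega)]
  have h2 : edgeParams n α β (Fin.last (2 * n)).succ = β := by
    simp [edgeParams]
  simp only [h1, h2]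
  rfl

theorem Fin.card_filter_val_lt' {N b : ℕ} (hb : b ≤ N) : #{k : Fin N | k.val < b} = b := by
  rw [Fin.card_filter_val_lt, min_eq_right hb]

/-- Here l numbers the variables that remain after the first integration, hence the shift to l + 1.
The last parameter never is an enclosed pole of the integrand. -/
theorem prod_inner_edgeParams {n : ℕ} (α β w : ℂ) (l : Fin n) :
    ∏ i with i.val ≤ 2 * (l.val + 1), (w - edgeParams n α β i) =
      (w - α) * (w - 1) ^ (2 * l.val + 2) := by
  have hl := l.isLt
  rw [Finset.prod_filter, prod_edgeParams α β fun i c => if i.val ≤ 2 * (l.val + 1) then w - c else 1,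
    if_pos (by simp), if_neg (by simp only [Fin.val_last]; omega), mul_one,
    ← Finset.prod_filter, Finset.prod_const]
  congr 2
  rw [← Fin.card_filter_val_lt' (N := 2 * n) (b := 2 * l.val + 2) (by omega)]
  refine congrArg Finset.card (Finset.filter_congr fun k _ => ?_)
  simp only [Fin.val_succ, Fin.val_castSucc]
  omega

theorem prod_outer_edgeParams {n : ℕ} (α β w : ℂ) (l : Fin n) :
    ∏ i with 2 * (l.val + 1) ≤ i.val, qSub w (edgeParams n α β i) =
      qSub w 1 ^ (2 * n - (2 * l.val + 1)) * qSub w β := by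
  have hl := l.isLt
  rw [Finset.prod_filter,
    prod_edgeParams α β fun i c => if 2 * (l.val + 1) ≤ i.val then qSub w c else 1,
    if_neg (by simp), if_pos (by simp only [Fin.val_last]; omega), one_mul,
    ← Finset.prod_filter, Finset.prod_const]
  congr 2
  have h1 := Fin.card_filter_val_lt' (N := 2 * n) (b := 2 * l.val + 1) (by omega)
  have h2 := Finset.card_filter_add_card_filter_not (s := (univ : Finset (Fin (2 * n))))
    fun k => k.val < 2 * l.val + 1
  rw [h1, Finset.card_univ, Fintype.card_fin] at h2
  refine (congrArg Finset.card (Finset.filter_congr fun k _ => ?_)).trans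
    (Nat.sub_eq_of_eq_add' h2.symm).symm
  simp only [Fin.val_succ, Fin.val_castSucc]
  omega

theorem Fin.prod_pairs_mul {M : Type*} [CommMonoid M] {n : ℕ} (d : Fin n → M) :
    ∏ l, ∏ m with l < m, (d l * d m) = ∏ l, d l ^ (n - 1) := by
  induction n with
  | zero => simp
  | succ n ih =>
    rw [Fin.prod_univ_succ, Fin.prod_univ_succ]
    simp only [Finset.prod_filter, Fin.prod_univ_succ, Fin.succ_pos, if_true, lt_self_iff_false,
      if_false, one_mul, Fin.not_lt_zero, Fin.succ_lt_succ_iff]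
    simp only [← Finset.prod_filter, ih fun l => d l.succ]
    rw [Finset.prod_mul_distrib, Finset.prod_const, Finset.card_univ, Fintype.card_fin, mul_assoc,
      ← Finset.prod_mul_distrib]
    congr 1
    refine Finset.prod_congr rfl fun l _ => ?_
    have := l.isLt
    rw [← pow_succ']
    congr 1
    omega

theorem Fin.prod_pairs_const {M : Type*} [CommMonoid M] (n : ℕ) (c : M) :
    ∏ l : Fin n, ∏ m with l < m, c = c ^ n.choose 2 := by
  induction n with
  | zero => simp
  | succ n ih =>
    rw [Fin.prod_univ_succ]
    simp only [Finset.prod_filter, Fin.prod_univ_succ, Fin.succ_pos, if_true, lt_self_iff_false,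
      if_false, one_mul, Fin.not_lt_zero, Fin.succ_lt_succ_iff]
    simp only [← Finset.prod_filter, ih]
    rw [Finset.prod_const, Finset.card_univ, Fintype.card_fin, Nat.choose_succ_succ' n 1,
      Nat.choose_one_right, pow_add]

/-- The residue in the first variable divides by a product over all i, whereas the prefactor lacks i
= 0. The factor `qSub α α` that completes it is present in the numerator. -/
theorem zPrefactor_edgeParams (n : ℕ) (α β : ℂ) :
    qSub α α * zPrefactor (n + 1) (edgeParams n α β) =
      (∏ i, qSub α (edgeParams n α β i)) *
        ((omega3 - omega3⁻¹) ^ (2 * n).choose 2 * qSub 1 β ^ (2 * n)) := by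
  have hone : qSub (1 : ℂ) 1 = omega3 - omega3⁻¹ := by rw [qSub_def, mul_one, mul_one]
  have h1 := prod_edgeParams (n := n) α β fun i c => ∏ j, if i.val < j.val then
    qSub c (edgeParams n α β j) else 1
  have h2 : ∀ k : Fin (2 * n), (∏ j, if k.val + 1 < j.val then qSub 1 (edgeParams n α β j) else 1) =
      (∏ m with k < m, (omega3 - omega3⁻¹)) * qSub 1 β := by
    intro k
    have hk := k.isLt
    rw [prod_edgeParams α β fun j c => if k.val + 1 < j.val then qSub 1 c else 1, hone,
      if_neg (by simp), one_mul, Finset.prod_filter]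
    congr 1
    · refine Finset.prod_congr rfl fun m _ => ?_
      simp only [Fin.lt_def, Fin.val_succ, Fin.val_castSucc, add_lt_add_iff_right]
    · rw [if_pos]
      simp only [Fin.val_last]
      omega
  have h3 : (∏ j, if 2 * n + 1 < j.val then qSub β (edgeParams n α β j) else 1) = 1 :=
    Finset.prod_eq_one fun j _ => if_neg (by omega)
  have h4 : qSub α α * (∏ j : Fin (2 * (n + 1)), if 0 < j.val then
      qSub α (edgeParams n α β j) else 1) = ∏ i, qSub α (edgeParams n α β i) := by
    rw [prod_edgeParams α β fun j c => if 0 < j.val then qSub α c else 1,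
      prod_edgeParams α β fun _ c => qSub α c]
    simp
  simp only [Fin.val_succ, Fin.val_castSucc, Fin.val_last, Fin.val_zero, h2, h3,
    Finset.prod_mul_distrib, mul_one] at h1
  rw [Fin.prod_pairs_const, Finset.prod_const, Finset.card_univ, Fintype.card_fin] at h1
  rw [← h4, mul_assoc]
  refine congrArg (qSub α α * ·) (Eq.trans ?_ h1)
  refine Finset.prod_congr rfl fun i _ => ?_
  rw [Finset.prod_filter]
  rfl

end EdgeParameters

/-! ### Transformation into the integral for alternating sign matrices -/

section EdgeIntegral

theorem zNumeratorValue_edgeParams {n : ℕ} (α β : ℂ) (w : Fin n → ℂ) :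
    zNumeratorValue (n + 1) (edgeParams n α β) (Fin.cons α w : Fin (n + 1) → ℂ) =
      qSub α α * (∏ l, ((w l - α) * qSub α (w l))) *
        ∏ l, (qSub 1 (w l) * ∏ m with l < m, ((w m - w l) * qSub (w l) (w m))) := by
  have h0 : edgeParams n α β ⟨2 * (0 : Fin (n + 1)).val, by simp⟩ = α := by simp [edgeParams]
  have h1 : ∀ l : Fin n, edgeParams n α β ⟨2 * l.succ.val, by omega⟩ = 1 := by
    intro l
    have := l.isLt
    simp only [edgeParams, Fin.val_succ]
    rw [if_neg (by omega), if_neg (by omega)]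
  rw [zNumeratorValue, Fin.prod_univ_succ]
  simp only [h0, h1, Fin.cons_zero, Fin.cons_succ, Finset.prod_filter, Fin.prod_univ_succ,
    Fin.succ_pos, if_true, lt_self_iff_false, if_false, one_mul, Fin.not_lt_zero,
    Fin.succ_lt_succ_iff]
  rfl

/-- The factor of one variable, with d = 1 - q u, v = w - α and e the derivative of w. The cross
factors contribute e to the power n - 1 and the change of variables one more; all powers of d
cancel. -/
theorem edgeIntegrand_local {κ d e A B X Y u v : ℂ} (n l : ℕ) (hl : l < n) (hκ : κ ≠ 0)
    (hd : d ≠ 0) (hB : B ≠ 0) (hY : Y ≠ 0) (hu : u ≠ 0) (hv : v ≠ 0) (he : e = κ / d ^ 2) :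
    (v * (A * X / d)) * (κ * (1 + u) / d) * (v * (κ * u / d) ^ (2 * l + 2) *
        ((κ / d) ^ (2 * n - (2 * l + 1)) * (B * Y / d)))⁻¹ * (e ^ (n - 1) * e) =
      A / (B * κ ^ n) * ((1 + u) * X / (u ^ (2 * l + 2) * Y)) := by
  have h1 : (κ * u / d) ^ (2 * l + 2) * (κ / d) ^ (2 * n - (2 * l + 1)) =
      u ^ (2 * l + 2) * (κ ^ n * κ ^ n * κ / (d ^ n * d ^ n * d)) := by
    have h2 : κ ^ n * κ ^ n * κ / (d ^ n * d ^ n * d) = (κ / d) ^ (2 * n + 1) := by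
      rw [div_pow]; ring
    rw [h2, show 2 * n + 1 = (2 * l + 2) + (2 * n - (2 * l + 1)) by omega, pow_add, mul_div_right_comm,
      mul_pow]
    ring
  have h3 : e ^ (n - 1) * e = κ ^ n / (d ^ n * d ^ n) := by
    rw [← pow_succ, Nat.sub_add_cancel (by omega), he, div_pow]
    ring
  have h4 : ∀ P Q R : ℂ, v * P * (Q * R) = v * (P * Q) * R := fun P Q R => by ring
  rw [h3, h4, h1]
  have hκn := pow_ne_zero n hκ
  have hdn := pow_ne_zero n hd
  have hul := pow_ne_zero (2 * l + 2) hu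
  generalize κ ^ n = K at *
  generalize d ^ n = D at *
  generalize u ^ (2 * l + 2) = U at *
  field_simp

theorem moebius_eq {u : ℂ} (hu : u ≠ omega3⁻¹) (a b : ℂ) :
    a * Contour.moebius u + b =
      (a * (1 - omega3⁻¹ * u) + b * (1 - omega3 * u)) / (1 - omega3 * u) := by
  have h := Contour.one_sub_omega3_mul_ne_zero hu
  rw [Contour.moebius]
  field_simp

/-- In the coordinate u the pole w = 1 moves to 0 and the pole w = q⁻² to infinity, so q w - q⁻¹
contributes no pole. The conditions `hx` and `hy` say which x and y belong to α and β: the factor q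
α - q⁻¹ w becomes a multiple of 1 + x u, and q w - q⁻¹ β one of 1 + u (1 - y). -/
theorem edgeIntegrand_eq {n : ℕ} {α β x y : ℂ} {u : Fin n → ℂ}
    (hx : omega3 - omega3 ^ 2 * α = x * (omega3 * α - omega3⁻¹))
    (hy : β - 1 = (1 - y) * (omega3 - omega3⁻¹ * β)) (hB : omega3 - omega3⁻¹ * β ≠ 0)
    (hu : ∀ l, u l ≠ omega3⁻¹) (hu0 : ∀ l, u l ≠ 0) (huα : ∀ l, Contour.moebius (u l) ≠ α)
    (huy : ∀ l, 1 + u l * (1 - y) ≠ 0) :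
    (zNumeratorValue (n + 1) (edgeParams n α β)
        (Fin.cons α fun l => Contour.moebius (u l) : Fin (n + 1) → ℂ) *
      ∏ l : Fin n, ((∏ i with i.val ≤ 2 * (l.val + 1),
          (Contour.moebius (u l) - edgeParams n α β i)) *
        ∏ i with 2 * (l.val + 1) ≤ i.val,
          qSub (Contour.moebius (u l)) (edgeParams n α β i))⁻¹) *
        ∏ l, Contour.moebiusDeriv (u l) =
      qSub α α * ((omega3 * α - omega3⁻¹) / ((omega3 - omega3⁻¹ * β) *
        (omega3 - omega3⁻¹) ^ n)) ^ n * asmIntegrand n x y u := by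
  have hq3 := omega3_pow_three
  have hqi := omega3_inv
  set κ := omega3 - omega3⁻¹ with hκ
  set A := omega3 * α - omega3⁻¹ with hA
  set B := omega3 - omega3⁻¹ * β with hB'
  have hκ0 : κ ≠ 0 := Contour.omega3_sub_inv_ne_zero
  have hd : ∀ l, 1 - omega3 * u l ≠ 0 := fun l => Contour.one_sub_omega3_mul_ne_zero (hu l)
  have e1 : ∀ l, qSub α (Contour.moebius (u l)) = A * (1 + x * u l) / (1 - omega3 * u l) := by
    intro l
    rw [qSub_def, show omega3 * α - omega3⁻¹ * Contour.moebius (u l) =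
      -omega3⁻¹ * Contour.moebius (u l) + omega3 * α by ring, moebius_eq (hu l)]
    congr 1
    have hx' : A + A * x * u l = omega3 * α - omega3⁻¹ + (omega3 - omega3 ^ 2 * α) * u l := by
      rw [hx, hA]; ring
    rw [mul_add, mul_one, ← mul_assoc, hx', hqi]
    linear_combination omega3 * u l * hq3
  have e2 : ∀ l, qSub 1 (Contour.moebius (u l)) = κ * (1 + u l) / (1 - omega3 * u l) := by
    intro l
    rw [qSub_def, show omega3 * 1 - omega3⁻¹ * Contour.moebius (u l) =
      -omega3⁻¹ * Contour.moebius (u l) + omega3 by ring, moebius_eq (hu l), hκ, hqi]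
    congr 1
    linear_combination omega3 * u l * hq3
  have e3 : ∀ l, Contour.moebius (u l) - 1 = κ * u l / (1 - omega3 * u l) := by
    intro l
    rw [show Contour.moebius (u l) - 1 = 1 * Contour.moebius (u l) + -1 by ring,
      moebius_eq (hu l), hκ]
    congr 1
    ring
  have e4 : ∀ l, qSub (Contour.moebius (u l)) 1 = κ / (1 - omega3 * u l) := by
    intro l
    rw [qSub_def, show omega3 * Contour.moebius (u l) - omega3⁻¹ * 1 =
      omega3 * Contour.moebius (u l) + -omega3⁻¹ by ring, moebius_eq (hu l), hκ]
    congr 1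
    ring
  have e5 : ∀ l, qSub (Contour.moebius (u l)) β = B * (1 + u l * (1 - y)) / (1 - omega3 * u l) := by
    intro l
    rw [qSub_def, show omega3 * Contour.moebius (u l) - omega3⁻¹ * β =
      omega3 * Contour.moebius (u l) + -omega3⁻¹ * β by ring, moebius_eq (hu l)]
    congr 1
    have : B * (1 + u l * (1 - y)) = B + u l * (β - 1) := by rw [hy]; ring
    rw [this, hB', hqi]
    linear_combination (-u l + u l * β) * hq3
  have e6 : ∀ l m, (Contour.moebius (u m) - Contour.moebius (u l)) *
      qSub (Contour.moebius (u l)) (Contour.moebius (u m)) =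
      (Contour.moebiusDeriv (u l) * Contour.moebiusDeriv (u m)) *
        ((u m - u l) * (1 + u m + u m * u l)) := by
    intro l m
    have hdl := hd l
    have hdm := hd m
    have h1 : qSub (Contour.moebius (u l)) (Contour.moebius (u m)) = κ * (1 + u m + u m * u l) /
        ((1 - omega3 * u l) * (1 - omega3 * u m)) := by
      rw [qSub_def, Contour.moebius, Contour.moebius, ← mul_div_assoc, ← mul_div_assoc,
        div_sub_div _ _ hdl hdm, hκ, hqi]
      congr 1
      linear_combination (omega3 * u m - omega3 ^ 2 * u l * u m + omega3 * u l * u m) * hq3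
    rw [Contour.moebius_sub_moebius (hu m) (hu l), h1, Contour.moebiusDeriv, Contour.moebiusDeriv,
      ← hκ]
    field_simp
  have e7 : ∏ l, ∏ m with l < m, ((Contour.moebius (u m) - Contour.moebius (u l)) *
      qSub (Contour.moebius (u l)) (Contour.moebius (u m))) =
      (∏ l, Contour.moebiusDeriv (u l) ^ (n - 1)) *
        ∏ l, ∏ m with l < m, ((u m - u l) * (1 + u m + u m * u l)) := by
    rw [← Fin.prod_pairs_mul, ← Finset.prod_mul_distrib]
    refine Finset.prod_congr rfl fun l _ => ?_
    rw [← Finset.prod_mul_distrib]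
    exact Finset.prod_congr rfl fun m _ => e6 l m
  rw [zNumeratorValue_edgeParams, asmIntegrand]
  simp only [prod_inner_edgeParams, prod_outer_edgeParams]
  rw [Finset.prod_mul_distrib (f := fun l => qSub 1 (Contour.moebius (u l))), e7]
  have e8 : ∀ l : Fin n, _ := fun l => edgeIntegrand_local (A := A) (X := 1 + x * u l) n l.val l.isLt
    hκ0 (hd l) hB (huy l) (hu0 l) (sub_ne_zero.2 (huα l))
    (show Contour.moebiusDeriv (u l) = κ / (1 - omega3 * u l) ^ 2 from rfl)
  have e9 := Finset.prod_congr (rfl : (univ : Finset (Fin n)) = univ) fun l _ => e8 l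
  simp only [e1, e2, e3, e4, e5]
  rw [Finset.prod_mul_distrib (f := fun _ : Fin n => A / (B * κ ^ n)), Finset.prod_const,
    Finset.card_univ, Fintype.card_fin] at e9
  simp only [Finset.prod_mul_distrib] at e9 ⊢
  linear_combination (qSub α α * (∏ l, ∏ m with l < m, (u m - u l)) *
    ∏ l, ∏ m with l < m, (1 + u m + u m * u l)) * e9

/-- For positive real parameters no enclosed pole meets an excluded one, so admissible contours
exist. -/
theorem ofReal_ne_omega3_mul {s t : ℝ} (hs : 0 < s) (ht : 0 < t) : (s : ℂ) ≠ omega3 * t := by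
  intro h
  have h1 : (s : ℂ) ^ 3 = (t : ℂ) ^ 3 := by rw [h, mul_pow, omega3_pow_three, one_mul]
  have h2 : s = t := by
    have h3 : s ^ 3 = t ^ 3 := by exact_mod_cast h1
    exact (pow_left_inj₀ hs.le ht.le three_ne_zero).1 h3
  rw [h2] at h
  exact omega3_ne_one (mul_right_cancel₀ (Complex.ofReal_ne_zero.2 ht.ne') (by rw [one_mul, ← h]))

theorem moebiusInv_ne_moebiusInv {w w' : ℂ} (hw : w ≠ omega3) (hw' : w' ≠ omega3) (h : w ≠ w') :
    Contour.moebiusInv w ≠ Contour.moebiusInv w' := fun h' => h (by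
  rw [← Contour.moebius_moebiusInv hw, h', Contour.moebius_moebiusInv hw'])

theorem exists_ofReal_edgeParams {n : ℕ} {a b : ℝ} (ha : 0 < a) (hb : 0 < b)
    (i : Fin (2 * (n + 1))) : ∃ r : ℝ, 0 < r ∧ (r = a ∨ r = 1 ∨ r = b) ∧
      edgeParams n a b i = r := by
  unfold edgeParams
  split_ifs
  · exact ⟨a, ha, Or.inl rfl, rfl⟩
  · exact ⟨b, hb, Or.inr (Or.inr rfl), rfl⟩
  · exact ⟨1, one_pos, Or.inr (Or.inl rfl), Complex.ofReal_one.symm⟩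

/-- Contours around `0` whose images are admissible. -/
theorem exists_edgeContour (n : ℕ) {a b : ℝ} (ha : 0 < a) (ha1 : a ≠ 1) (hb : 0 < b) (hb1 : b ≠ 1) :
    ∃ Γ Γ' : Contour, Γ.Separates {0} {Contour.moebiusInv (omega3 * b), omega3⁻¹} ∧
      (∀ f, Γ'.integral f = Γ.integral fun u => f (Contour.moebius u) * Contour.moebiusDeriv u) ∧
      Γ.Avoids (Contour.moebiusInv a) ∧
      AdmissibleContours omega3 (n + 1) (edgeParams n a b) fun _ => Γ' := by
  have hq : ∀ {r : ℝ}, 0 < r → (r : ℂ) ≠ omega3 := fun hr => by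
    simpa using ofReal_ne_omega3_mul hr one_pos
  -- The point q has its preimage at infinity; for a, b ≠ 1 the excluded poles q a and q b have
  -- finite preimages.
  have hqq : ∀ {r : ℝ}, r ≠ 1 → omega3 * (r : ℂ) ≠ omega3 := fun hr h => hr (by
    have h1 := mul_left_cancel₀ omega3_ne_zero (h.trans (mul_one omega3).symm)
    exact_mod_cast h1)
  have hinv1 : Contour.moebiusInv ((1 : ℝ) : ℂ) = 0 := by simp [Contour.moebiusInv]
  obtain ⟨Γ, h1, h2⟩ := Contour.exists_separates
    {Contour.moebiusInv ((1 : ℝ) : ℂ), Contour.moebiusInv a, Contour.moebiusInv b}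
    {Contour.moebiusInv (omega3 * a), Contour.moebiusInv (omega3 * b), omega3⁻¹} (by
      have hne : ∀ {r s : ℝ}, 0 < r → 0 < s → s ≠ 1 →
          Contour.moebiusInv (r : ℂ) ≠ Contour.moebiusInv (omega3 * s) := fun hr hs hs1 =>
        moebiusInv_ne_moebiusInv (hq hr) (hqq hs1) (ofReal_ne_omega3_mul hr hs)
      rw [Finset.disjoint_left]
      intro x hx hx'
      simp only [Finset.mem_insert, Finset.mem_singleton] at hx hx'
      obtain ⟨r, hr, rfl⟩ : ∃ r : ℝ, 0 < r ∧ x = Contour.moebiusInv r := by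
        rcases hx with h | h | h
        · exact ⟨1, one_pos, h⟩
        · exact ⟨a, ha, h⟩
        · exact ⟨b, hb, h⟩
      rcases hx' with h | h | h
      · exact hne hr ha ha1 h
      · exact hne hr hb hb1 h
      · exact Contour.moebiusInv_ne _ h)
  simp only [Finset.coe_insert, Finset.coe_singleton] at h1 h2
  obtain ⟨Γ', h3, h4, h5⟩ := Contour.exists_moebius_map (h2 omega3⁻¹ (by simp)).1
    (h2 omega3⁻¹ (by simp)).2
  refine ⟨Γ, Γ', ⟨?_, ?_⟩, h3, (h1 _ (by simp)).1, fun l => ⟨?_, ?_⟩⟩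
  · rintro _ rfl
    rw [← hinv1]
    exact h1 _ (by simp)
  · rintro p (rfl | rfl)
    · exact h2 _ (by simp)
    · exact h2 _ (by simp)
  · rintro _ ⟨i, rfl⟩
    obtain ⟨r, hr, hr', h⟩ := exists_ofReal_edgeParams (n := n) ha hb i
    rw [h]
    have h6 := h1 (Contour.moebiusInv r) (by rcases hr' with rfl | rfl | rfl <;> simp)
    have h7 := h5 r (hq hr) h6.1
    exact ⟨h7.1, h7.2.trans h6.2⟩
  · rintro _ ⟨i, rfl⟩
    obtain ⟨r, hr, hr', h⟩ := exists_ofReal_edgeParams (n := n) ha hb i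
    simp only [h, omega3_zpow_neg_two]
    by_cases hr1 : r = 1
    · rw [hr1, Complex.ofReal_one, mul_one]
      exact h4
    · have h6 := h2 (Contour.moebiusInv (omega3 * r)) (by
        rcases hr' with rfl | rfl | rfl
        · simp
        · exact absurd rfl hr1
        · simp)
      have h7 := h5 (omega3 * r) (hqq hr1) h6.1
      exact ⟨h7.1, h7.2.trans h6.2⟩

/-- The first evaluation of the polynomial, through the contour integral. The exponent of q - q⁻¹ is
(2n choose 2) - n², from the prefactor and from the n transformed variables. -/
theorem exists_eval_edgeParams (n : ℕ) {a b : ℝ} (ha : 0 < a) (ha1 : a ≠ 1) (hb : 0 < b)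
    (hb1 : b ≠ 1) {x y : ℂ} (hx : omega3 - omega3 ^ 2 * a = x * (omega3 * a - omega3⁻¹))
    (hy : (b : ℂ) - 1 = (1 - y) * (omega3 - omega3⁻¹ * b)) :
    ∃ Γ : Contour, Γ.Separates {0} {p | 1 + p * (1 - y) = 0} ∧
      MvPolynomial.eval (edgeParams n a b) (sixVertexPoly (n + 1)) =
        (-1) ^ (n + 1).choose 2 * (omega3 - omega3⁻¹) ^ (n * (n - 1)) *
          ((omega3 * a - omega3⁻¹) * (omega3 - omega3⁻¹ * b)) ^ n *
            Contour.iterated n (fun _ => Γ) (asmIntegrand n x y) := by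
  obtain ⟨Γ, Γ', hsep, hmap, hav, hadm⟩ := exists_edgeContour n ha ha1 hb hb1
  have hb1' : (b : ℂ) - 1 ≠ 0 := sub_ne_zero.2 (by exact_mod_cast hb1)
  have hB : omega3 - omega3⁻¹ * b ≠ 0 := by
    intro h
    rw [h, mul_zero] at hy
    exact hb1' hy
  -- The only nonzero pole of the new integrand is the preimage of the excluded pole q b.
  have hpole : ∀ p, 1 + p * (1 - y) = 0 → p = Contour.moebiusInv (omega3 * b) := by
    intro p hp
    have h1 : omega3 * (omega3 * b) - omega3⁻¹ ≠ 0 := by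
      rw [omega3_inv]
      intro h
      exact mul_ne_zero (pow_ne_zero 2 omega3_ne_zero) hb1' (by linear_combination h)
    rw [Contour.moebiusInv, eq_div_iff h1]
    have h2 : p * (b - 1) = -(omega3 - omega3⁻¹ * b) := by
      rw [hy]
      linear_combination (omega3 - omega3⁻¹ * b) * hp
    rw [omega3_inv] at h2 ⊢
    linear_combination omega3 ^ 2 * h2 + (b * omega3 - 1) * omega3_pow_three
  have hsep' : Γ.Separates {0} {p | 1 + p * (1 - y) = 0} :=
    ⟨hsep.1, fun p hp => hsep.2 p (Or.inl (hpole p hp))⟩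
  refine ⟨Γ, hsep', ?_⟩
  have h0 : edgeParams n a b 0 = a := by simp [edgeParams]
  have hne : ∏ i, qSub (a : ℂ) (edgeParams n a b i) ≠ 0 := by
    refine Finset.prod_ne_zero_iff.2 fun i _ => ?_
    obtain ⟨r, hr, -, h⟩ := exists_ofReal_edgeParams (n := n) ha hb i
    rw [h, qSub_eq_mul]
    exact mul_ne_zero omega3_ne_zero (sub_ne_zero.2 (ofReal_ne_omega3_mul ha hr))
  have hint := Contour.iterated_congr (Γ := fun _ : Fin n => Γ)
    (f := fun u => (zNumeratorValue (n + 1) (edgeParams n a b)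
        (Fin.cons (a : ℂ) fun l => Contour.moebius (u l) : Fin (n + 1) → ℂ) *
      ∏ l : Fin n, ((∏ i with i.val ≤ 2 * (l.val + 1),
          (Contour.moebius (u l) - edgeParams n a b i)) *
        ∏ i with 2 * (l.val + 1) ≤ i.val,
          qSub (Contour.moebius (u l)) (edgeParams n a b i))⁻¹) *
        ∏ l, Contour.moebiusDeriv (u l))
    (g := fun u => qSub (a : ℂ) a * ((omega3 * a - omega3⁻¹) / ((omega3 - omega3⁻¹ * b) *
        (omega3 - omega3⁻¹) ^ n)) ^ n * asmIntegrand n x y u) (by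
      intro u hu
      choose γ hγ t ht h using hu
      have hqi : ∀ l, u l ≠ omega3⁻¹ := fun l => by
        rw [h l]; exact (hsep.2 _ (Or.inr rfl)).1 _ (hγ l) _ (ht l)
      refine edgeIntegrand_eq hx hy hB hqi (fun l => ?_) (fun l hl => ?_) fun l hl => ?_
      · rw [h l]; exact (hsep.1 _ rfl).1 _ (hγ l) _ (ht l)
      · refine hav _ (hγ l) _ (ht l) ?_
        have hqa : (a : ℂ) ≠ omega3 := by simpa using ofReal_ne_omega3_mul ha one_pos
        by_contra hne'
        rw [← h l, ← sub_eq_zero.not] at hne'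
        have h1 := Contour.moebius_sub_moebius (hqi l) (Contour.moebiusInv_ne a)
        rw [Contour.moebius_moebiusInv hqa, hl, sub_self] at h1
        exact div_ne_zero (mul_ne_zero Contour.omega3_sub_inv_ne_zero hne')
          (mul_ne_zero (Contour.one_sub_omega3_mul_ne_zero (hqi l))
            (Contour.one_sub_omega3_mul_ne_zero (Contour.moebiusInv_ne a))) h1.symm
      · exact (hsep'.2 _ hl).1 _ (hγ l) _ (ht l) (h l).symm)
  rw [contour_iterated_const_mul, ← Contour.iterated_map hmap (fun w : Fin n → ℂ =>
    zNumeratorValue (n + 1) (edgeParams n a b) (Fin.cons (a : ℂ) w : Fin (n + 1) → ℂ) *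
      ∏ l : Fin n, ((∏ i with i.val ≤ 2 * (l.val + 1), (w l - edgeParams n a b i)) *
        ∏ i with 2 * (l.val + 1) ≤ i.val, qSub (w l) (edgeParams n a b i))⁻¹)] at hint
  have hsucc := iterated_zIntegrand_succ hadm
  rw [h0, hint] at hsucc
  have hpre := zPrefactor_edgeParams n (a : ℂ) b
  rw [← contourZ_eq_eval_sixVertexPoly hadm, contourZ, hsucc]
  change _ * zPrefactor (n + 1) (edgeParams n a b) * _ = _
  have hB' : qSub (1 : ℂ) b = omega3 - omega3⁻¹ * b := by rw [qSub_def, mul_one]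
  have hchoose : (2 * n).choose 2 = n * n + n * (n - 1) := by
    rw [Nat.choose_two_right]
    rcases n with _ | n
    · rfl
    · refine Nat.div_eq_of_eq_mul_left two_pos ?_
      simp only [Nat.add_sub_cancel, show 2 * (n + 1) - 1 = 2 * n + 1 by omega]
      ring
  rw [hB', hchoose, pow_add, pow_mul _ n n] at hpre
  have hκ := pow_ne_zero n (pow_ne_zero n Contour.omega3_sub_inv_ne_zero)
  have hBn := pow_ne_zero n hB
  rw [div_pow, mul_pow, mul_pow]
  generalize omega3 - omega3⁻¹ = κ at *
  generalize omega3 - omega3⁻¹ * (b : ℂ) = B at *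
  generalize omega3 * (a : ℂ) - omega3⁻¹ = A at *
  have hfinal : ∀ s Z F f K k L L2 I A' : ℂ, F ≠ 0 → K ≠ 0 → L ≠ 0 → f * Z = F * (K * k * L2) →
      L2 = L * L → s * Z * (F⁻¹ * (f * (A' / (L * K)) * I)) = s * k * (A' * L) * I := by
    intro s Z F f K k L L2 I A' h1 h2 h3 h4 h5
    subst h5
    have : s * Z * (F⁻¹ * (f * (A' / (L * K)) * I)) =
      s * (f * Z) * (F⁻¹ * (A' / (L * K)) * I) := by ring
    rw [this, h4]
    field_simp
  exact hfinal _ _ _ _ _ _ _ _ _ _ hne hκ hBn hpre (by ring)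

end EdgeIntegral

/-! ### Arrow configurations and alternating sign matrices -/

section AlternatingSigns

/-- The sign of a pair of consecutive arrows on a line. -/
def edgeSign (l r : Bool) : SignType := if l = r then 0 else if l = true then 1 else -1

/-- Alternating sign sequences in which the first sign is given by the state `b`. -/
def AlternatesFrom : Bool → List SignType → Prop
  | b, [] => b = false
  | b, x :: xs => x = edgeSign b (!b) ∧ AlternatesFrom (!b) xs

theorem alternatesFrom_cons_iff (b : Bool) (x : SignType) (xs : List SignType) :
    AlternatesFrom b (x :: xs) ↔ x = edgeSign b (!b) ∧ (x :: xs).getLast? = some 1 ∧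
      (x :: xs).IsChain fun a b => b = -a := by
  induction xs generalizing b x with
  | nil => cases b <;> cases x <;> simp [AlternatesFrom, edgeSign]
  | cons y ys ih =>
    rw [AlternatesFrom, ih, List.isChain_cons_cons, List.getLast?_cons_cons]
    constructor
    · rintro ⟨rfl, rfl, h1, h2⟩
      refine ⟨rfl, h1, ?_, h2⟩
      cases b <;> decide
    · rintro ⟨rfl, h1, rfl, h2⟩
      refine ⟨rfl, ?_, h1, h2⟩
      cases b <;> decide

/-- The state of an edge records whether the next nonzero sign is 1 or -1; zeros leave it unchanged.
-/
theorem alternatesFrom_filter_ofFn {n : ℕ} (b : Bool) (f : Fin n → SignType) :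
    AlternatesFrom b ((List.ofFn f).filter (· ≠ 0)) ↔
      ∃ h : Fin (n + 1) → Bool, h 0 = b ∧ h (Fin.last n) = false ∧
        ∀ j : Fin n, f j = edgeSign (h j.castSucc) (h j.succ) := by
  induction n generalizing b with
  | zero =>
    simp only [List.ofFn_zero, List.filter_nil, AlternatesFrom]
    constructor
    · intro h
      exact ⟨fun _ => b, rfl, h, fun j => j.elim0⟩
    · rintro ⟨h, rfl, h2, -⟩
      exact h2
  | succ n ih =>
    have hcons : ∀ c : Bool, (∃ h : Fin (n + 1) → Bool, h 0 = c ∧ h (Fin.last n) = false ∧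
        ∀ j : Fin n, f j.succ = edgeSign (h j.castSucc) (h j.succ)) → f 0 = edgeSign b c →
        ∃ h : Fin (n + 1 + 1) → Bool, h 0 = b ∧ h (Fin.last (n + 1)) = false ∧
          ∀ j : Fin (n + 1), f j = edgeSign (h j.castSucc) (h j.succ) := by
      rintro c ⟨h, h1, h2, h3⟩ h0
      refine ⟨Fin.cons b h, rfl, ?_, fun j => ?_⟩
      · rw [← Fin.succ_last, Fin.cons_succ, h2]
      · refine Fin.cases ?_ (fun j => ?_) j
        · rw [Fin.castSucc_zero, Fin.cons_zero, Fin.cons_succ, h1, h0]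
        · rw [← Fin.succ_castSucc, Fin.cons_succ, Fin.cons_succ, h3]
    have htail : ∀ h : Fin (n + 1 + 1) → Bool, h (Fin.last (n + 1)) = false →
        (∀ j : Fin (n + 1), f j = edgeSign (h j.castSucc) (h j.succ)) →
        ∃ h' : Fin (n + 1) → Bool, h' 0 = h (Fin.succ 0) ∧ h' (Fin.last n) = false ∧
          ∀ j : Fin n, f j.succ = edgeSign (h' j.castSucc) (h' j.succ) := fun h h2 h3 =>
      ⟨fun j => h j.succ, rfl, h2, fun j => h3 j.succ⟩
    rw [List.ofFn_succ, List.filter_cons]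
    split_ifs with h0
    · rw [AlternatesFrom, ih]
      constructor
      · rintro ⟨h1, h2⟩
        exact hcons _ h2 h1
      · rintro ⟨h, rfl, h2, h3⟩
        have h4 := h3 0
        have h5 : h (Fin.succ 0) = !(h 0) := by
          rw [Fin.castSucc_zero] at h4
          rw [h4] at h0
          revert h0
          cases h 0 <;> cases h (Fin.succ 0) <;> simp [edgeSign]
        rw [Fin.castSucc_zero, h5] at h4
        exact ⟨h4, h5 ▸ htail h h2 h3⟩
    · rw [ih]
      have h0' : f 0 = 0 := by simpa using h0
      constructor
      · intro h
        exact hcons _ h (by rw [h0', edgeSign, if_pos rfl])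
      · rintro ⟨h, rfl, h2, h3⟩
        have h4 := h3 0
        have h5 : h (Fin.succ 0) = h 0 := by
          rw [Fin.castSucc_zero, h0'] at h4
          revert h4
          cases h 0 <;> cases h (Fin.succ 0) <;> simp [edgeSign]
        exact h5 ▸ htail h h2 h3

/-- The arrows along a line are the partial sums in disguise: a sequence alternates precisely if it
records the changes in a line of arrows that starts with `true` and ends with `false`. -/
theorem isAlternating_iff {n : ℕ} (f : Fin n → SignType) :
    IsAlternating f ↔ ∃ h : Fin (n + 1) → Bool, h 0 = true ∧ h (Fin.last n) = false ∧
      ∀ j : Fin n, f j = edgeSign (h j.castSucc) (h j.succ) := by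
  rw [← alternatesFrom_filter_ofFn, IsAlternating]
  generalize (List.ofFn f).filter (· ≠ 0) = l
  cases l with
  | nil => simp [AlternatesFrom]
  | cons x xs =>
    rw [alternatesFrom_cons_iff, List.head?_cons, Option.some_inj]
    rfl

theorem edgeSign_right_injective {b r r' : Bool} (h : edgeSign b r = edgeSign b r') : r = r' := by
  revert h
  cases b <;> cases r <;> cases r' <;> simp [edgeSign]

theorem eq_of_edgeSign_eq {n : ℕ} {h h' : Fin (n + 1) → Bool} (h0 : h 0 = h' 0)
    (hs : ∀ j : Fin n, edgeSign (h j.castSucc) (h j.succ) = edgeSign (h' j.castSucc) (h' j.succ)) :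
    h = h' := by
  ext1 j
  induction j using Fin.induction with
  | zero => exact h0
  | succ j ih =>
    have h1 := hs j
    rw [ih] at h1
    exact edgeSign_right_injective h1

namespace ArrowConfig

variable {n : ℕ}

/-- The matrix of signs of an arrow configuration. -/
def signMatrix (c : ArrowConfig n) : Matrix (Fin n) (Fin n) SignType :=
  fun i j => edgeSign (c.left i j) (c.right i j)

/-- The ice rule says that the entries read off horizontally and vertically agree. So one matrix has
alternating rows and columns, and it determines all arrows. -/
theorem inDegree_eq_two_iff (c : ArrowConfig n) (i j : Fin n) :
    c.inDegree i j = 2 ↔ edgeSign (c.left i j) (c.right i j) = edgeSign (c.top i j) (c.bottom i j) := by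
  rw [inDegree]
  generalize c.left i j = l
  generalize c.right i j = r
  generalize c.top i j = t
  generalize c.bottom i j = u
  revert l r t u
  decide

theorem IsDWBC.isASM_signMatrix {c : ArrowConfig n} (hc : c.IsDWBC) : IsASM c.signMatrix := by
  obtain ⟨h1, h2, h3, h4, h5⟩ := hc
  refine ⟨fun i => (isAlternating_iff _).2 ⟨c.1 i, h2 i, h3 i, fun j => rfl⟩,
    fun j => (isAlternating_iff _).2 ⟨fun i => c.2 i j, h4 j, h5 j, fun i => ?_⟩⟩
  exact (c.inDegree_eq_two_iff i j).1 (h1 i j)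

theorem IsDWBC.signMatrix_injective {c c' : ArrowConfig n} (hc : c.IsDWBC) (hc' : c'.IsDWBC)
    (h : c.signMatrix = c'.signMatrix) : c = c' := by
  have hs : ∀ i j, edgeSign (c.left i j) (c.right i j) = edgeSign (c'.left i j) (c'.right i j) :=
    fun i j => congrFun (congrFun h i) j
  refine Prod.ext (funext fun i => ?_) (funext fun i => funext fun j => ?_)
  · exact eq_of_edgeSign_eq ((hc.2.1 i).trans (hc'.2.1 i).symm) (hs i)
  · refine congrFun (eq_of_edgeSign_eq (h := fun i => c.2 i j) (h' := fun i => c'.2 i j)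
      ((hc.2.2.2.1 j).trans (hc'.2.2.2.1 j).symm) fun i => ?_) i
    have h1 := (c.inDegree_eq_two_iff i j).1 (hc.1 i j)
    have h2 := (c'.inDegree_eq_two_iff i j).1 (hc'.1 i j)
    exact h1.symm.trans ((hs i j).trans h2)

theorem exists_signMatrix_eq {M : Matrix (Fin n) (Fin n) SignType} (hM : IsASM M) :
    ∃ c : ArrowConfig n, c.IsDWBC ∧ c.signMatrix = M := by
  choose h h1 h2 h3 using fun i => (isAlternating_iff _).1 (hM.1 i)
  choose v v1 v2 v3 using fun j => (isAlternating_iff _).1 (hM.2 j)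
  refine ⟨(h, fun i j => v j i), ⟨fun i j => ?_, h1, h2, v1, v2⟩, ?_⟩
  · exact (inDegree_eq_two_iff _ i j).2 ((h3 i j).symm.trans (v3 j i))
  · ext i j
    exact (h3 i j).symm

end ArrowConfig

open Classical in
theorem refinedASMCount_eq (n : ℕ) (i j : Fin (n + 1)) :
    refinedASMCount n i j = #{c : ArrowConfig (n + 1) |
      c.IsDWBC ∧ c.signMatrix 0 i = 1 ∧ c.signMatrix (Fin.last n) j = 1} := by
  symm
  refine Finset.card_bij (fun c _ => c.signMatrix) ?_ ?_ ?_
  · intro c hc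
    obtain ⟨-, h1, h2⟩ := Finset.mem_filter.1 hc
    exact Finset.mem_filter.2 ⟨Finset.mem_univ _, h1.isASM_signMatrix, h2⟩
  · intro c hc c' hc' h
    exact (Finset.mem_filter.1 hc).2.1.signMatrix_injective (Finset.mem_filter.1 hc').2.1 h
  · intro M hM
    obtain ⟨-, h1, h2⟩ := Finset.mem_filter.1 hM
    obtain ⟨c, hc, rfl⟩ := ArrowConfig.exists_signMatrix_eq h1
    exact ⟨c, Finset.mem_filter.2 ⟨Finset.mem_univ _, hc, h2⟩, rfl⟩

end AlternatingSigns

/-! ### Weights at the combinatorial point -/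

section BoundaryRows

theorem exists_step {n : ℕ} {h : Fin (n + 1) → Bool} (h0 : h 0 = true)
    (h1 : h (Fin.last n) = false)
    (hs : ∀ j : Fin n, h j.castSucc = false → h j.succ = false) :
    ∃ i : Fin n, ∀ e, h e = true ↔ e.val ≤ i.val := by
  have hanti : Antitone h := Fin.antitone_iff_succ_le.2 fun j => by
    have := hs j
    revert this
    cases h j.castSucc <;> cases h j.succ <;> simp
  have hne : (univ.filter fun e => h e = true).Nonempty := ⟨0, by simp [h0]⟩
  have hmem := (Finset.mem_filter.1 (Finset.max'_mem _ hne)).2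
  have hlt : ((univ.filter fun e => h e = true).max' hne).val < n := by
    refine lt_of_le_of_ne (Nat.lt_succ_iff.1 (Fin.isLt _)) fun heq => ?_
    rw [show (univ.filter fun e => h e = true).max' hne = Fin.last n from Fin.ext heq, h1] at hmem
    exact Bool.false_ne_true hmem
  refine ⟨⟨_, hlt⟩, fun e => ⟨fun he => ?_, fun he => ?_⟩⟩
  · exact Fin.le_def.1 (Finset.le_max' _ e (by simp [he]))
  · have h2 := hanti (Fin.le_def.2 he)
    rw [hmem] at h2
    exact top_le_iff.1 h2

theorem Fin.prod_step {M : Type*} [CommMonoid M] {n : ℕ} (i : Fin (n + 1)) (a b k : M) :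
    ∏ j : Fin (n + 1), (if j < i then a else if j = i then k else b) =
      k * (a ^ i.val * b ^ (n - i.val)) := by
  have h1 : ∀ j : Fin n, (if i.succAbove j < i then a else if i.succAbove j = i then k else b) =
      if j.val < i.val then a else b := by
    intro j
    rw [if_neg (Fin.succAbove_ne i j)]
    exact if_congr (Fin.succAbove_lt_iff_castSucc_lt i j) rfl rfl
  have h2 := Fin.card_filter_val_lt' (N := n) (b := i.val) (by have := i.isLt; omega)
  have h3 := Finset.card_filter_add_card_filter_not (s := (univ : Finset (Fin n)))
    fun k => k.val < i.val
  rw [h2, Finset.card_univ, Fintype.card_fin] at h3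
  rw [Fin.prod_univ_succAbove _ i, if_neg (lt_irrefl i), if_pos rfl]
  simp only [h1]
  rw [Finset.prod_ite, Finset.prod_const, Finset.prod_const, h2,
    (Nat.sub_eq_of_eq_add' h3.symm).symm]

variable {R : Type*} [CommRing R]

theorem vWeight_top (s si z : R) {l r u : Bool} (h : edgeSign l r = edgeSign true u) :
    vWeight s si z 1 l r true u =
      if r = true then si - s * z else if l = true then si ^ 2 - s ^ 2 else si * z - s := by
  revert h
  cases l <;> cases r <;> cases u <;> simp [edgeSign, vWeight, iceWeight]

theorem vWeight_bottom (s si z : R) {l r t : Bool} (h : edgeSign l r = edgeSign t false) :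
    vWeight s si z 1 l r t false =
      if r = true then si * z - s else if l = true then si ^ 2 - s ^ 2 else si - s * z := by
  revert h
  cases l <;> cases r <;> cases t <;> simp [edgeSign, vWeight, iceWeight]

/-- From s + s⁻¹ = 1 follows s⁻¹ - s = s⁻² - s²: the a-, b- and c-weights coincide and
configurations are counted. -/
theorem vWeight_one_one {s si : R} (hs : s + si = 1) {l r t u : Bool}
    (h : edgeSign l r = edgeSign t u) : vWeight s si 1 1 l r t u = si ^ 2 - s ^ 2 := by
  have h1 : si - s = si ^ 2 - s ^ 2 := by linear_combination (s - si) * hs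
  revert h
  cases l <;> cases r <;> cases t <;> cases u <;> simp [edgeSign, vWeight, iceWeight, h1]

namespace ArrowConfig

variable {n : ℕ}

/-- In a boundary row the arrows turn only once. The position of the turn is the column of the 1,
with one kind of straight vertex before it and the other kind after it. -/
theorem prod_row_eq (c : ArrowConfig (n + 1)) (k : Fin (n + 1))
    (hs : ∀ j, c.left k j = false → c.right k j = false) (h0 : c.1 k 0 = true)
    (h1 : c.1 k (Fin.last (n + 1)) = false) (a b d : R) :
    ∃ i : Fin (n + 1), (∀ i', c.signMatrix k i' = 1 ↔ i' = i) ∧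
      ∏ j, (if c.right k j = true then a else if c.left k j = true then d else b) =
        d * (a ^ i.val * b ^ (n - i.val)) := by
  obtain ⟨i, hi⟩ := exists_step h0 h1 hs
  have hl : ∀ j, c.left k j = true ↔ j ≤ i := fun j => hi _
  have hr : ∀ j, c.right k j = true ↔ j < i := fun j => hi _
  refine ⟨i, fun i' => ?_, ?_⟩
  · have h2 : c.signMatrix k i' = 1 ↔ c.left k i' = true ∧ ¬ c.right k i' = true := by
      simp only [signMatrix]
      generalize c.left k i' = l
      generalize c.right k i' = r
      revert l r
      decide
    rw [h2, hl, hr, not_lt]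
    exact ⟨fun h => le_antisymm h.1 h.2, fun h => ⟨h.le, h.ge⟩⟩
  · rw [← Fin.prod_step]
    refine Finset.prod_congr rfl fun j _ => ?_
    simp only [hl, hr]
    by_cases h : j < i
    · rw [if_pos h, if_pos h]
    · rw [if_neg h, if_neg h]
      exact if_congr ⟨fun h' => le_antisymm h' (not_lt.1 h), fun h' => h'.le⟩ rfl rfl

/-- The row parameters `α, 1, …, 1, β`. -/
def edgeRows (n : ℕ) (α β : R) : Fin (n + 2) → R :=
  Fin.cons α (Fin.snoc (fun _ : Fin n => (1 : R)) β : Fin (n + 1) → R)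

theorem IsDWBC.prod_vWeight {c : ArrowConfig (n + 2)} (hc : c.IsDWBC) {s si : R} (hs : s + si = 1)
    (α β : R) :
    ∃ i j, (∀ i', c.signMatrix 0 i' = 1 ↔ i' = i) ∧
      (∀ j', c.signMatrix (Fin.last (n + 1)) j' = 1 ↔ j' = j) ∧
      ∏ k, ∏ l, vWeight s si (edgeRows n α β k) 1 (c.left k l) (c.right k l) (c.top k l)
        (c.bottom k l) =
      (si ^ 2 - s ^ 2) ^ (n * (n + 2) + 2) *
        (((si - s * α) ^ i.val * (si * α - s) ^ (n + 1 - i.val)) *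
          ((si * β - s) ^ j.val * (si - s * β) ^ (n + 1 - j.val))) := by
  obtain ⟨hdeg, h2, h3, h4, h5⟩ := hc
  have he := fun k l => (c.inDegree_eq_two_iff k l).1 (hdeg k l)
  have ht : ∀ l, c.top 0 l = true := h4
  have hb : ∀ l, c.bottom (Fin.last (n + 1)) l = false := h5
  have he1 : ∀ l, edgeSign (c.left 0 l) (c.right 0 l) = edgeSign true (c.bottom 0 l) := fun l => by
    rw [he, ht]
  have he2 : ∀ l, edgeSign (c.left (Fin.last (n + 1)) l) (c.right (Fin.last (n + 1)) l) =
      edgeSign (c.top (Fin.last (n + 1)) l) false := fun l => by rw [he, hb]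
  obtain ⟨i, hi, hi'⟩ := c.prod_row_eq 0 (fun l hl => by
    have h := he1 l
    rw [hl] at h
    revert h
    cases c.right 0 l <;> cases c.bottom 0 l <;> simp [edgeSign]) (h2 0) (h3 0)
    (si - s * α) (si * α - s) (si ^ 2 - s ^ 2)
  obtain ⟨j, hj, hj'⟩ := c.prod_row_eq (Fin.last (n + 1)) (fun l hl => by
    have h := he2 l
    rw [hl] at h
    revert h
    cases c.right (Fin.last (n + 1)) l <;> cases c.top (Fin.last (n + 1)) l <;> simp [edgeSign])
    (h2 _) (h3 _) (si * β - s) (si - s * β) (si ^ 2 - s ^ 2)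
  refine ⟨i, j, hi, hj, ?_⟩
  have hz0 : edgeRows n α β 0 = α := rfl
  have hz1 : ∀ k : Fin n, edgeRows n α β k.castSucc.succ = 1 := fun k => by simp [edgeRows]
  have hz2 : edgeRows n α β (Fin.last n).succ = β := by simp [edgeRows]
  rw [Fin.prod_univ_succ, Fin.prod_univ_castSucc (n := n), hz0, hz2]
  simp only [hz1, ht, Fin.succ_last, hb, fun l => vWeight_top s si α (he1 l),
    fun l => vWeight_bottom s si β (he2 l), fun k l => vWeight_one_one hs (he k l), hi', hj',
    Finset.prod_const, Finset.card_univ, Fintype.card_fin]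
  generalize si ^ 2 - s ^ 2 = κ
  ring

end ArrowConfig

/-- Each of the n inner rows has n + 2 equal weights, and both outer rows contribute one c-vertex;
this explains the exponent. The rest depends only on the positions of the two boundary 1s. -/
theorem dwPartition_edgeRows (n : ℕ) {s si : R} (hs : s + si = 1) (α β : R) :
    dwPartition s si (n + 2) (ArrowConfig.edgeRows n α β) (fun _ => 1) =
      (si ^ 2 - s ^ 2) ^ (n * (n + 2) + 2) * ∑ i, ∑ j, (refinedASMCount (n + 1) i j : R) *
        (((si - s * α) ^ i.val * (si * α - s) ^ (n + 1 - i.val)) *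
          ((si * β - s) ^ j.val * (si - s * β) ^ (n + 1 - j.val))) := by
  classical
  rw [dwPartition_eq_sum]
  have h1 : ∑ c : ArrowConfig (n + 2) with c.IsBoundary, ∏ k, ∏ l,
      vWeight s si (ArrowConfig.edgeRows n α β k) 1 (c.left k l) (c.right k l) (c.top k l)
        (c.bottom k l) =
      ∑ c : ArrowConfig (n + 2) with c.IsDWBC, ∏ k, ∏ l,
        vWeight s si (ArrowConfig.edgeRows n α β k) 1 (c.left k l) (c.right k l) (c.top k l)
          (c.bottom k l) := by
    symm
    refine Finset.sum_subset (fun c hc => ?_) fun c hc hc' => ?_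
    · simp only [Finset.mem_filter, Finset.mem_univ, true_and] at hc ⊢
      exact (c.isDWBC_iff.1 hc).2
    · simp only [Finset.mem_filter, Finset.mem_univ, true_and] at hc hc'
      rw [c.isDWBC_iff, and_iff_left hc] at hc'
      push Not at hc'
      obtain ⟨k, l, hkl⟩ := hc'
      exact Finset.prod_eq_zero (Finset.mem_univ k)
        (Finset.prod_eq_zero (Finset.mem_univ l) (vWeight_eq_zero _ _ _ _ c k l hkl))
  rw [h1, Finset.mul_sum]
  simp only [refinedASMCount_eq, Finset.card_filter, Nat.cast_sum, Finset.sum_mul, Finset.mul_sum]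
  have h2 : ∀ F : Fin (n + 2) → Fin (n + 2) → ArrowConfig (n + 2) → R,
      ∑ i, ∑ j, ∑ c, F i j c = ∑ c, ∑ i, ∑ j, F i j c := by
    intro F
    exact (Finset.sum_congr rfl fun i _ => Finset.sum_comm).trans Finset.sum_comm
  rw [Finset.sum_filter, h2]
  refine Finset.sum_congr rfl fun c _ => ?_
  by_cases hc : c.IsDWBC
  · obtain ⟨i, j, hi, hj, h⟩ := hc.prod_vWeight hs α β
    simp only [hc, hi, hj, true_and, if_true, h]
    rw [Finset.sum_eq_single_of_mem i (Finset.mem_univ i) fun i' _ hi' => by simp [hi'],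
      Finset.sum_eq_single_of_mem j (Finset.mem_univ j) fun j' _ hj' => by simp [hj']]
    simp
  · simp [hc]

end BoundaryRows

/-! ### The polynomial at α, 1, …, 1, β through the model -/

section AlternatingSignMatrixIntegral

/-- In `edgeParams` the parameter β belongs to the last column. By full symmetry it is exchanged
with the 1 of the last row. -/
theorem eval_edgeParams_eq_dwPartition (n : ℕ) (α β : ℂ) :
    MvPolynomial.eval (edgeParams (n + 1) α β) (sixVertexPoly (n + 2)) =
      (-1) ^ (n + 2).choose 2 * (omega3Diff ^ (n + 2))⁻¹ *
        dwPartition sqrtOmega3 sqrtOmega3⁻¹ (n + 2) (ArrowConfig.edgeRows n α β) fun _ => 1 := by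
  rw [← sixVertexPoly_perm _ (Equiv.swap ⟨n + 1, by omega⟩ ⟨2 * (n + 1) + 1, by omega⟩),
    eval_sixVertexPoly, sixVertexValue, ← Nat.choose_two_right]
  congr 2
  · ext k
    refine Fin.cases ?_ (fun k => ?_) k
    · rw [rowParam, Equiv.swap_apply_of_ne_of_ne (by simp [Fin.ext_iff]) (by simp [Fin.ext_iff])]
      rfl
    · refine Fin.lastCases ?_ (fun k => ?_) k
      · have h : (⟨((Fin.last n).succ : Fin (n + 2)).val, by simp; omega⟩ : Fin (2 * (n + 2))) =
            ⟨n + 1, by omega⟩ := by simp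
        rw [rowParam, h, Equiv.swap_apply_left]
        simp [edgeParams, ArrowConfig.edgeRows]
      · have hk := k.isLt
        rw [rowParam, Equiv.swap_apply_of_ne_of_ne (by simp [Fin.ext_iff]; omega)
          (by simp [Fin.ext_iff]; omega)]
        simp [edgeParams, ArrowConfig.edgeRows]
        omega
  · ext j
    have hj := j.isLt
    rw [colParam]
    by_cases h : j = Fin.last (n + 1)
    · have h' : (⟨n + 2 + j.val, by omega⟩ : Fin (2 * (n + 2))) = ⟨2 * (n + 1) + 1, by omega⟩ := by
        rw [Fin.mk.injEq, h, Fin.val_last]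
        ring
      rw [h', Equiv.swap_apply_right]
      simp [edgeParams]
      omega
    · have h1 : j.val ≠ n + 1 := fun h' => h (Fin.ext h')
      rw [Equiv.swap_apply_of_ne_of_ne (by simp [Fin.ext_iff]; omega)
        (by simp [Fin.ext_iff]; omega)]
      simp [edgeParams]
      omega

theorem sum_refinedASMCount_mul (n : ℕ) {a b a' b' x y : ℂ} (hx : a = x * b) (hy : b' = y * a') :
    ∑ i : Fin (n + 1), ∑ j : Fin (n + 1), (refinedASMCount n i j : ℂ) *
      ((a ^ i.val * b ^ (n - i.val)) * (b' ^ j.val * a' ^ (n - j.val))) =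
      (b * a') ^ n * refinedASM n x y := by
  subst hx hy
  rw [refinedASM, Finset.mul_sum]
  refine Finset.sum_congr rfl fun i _ => ?_
  rw [Finset.mul_sum]
  refine Finset.sum_congr rfl fun j _ => ?_
  have hi : b ^ n = b ^ i.val * b ^ (n - i.val) := by
    rw [← pow_add, Nat.add_sub_cancel' (Nat.lt_succ_iff.1 i.isLt)]
  have hj : a' ^ n = a' ^ j.val * a' ^ (n - j.val) := by
    rw [← pow_add, Nat.add_sub_cancel' (Nat.lt_succ_iff.1 j.isLt)]
  rw [mul_pow, mul_pow, mul_pow, hi, hj]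
  ring

/-- This is 2 cos(π / 3) = 1 and depends on the principal branch; the other square root would give
-1. -/
theorem sqrtOmega3_add_inv : sqrtOmega3 + sqrtOmega3⁻¹ = 1 := by
  have h1 : sqrtOmega3 = Complex.exp (Real.pi * Complex.I / 3) := by
    have h2 : 2 * (Real.pi : ℂ) * Complex.I / 3 = ((2 * Real.pi / 3 : ℝ) : ℂ) * Complex.I := by
      push_cast
      ring
    have hπ := Real.pi_pos
    rw [sqrtOmega3, Complex.cpow_def_of_ne_zero omega3_ne_zero, omega3, Complex.log_exp]
    · congr 1
      ring
    · rw [h2, Complex.im_ofReal_mul, Complex.I_im, mul_one]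
      linarith
    · rw [h2, Complex.im_ofReal_mul, Complex.I_im, mul_one]
      linarith
  have h3 : sqrtOmega3 ^ 3 = -1 := by
    rw [h1, ← Complex.exp_nat_mul, ← Complex.exp_pi_mul_I]
    congr 1
    push_cast
    ring
  rw [sqrtOmega3_inv, ← sqrtOmega3_sq]
  linear_combination (sqrtOmega3 ^ 2 + sqrtOmega3) * h3 - sqrtOmega3_quadratic

/-- The second evaluation: x and y are the ratios of the two straight weights in the first and in
the last row. These are the relations `hx`, `hy` of the contour evaluation, which is why the two
generating variables match. -/
theorem eval_edgeParams_eq_refinedASM (n : ℕ) {α β x y : ℂ}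
    (hx : omega3 - omega3 ^ 2 * α = x * (omega3 * α - omega3⁻¹))
    (hy : β - 1 = (1 - y) * (omega3 - omega3⁻¹ * β)) :
    MvPolynomial.eval (edgeParams (n + 1) α β) (sixVertexPoly (n + 2)) =
      (-1) ^ (n + 2).choose 2 * omega3Diff ^ ((n + 1) * n) *
        ((omega3 * α - omega3⁻¹) * (omega3 - omega3⁻¹ * β)) ^ (n + 1) *
          refinedASM (n + 1) x y := by
  have hs := sqrtOmega3_inv
  have h3 := omega3_pow_three
  have hquad := omega3_quadratic
  have hs2 := sqrtOmega3_sq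
  have hx' : sqrtOmega3⁻¹ - sqrtOmega3 * α = x * (sqrtOmega3⁻¹ * α - sqrtOmega3) := by
    rw [omega3_inv] at hx
    rw [hs]
    linear_combination sqrtOmega3 * omega3 * hx + (α - x) * sqrtOmega3 * h3
  have hy' : sqrtOmega3⁻¹ * β - sqrtOmega3 = y * (sqrtOmega3⁻¹ - sqrtOmega3 * β) := by
    rw [omega3_inv] at hy
    rw [hs]
    linear_combination -sqrtOmega3 * omega3 * hy + sqrtOmega3 * (β - 1) * hquad +
      sqrtOmega3 * β * (1 - y) * h3
  have hba : (sqrtOmega3⁻¹ * α - sqrtOmega3) * (sqrtOmega3⁻¹ - sqrtOmega3 * β) =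
      (omega3 * α - omega3⁻¹) * (omega3 - omega3⁻¹ * β) := by
    rw [hs, omega3_inv]
    linear_combination (omega3 ^ 2 * α - 1) * (omega3 ^ 2 - β) * hs2 +
      (omega3 ^ 2 * α - omega3 * β) * h3
  rw [eval_edgeParams_eq_dwPartition, dwPartition_edgeRows n sqrtOmega3_add_inv,
    sqrtOmega3_inv_sq_sub, sum_refinedASMCount_mul (n + 1) hx' hy', hba,
    show n * (n + 2) + 2 = (n + 1) * n + (n + 2) by ring, pow_add]
  have hκ := inv_mul_cancel₀ (pow_ne_zero (n + 2) omega3Diff_ne_zero)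
  linear_combination (-1) ^ (n + 2).choose 2 * omega3Diff ^ ((n + 1) * n) *
    ((omega3 * α - omega3⁻¹) * (omega3 - omega3⁻¹ * β)) ^ (n + 1) *
      refinedASM (n + 1) x y * hκ

end AlternatingSignMatrixIntegral

/-! ### Comparison for positive real parameters; polynomiality in x and y -/

section RefinedEnumeration

theorem refinedASM_zero (x y : ℂ) : refinedASM 0 x y = 1 := by
  have h : refinedASMCount 0 0 0 = 1 := by
    classical
    rw [refinedASMCount, Finset.card_eq_one]
    refine ⟨Matrix.of fun _ _ => 1, Finset.ext fun M => ?_⟩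
    simp only [Finset.mem_filter, Finset.mem_univ, true_and, Finset.mem_singleton]
    constructor
    · rintro ⟨-, h, -⟩
      ext i j
      exact (congrArg₂ M (Fin.fin_one_eq_zero i) (Fin.fin_one_eq_zero j)).trans h
    · rintro rfl
      refine ⟨⟨fun i => ?_, fun i => ?_⟩, rfl, rfl⟩ <;> simp [IsAlternating]
  simp [refinedASM, h]

theorem ofReal_omega3_sub_ne_zero {a : ℝ} (ha : 0 < a) : omega3 * (a : ℂ) - omega3⁻¹ ≠ 0 := by
  intro h
  rw [omega3_inv] at h
  refine ofReal_ne_omega3_mul ha one_pos (mul_left_cancel₀ omega3_ne_zero ?_)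
  push_cast
  linear_combination h

theorem omega3_sub_ofReal_ne_zero {b : ℝ} (hb : 0 < b) : omega3 - omega3⁻¹ * (b : ℂ) ≠ 0 := by
  intro h
  rw [omega3_inv] at h
  refine ofReal_ne_omega3_mul one_pos hb (mul_left_cancel₀ omega3_ne_zero ?_)
  push_cast
  linear_combination h

/-- Both evaluations carry the same factor, which is nonzero. Size 1 is treated separately because
its first and last rows coincide. -/
theorem exists_refinedASM_eq_iterated (n : ℕ) {a b : ℝ} (ha : 0 < a) (ha1 : a ≠ 1) (hb : 0 < b)
    (hb1 : b ≠ 1) {x y : ℂ} (hx : omega3 - omega3 ^ 2 * a = x * (omega3 * a - omega3⁻¹))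
    (hy : (b : ℂ) - 1 = (1 - y) * (omega3 - omega3⁻¹ * b)) :
    ∃ Γ : Contour, Γ.Separates {0} {p | 1 + p * (1 - y) = 0} ∧
      refinedASM n x y = Contour.iterated n (fun _ => Γ) (asmIntegrand n x y) := by
  obtain ⟨Γ, hΓ, h⟩ := exists_eval_edgeParams n ha ha1 hb hb1 hx hy
  refine ⟨Γ, hΓ, ?_⟩
  rcases n with _ | n
  · simp [refinedASM_zero, Contour.iterated, asmIntegrand]
  · rw [eval_edgeParams_eq_refinedASM n hx hy] at h
    have hκ : (omega3 - omega3⁻¹) ^ ((n + 1) * (n + 1 - 1)) = omega3Diff ^ ((n + 1) * n) := by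
      rw [show omega3 - omega3⁻¹ = -omega3Diff by rw [omega3Diff]; ring, Nat.add_sub_cancel,
        Even.neg_pow (by rw [mul_comm]; exact Nat.even_mul_succ_self n)]
    rw [hκ] at h
    refine mul_left_cancel₀ (mul_ne_zero (mul_ne_zero (pow_ne_zero _ (by norm_num))
      (pow_ne_zero _ omega3Diff_ne_zero)) (pow_ne_zero _ (mul_ne_zero
        (ofReal_omega3_sub_ne_zero ha) (omega3_sub_ofReal_ne_zero hb)))) h

open MvPolynomial

/-- The generating function `refinedASM` as a polynomial. -/
def refinedASMPoly (n : ℕ) : MvPolynomial (Fin 2) ℂ :=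
  ∑ i : Fin (n + 1), ∑ j : Fin (n + 1),
    C (refinedASMCount n i j : ℂ) * X 0 ^ (i : ℕ) * X 1 ^ (j : ℕ)

theorem eval_refinedASMPoly (n : ℕ) (x y : ℂ) : eval ![x, y] (refinedASMPoly n) = refinedASM n x y := by
  simp [refinedASMPoly, refinedASM]

/-- The numerator of `asmIntegrand`. -/
def asmNumerator (n : ℕ) : MvPolynomial (Fin n) (MvPolynomial (Fin 2) ℂ) :=
  (∏ k, ((1 + X k) * (1 + C (X 0) * X k))) *
    ∏ k, ∏ m with k < m, ((X m - X k) * (1 + X m + X m * X k))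

/-- The integral of `asmIntegrand` as a polynomial. -/
def asmIntegralPoly (n : ℕ) : MvPolynomial (Fin 2) ℂ :=
  ∑ d ∈ (asmNumerator n).support, coeff d (asmNumerator n) *
    ∏ l, if d l < 2 * l.val + 2 then (X 1 - 1) ^ (2 * l.val + 2 - 1 - d l) else 0

/-- The residue at 0 in each variable is a power of y - 1 or zero, so the integral is a polynomial
in x and y and does not depend on the contours. -/
theorem iterated_asmIntegrand {n : ℕ} {x y : ℂ} {Γ : Fin n → Contour}
    (hΓ : ∀ l, (Γ l).Separates {0} {p | 1 + p * (1 - y) = 0}) :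
    Contour.iterated n Γ (asmIntegrand n x y) = eval ![x, y] (asmIntegralPoly n) := by
  have h := Contour.iterated_eval_mul Γ (asmNumerator n) ![x, y]
    (fun l u => (u ^ (2 * l.val + 2) * (1 + u * (1 - y)))⁻¹) fun l =>
      Contour.continuousAlong_of_continuousAt fun γ hγ t ht => ContinuousAt.inv₀ (by fun_prop)
        (mul_ne_zero (pow_ne_zero _ (((hΓ l).1 _ rfl).1 γ hγ t ht)) fun h0 =>
          ((hΓ l).2 _ h0).1 γ hγ t ht rfl)
  have h1 : asmIntegrand n x y = fun u => eval u (map (eval ![x, y]) (asmNumerator n)) *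
      ∏ l : Fin n, (u l ^ (2 * l.val + 2) * (1 + u l * (1 - y)))⁻¹ := by
    ext u
    simp only [asmIntegrand, asmNumerator, map_mul, map_prod, map_add, map_sub, map_one, map_X,
      map_C, eval_X, eval_C, Matrix.cons_val_zero, div_eq_mul_inv, Finset.prod_mul_distrib]
    ring
  rw [h1, h, asmIntegralPoly, map_sum]
  refine Finset.sum_congr rfl fun d _ => ?_
  rw [map_mul, map_prod]
  congr 1
  refine Finset.prod_congr rfl fun l _ => ?_
  rw [Contour.integral_residueAtZero (hΓ l), Contour.residueAtZero]
  split_ifs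
  · simp
  · simp

end RefinedEnumeration

/-! ### Extension to all x and y -/

section RefinedEnumerationFormula

theorem omega3_sq_sub_ne_zero : omega3 ^ 2 - omega3 ≠ 0 := fun h => by
  have h1 : omega3 * (omega3 - 1) = 0 := by linear_combination h
  exact (mul_ne_zero omega3_ne_zero (sub_ne_zero.2 omega3_ne_one)) h1

/-- x is a nonconstant Möbius function of a, hence injective on the integers k + 2. -/
theorem infinite_firstRow_values : {x : ℂ | ∃ a : ℝ, 0 < a ∧ a ≠ 1 ∧
    omega3 - omega3 ^ 2 * a = x * (omega3 * a - omega3⁻¹)}.Infinite := by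
  have hpos : ∀ k : ℕ, (0 : ℝ) < (k : ℝ) + 2 := fun k => by positivity
  refine Set.infinite_of_injective_forall_mem (f := fun k : ℕ =>
    (omega3 - omega3 ^ 2 * ((k + 2 : ℝ) : ℂ)) / (omega3 * ((k + 2 : ℝ) : ℂ) - omega3⁻¹)) ?_ fun k =>
      ⟨k + 2, hpos k, by linarith [hpos k, (Nat.cast_nonneg k : (0 : ℝ) ≤ k)],
        (div_mul_cancel₀ _ (ofReal_omega3_sub_ne_zero (hpos k))).symm⟩
  intro k m h
  simp only at h
  rw [div_eq_div_iff (ofReal_omega3_sub_ne_zero (hpos k)) (ofReal_omega3_sub_ne_zero (hpos m)),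
    omega3_inv] at h
  push_cast at h
  have h1 : ((k : ℂ) - m) * (omega3 ^ 2 - omega3) = 0 := by
    linear_combination -h + omega3 * (k - m) * omega3_pow_three
  exact_mod_cast sub_eq_zero.1 ((mul_eq_zero.1 h1).resolve_right omega3_sq_sub_ne_zero)

theorem infinite_lastRow_values : {y : ℂ | ∃ b : ℝ, 0 < b ∧ b ≠ 1 ∧
    (b : ℂ) - 1 = (1 - y) * (omega3 - omega3⁻¹ * b)}.Infinite := by
  have hpos : ∀ k : ℕ, (0 : ℝ) < (k : ℝ) + 2 := fun k => by positivity
  refine Set.infinite_of_injective_forall_mem (f := fun k : ℕ =>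
    1 - (((k + 2 : ℝ) : ℂ) - 1) / (omega3 - omega3⁻¹ * ((k + 2 : ℝ) : ℂ))) ?_ fun k =>
      ⟨k + 2, hpos k, by linarith [hpos k, (Nat.cast_nonneg k : (0 : ℝ) ≤ k)], by
        rw [sub_sub_cancel, div_mul_cancel₀ _ (omega3_sub_ofReal_ne_zero (hpos k))]⟩
  intro k m h
  replace h := sub_right_injective h
  rw [div_eq_div_iff (omega3_sub_ofReal_ne_zero (hpos k)) (omega3_sub_ofReal_ne_zero (hpos m)),
    omega3_inv] at h
  push_cast at h
  have h1 : ((k : ℂ) - m) * (omega3 ^ 2 - omega3) = 0 := by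
    linear_combination -h
  exact_mod_cast sub_eq_zero.1 ((mul_eq_zero.1 h1).resolve_right omega3_sq_sub_ne_zero)

/-- Two polynomials that agree on a product of infinite sets are equal. -/
theorem refinedASMPoly_eq (n : ℕ) : refinedASMPoly n = asmIntegralPoly n := by
  refine MvPolynomial.funext_set
    ![{x : ℂ | ∃ a : ℝ, 0 < a ∧ a ≠ 1 ∧ omega3 - omega3 ^ 2 * a = x * (omega3 * a - omega3⁻¹)},
      {y : ℂ | ∃ b : ℝ, 0 < b ∧ b ≠ 1 ∧ (b : ℂ) - 1 = (1 - y) * (omega3 - omega3⁻¹ * b)}] ?_ ?_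
  · exact Fin.forall_fin_two.2 ⟨infinite_firstRow_values, infinite_lastRow_values⟩
  · intro z hz
    obtain ⟨a, ha, ha1, hx⟩ := hz 0 (Set.mem_univ _)
    obtain ⟨b, hb, hb1, hy⟩ := hz 1 (Set.mem_univ _)
    have hz2 : z = ![z 0, z 1] := by
      ext i
      fin_cases i <;> rfl
    obtain ⟨Γ, hΓ, h⟩ := exists_refinedASM_eq_iterated n ha ha1 hb hb1 hx hy
    rw [hz2, eval_refinedASMPoly, h, iterated_asmIntegrand fun _ => hΓ]

theorem refinedASM_eq_iterated (n : ℕ) (x y : ℂ) (Γ : Fin n → Contour)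
    (hΓ : ∀ l, (Γ l).Separates {0} {p : ℂ | 1 + p * (1 - y) = 0}) :
    refinedASM n x y = Contour.iterated n Γ (asmIntegrand n x y) := by
  rw [iterated_asmIntegrand hΓ, ← refinedASMPoly_eq, eval_refinedASMPoly]

end RefinedEnumerationFormula

end

theorem mainTheorem2 :
    (∀ (n : ℕ) (z : Fin (2 * n) → ℂ) (Γ : Fin n → Contour), AdmissibleContours omega3 n z Γ →
      normalizedZ omega3 n z = contourZ omega3 n z Γ) ∧
    (∃ P : (n : ℕ) → MvPolynomial (Fin (2 * n)) ℂ,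
      (∀ (n : ℕ) (z : Fin (2 * n) → ℂ) (Γ : Fin n → Contour), AdmissibleContours omega3 n z Γ →
        contourZ omega3 n z Γ = MvPolynomial.eval z (P n)) ∧
      (∀ (n : ℕ) (z : Fin (2 * n) → ℂ), (∀ i, z i ≠ 0) →
        normalizedZ omega3 n z = MvPolynomial.eval z (P n)) ∧
      (∀ (n : ℕ) (i : Fin (2 * n)), (P n).degreeOf i = n - 1) ∧
      (∀ (n : ℕ) (z : Fin (2 * n) → ℂ) (i j k : Fin (2 * n)), i < j → j < k →
        z j = omega3 ^ 2 * z i → z k = omega3 ^ 4 * z i → MvPolynomial.eval z (P n) = 0) ∧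
      (∀ (n : ℕ) (z : Fin (2 * (n + 1)) → ℂ) (i : Fin (2 * n + 2)) (j : Fin (2 * n + 1)),
        z (i.succAbove j) = omega3 ^ 2 * z i →
        MvPolynomial.eval z (P (n + 1)) =
          (∏ k : Fin (2 * n), (omega3 * z i - z (i.succAbove (j.succAbove k)))) *
            MvPolynomial.eval (fun k : Fin (2 * n) => z (i.succAbove (j.succAbove k))) (P n)) ∧
      (∀ (n : ℕ) (ε : Fin (2 * n) → ℤ), (∀ i, ε i = 1 ∨ ε i = -1) → ∑ i, ε i = 0 →
        (∀ j, ∑ i with i ≤ j, ε i ≤ 0) →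
        MvPolynomial.eval (fun i => omega3 ^ ε i) (P n) = 3 ^ n.choose 2)) ∧
    (∀ (n : ℕ) (x y : ℂ) (Γ : Fin n → Contour),
      (∀ l, (Γ l).Separates {0} {p : ℂ | 1 + p * (1 - y) = 0}) →
      refinedASM n x y = Contour.iterated n Γ (asmIntegrand n x y)) := by
  refine ⟨fun n z Γ hΓ => ?_, ⟨sixVertexPoly, fun n z Γ hΓ => contourZ_eq_eval_sixVertexPoly hΓ,
    normalizedZ_eq_eval, degreeOf_sixVertexPoly, fun n z i j k hij hjk hj hk => ?_,
    sixVertexPoly_recursion, sixVertexPoly_dyck⟩, ?_⟩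
  · rw [normalizedZ_eq_eval n z hΓ.ne_zero, contourZ_eq_eval_sixVertexPoly hΓ]
  -- Here q ^ 4 = q.
  · refine sixVertexPoly_wheel n z hij.ne (hij.trans hjk).ne hjk.ne hj ?_
    rw [hk]
    linear_combination omega3 * z i * omega3_pow_three
  · exact refinedASM_eq_iterated
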